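/- Let $G$ be a finite group and let $A$ be a separable C*-algebra with $A\cong M_{|G|^\infty}\otimes A$, where $M_{|G|^\infty}$ denotes the UHF algebra $\varinjlim M_{|G|^k}(\mathbb C)$. Assume that $A$ is unital, or stable (i.e. $A\cong\mathcal K\otimes A$ with $\mathcal K$ the compact operators on a separable infinite-dimensional Hilbert space), or of stable rank one (i.e. the invertible elements of $\tilde A$ are dense in $\tilde A$). Notation. $\tilde A$ is the unitization of $A$, with $\tilde A=A$ if $A$ is unital. For $*$-homomorphisms $\varphi,\psi$ from $A$ to $A$, write $\varphi\approx_u\psi$ if there are unitaries $u_n\in\tilde A$ with $\psi(a)=\lim_n u_n\varphi(a)u_n^*$ for all $a\in A$; the quotient $\mathrm{Aut}(A)/{\approx_u}$ is a group under $[\theta_1][\theta_2]=[\theta_1\circ\theta_2]$. Let $A_\infty=\ell^\infty(\mathbb N,A)/c_0(\mathbb N,A)$, with $A\subset A_\infty$ as constant sequences, and let $F_\infty(A)=(A_\infty\cap A')/\mathrm{Ann}(A,A_\infty)$, where $\mathrm{Ann}(A,A_\infty)=\{x\in A_\infty : xb=bx=0 \text{ for all } b\in A\}$. An action $\alpha\colon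 G\to\mathrm{Aut}(A)$ is a Rokhlin action if there is a unital $*$-homomorphism $C(G)\to F_\infty(A)$ that is equivariant for the $G$-shift on $C(G)$ and the action $\alpha_\infty$ on $F_\infty(A)$ induced by componentwise application of $\alpha$. Let $\mathcal R_G(A)$ be the set of Rokhlin actions of $G$ on $A$, and let $\overline{\mathcal R}_G(A)$ be the set of their conjugacy classes, where $\alpha$ and $\beta$ are conjugate if there is $\sigma\in\mathrm{Aut}(A)$ with $\beta_g=\sigma\circ\alpha_g\circ\sigma^{-1}$ for all $g\in G$. For groups $H_1,H_2$, let $\overline{\mathrm{Hom}}(H_1,H_2)$ be the set of group homomorphisms $H_1\to H_2$ modulo conjugation by elements of $H_2$. Then the natural map $$\mathcal R_G(A)\longrightarrow \mathrm{Hom}(G,\mathrm{Aut}(A)/{\approx_u}),\qquad \alpha\longmapsto[\,g\mapsto[\alpha_g]\,]$$ is surjective, and it induces a bijection $$\overline{\mathcal R}_G(A)\longrightarrow\overline{\mathrm{Hom}}(G,\mathrm{Aut}(A)/{\approx_u}).$$ -/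

import Mathlib

open Filter Topology
open scoped ENNReal

noncomputable section

namespace CStarRokhlin

/-! ### Quotients of `*`-algebras by `*`-ideals -/

/-- A two-sided, star-closed ideal (and linear subspace) of a possibly non-unital complex
`*`-algebra. -/
structure StarIdeal (R : Type*) [NonUnitalRing R] [StarRing R] [Module ℂ R] extends
    Submodule ℂ R where
  mul_mem_left' : ∀ x y : R, y ∈ carrier → x * y ∈ carrier
  mul_mem_right' : ∀ x y : R, x ∈ carrier → x * y ∈ carrier
  star_mem' : ∀ x : R, x ∈ carrier → star x ∈ carrier

namespace StarIdeal

variable {R : Type*} [NonUnitalRing R] [StarRing R] [Module ℂ R]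

/-- The quotient of a `*`-algebra by a `*`-ideal. -/
def Quot (I : StarIdeal R) : Type _ := R ⧸ I.toSubmodule

/-- The class of an element in the quotient. -/
def cls (I : StarIdeal R) (x : R) : I.Quot := Submodule.Quotient.mk x

instance (I : StarIdeal R) : AddCommGroup I.Quot :=
  inferInstanceAs (AddCommGroup (R ⧸ I.toSubmodule))

instance (I : StarIdeal R) : Module ℂ I.Quot :=
  inferInstanceAs (Module ℂ (R ⧸ I.toSubmodule))

theorem cls_surjective (I : StarIdeal R) : Function.Surjective I.cls :=
  Submodule.Quotient.mk_surjective _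

theorem cls_eq_cls (I : StarIdeal R) {x y : R} : I.cls x = I.cls y ↔ x - y ∈ I.toSubmodule :=
  Submodule.Quotient.eq _

instance (I : StarIdeal R) : Mul I.Quot where
  mul := Quotient.map₂ (· * ·) (by
    intro a₁ a₂ ha b₁ b₂ hb
    have ha' := (Submodule.quotientRel_def _).1 ha
    have hb' := (Submodule.quotientRel_def _).1 hb
    refine (Submodule.quotientRel_def _).2 ?_
    have : a₁ * b₁ - a₂ * b₂ = (a₁ - a₂) * b₁ + a₂ * (b₁ - b₂) := by
      rw [sub_mul, mul_sub]; abel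
    rw [this]
    exact I.toSubmodule.add_mem (I.mul_mem_right' _ _ ha') (I.mul_mem_left' _ _ hb'))

instance (I : StarIdeal R) : Star I.Quot where
  star := Quotient.map star (by
    intro a b hab
    have h := (Submodule.quotientRel_def _).1 hab
    refine (Submodule.quotientRel_def _).2 ?_
    rw [← star_sub]
    exact I.star_mem' _ h)

theorem cls_add (I : StarIdeal R) (x y : R) : I.cls (x + y) = I.cls x + I.cls y := rfl
theorem cls_smul (I : StarIdeal R) (c : ℂ) (x : R) : I.cls (c • x) = c • I.cls x := rfl
theorem cls_mul (I : StarIdeal R) (x y : R) : I.cls (x * y) = I.cls x * I.cls y := rfl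
theorem cls_star (I : StarIdeal R) (x : R) : I.cls (star x) = star (I.cls x) := rfl
theorem cls_zero (I : StarIdeal R) : I.cls 0 = 0 := rfl

instance (I : StarIdeal R) : NonUnitalRing I.Quot where
  __ := (inferInstance : AddCommGroup I.Quot)
  __ := (inferInstance : Mul I.Quot)
  left_distrib a b c := by
    obtain ⟨a, rfl⟩ := I.cls_surjective a
    obtain ⟨b, rfl⟩ := I.cls_surjective b
    obtain ⟨c, rfl⟩ := I.cls_surjective c
    exact congrArg I.cls (mul_add a b c)
  right_distrib a b c := by
    obtain ⟨a, rfl⟩ := I.cls_surjective a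
    obtain ⟨b, rfl⟩ := I.cls_surjective b
    obtain ⟨c, rfl⟩ := I.cls_surjective c
    exact congrArg I.cls (add_mul a b c)
  zero_mul a := by
    obtain ⟨a, rfl⟩ := I.cls_surjective a
    exact congrArg I.cls (zero_mul a)
  mul_zero a := by
    obtain ⟨a, rfl⟩ := I.cls_surjective a
    exact congrArg I.cls (mul_zero a)
  mul_assoc a b c := by
    obtain ⟨a, rfl⟩ := I.cls_surjective a
    obtain ⟨b, rfl⟩ := I.cls_surjective b
    obtain ⟨c, rfl⟩ := I.cls_surjective c
    exact congrArg I.cls (mul_assoc a b c)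

instance (I : StarIdeal R) : StarRing I.Quot where
  star_involutive a := by
    obtain ⟨a, rfl⟩ := I.cls_surjective a
    exact congrArg I.cls (star_star a)
  star_mul a b := by
    obtain ⟨a, rfl⟩ := I.cls_surjective a
    obtain ⟨b, rfl⟩ := I.cls_surjective b
    exact congrArg I.cls (star_mul a b)
  star_add a b := by
    obtain ⟨a, rfl⟩ := I.cls_surjective a
    obtain ⟨b, rfl⟩ := I.cls_surjective b
    exact congrArg I.cls (star_add a b)

instance [StarModule ℂ R] (I : StarIdeal R) : StarModule ℂ I.Quot where
  star_smul c a := by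
    obtain ⟨a, rfl⟩ := I.cls_surjective a
    exact congrArg I.cls (star_smul c a)

instance [IsScalarTower ℂ R R] (I : StarIdeal R) : IsScalarTower ℂ I.Quot I.Quot where
  smul_assoc c a b := by
    obtain ⟨a, rfl⟩ := I.cls_surjective a
    obtain ⟨b, rfl⟩ := I.cls_surjective b
    exact congrArg I.cls (smul_assoc c a b)

instance [SMulCommClass ℂ R R] (I : StarIdeal R) : SMulCommClass ℂ I.Quot I.Quot where
  smul_comm c a b := by
    obtain ⟨a, rfl⟩ := I.cls_surjective a
    obtain ⟨b, rfl⟩ := I.cls_surjective b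
    exact congrArg I.cls (smul_comm c a b)

/-- The quotient map as a `*`-homomorphism. -/
def mkHom (I : StarIdeal R) : R →⋆ₙₐ[ℂ] I.Quot where
  toFun := I.cls
  map_smul' _ _ := rfl
  map_zero' := rfl
  map_add' _ _ := rfl
  map_mul' _ _ := rfl
  map_star' _ := rfl

/-- The `*`-homomorphism between quotients induced by a `*`-homomorphism that maps one ideal into
the other. -/
def mapQuot {S : Type*} [NonUnitalRing S] [StarRing S] [Module ℂ S] (I : StarIdeal R)
    (J : StarIdeal S) (f : R →⋆ₙₐ[ℂ] S) (h : ∀ x ∈ I.toSubmodule, f x ∈ J.toSubmodule) :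
    I.Quot →⋆ₙₐ[ℂ] J.Quot where
  toFun := Quotient.map f (by
    intro a b hab
    have h' := (Submodule.quotientRel_def _).1 hab
    refine (Submodule.quotientRel_def _).2 ?_
    rw [← map_sub]
    exact h _ h')
  map_smul' c a := by
    obtain ⟨a, rfl⟩ := I.cls_surjective a
    exact congrArg J.cls (map_smul f c a)
  map_zero' := congrArg J.cls (map_zero f)
  map_add' a b := by
    obtain ⟨a, rfl⟩ := I.cls_surjective a
    obtain ⟨b, rfl⟩ := I.cls_surjective b
    exact congrArg J.cls (map_add f a b)
  map_mul' a b := by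
    obtain ⟨a, rfl⟩ := I.cls_surjective a
    obtain ⟨b, rfl⟩ := I.cls_surjective b
    exact congrArg J.cls (map_mul f a b)
  map_star' a := by
    obtain ⟨a, rfl⟩ := I.cls_surjective a
    exact congrArg J.cls (map_star f a)

theorem mapQuot_cls {S : Type*} [NonUnitalRing S] [StarRing S] [Module ℂ S] (I : StarIdeal R)
    (J : StarIdeal S) (f : R →⋆ₙₐ[ℂ] S) (h : ∀ x ∈ I.toSubmodule, f x ∈ J.toSubmodule) (x : R) :
    mapQuot I J f h (I.cls x) = J.cls (f x) := rfl

end StarIdeal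

/-! ### Sequence algebras `∏ Aₖ / ⨁ Aₖ` -/

section SeqAlg

variable (A : ℕ → Type*) [∀ k, NonUnitalCStarAlgebra (A k)]

/-- The ideal of null sequences in the C⋆-algebra `lp A ∞` of bounded sequences. -/
def nullSeq : StarIdeal (lp A ∞) where
  carrier := {x | Tendsto (fun k => ‖x k‖) atTop (𝓝 0)}
  zero_mem' := by simp
  add_mem' {x y} hx hy := by
    refine squeeze_zero (fun k => norm_nonneg _) (fun k => norm_add_le (x k) (y k)) ?_
    simpa using hx.add hy
  smul_mem' c x hx := by
    have h : ∀ k, ‖(c • x) k‖ = ‖c‖ * ‖x k‖ := fun k => norm_smul c (x k)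
    change Tendsto (fun k => ‖(c • x) k‖) atTop (𝓝 0)
    simp only [h]
    simpa using Tendsto.const_mul ‖c‖ hx
  mul_mem_left' x y hy := by
    refine squeeze_zero (fun k => norm_nonneg _) (fun k => (norm_mul_le (x k) (y k)).trans
      (mul_le_mul_of_nonneg_right (lp.norm_apply_le_norm ENNReal.top_ne_zero x k)
        (norm_nonneg _))) ?_
    simpa using hy.const_mul ‖x‖
  mul_mem_right' x y hx := by
    refine squeeze_zero (fun k => norm_nonneg _) (fun k => (norm_mul_le (x k) (y k)).trans
      (mul_le_mul_of_nonneg_left (lp.norm_apply_le_norm ENNReal.top_ne_zero y k)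
        (norm_nonneg _))) ?_
    simpa using hx.mul_const ‖y‖
  star_mem' x hx := by
    have h : ∀ k, ‖(star x) k‖ = ‖x k‖ := fun k => norm_star (x k)
    simpa [h] using hx

theorem mem_nullSeq {x : lp A ∞} :
    x ∈ (nullSeq A).toSubmodule ↔ Tendsto (fun k => ‖x k‖) atTop (𝓝 0) := Iff.rfl

/-- The sequence algebra `∏ Aₖ / ⨁ Aₖ`: bounded sequences modulo null sequences. -/
abbrev SeqAlg : Type _ := (nullSeq A).Quot

/-- The class of a bounded sequence. -/
def seqMk : lp A ∞ →⋆ₙₐ[ℂ] SeqAlg A := (nullSeq A).mkHom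

theorem seqMk_surjective : Function.Surjective (seqMk A) := (nullSeq A).cls_surjective

theorem seqMk_eq_seqMk {x y : lp A ∞} :
    seqMk A x = seqMk A y ↔ Tendsto (fun k => ‖x k - y k‖) atTop (𝓝 0) :=
  (nullSeq A).cls_eq_cls

instance isClosed_nullSeq : IsClosed ((nullSeq A).toSubmodule : Set (lp A ∞)) := by
  rw [← isSeqClosed_iff_isClosed]
  intro u x hu hx
  change Tendsto (fun k => ‖x k‖) atTop (𝓝 0)
  rw [Metric.tendsto_atTop]
  intro ε hε
  obtain ⟨N, hN⟩ := (Metric.tendsto_atTop.1 hx) (ε / 2) (half_pos hε)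
  obtain ⟨M, hM⟩ := (Metric.tendsto_atTop.1 (hu N)) (ε / 2) (half_pos hε)
  refine ⟨M, fun k hk => ?_⟩
  have h1 : ‖u N k - x k‖ ≤ ‖u N - x‖ :=
    lp.norm_apply_le_norm ENNReal.top_ne_zero (u N - x) k
  have h2 := hN N le_rfl
  have h3 := hM k hk
  rw [dist_eq_norm] at h2
  simp only [dist_zero_right, norm_norm] at h3 ⊢
  have h4 : ‖x k‖ ≤ ‖u N k‖ + ‖u N k - x k‖ := norm_le_norm_add_norm_sub _ _
  linarith

/-- The quotient norm on the sequence algebra. -/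
instance : NormedAddCommGroup (SeqAlg A) :=
  inferInstanceAs (NormedAddCommGroup (lp A ∞ ⧸ (nullSeq A).toSubmodule))

instance : NormedSpace ℂ (SeqAlg A) :=
  inferInstanceAs (NormedSpace ℂ (lp A ∞ ⧸ (nullSeq A).toSubmodule))

instance : CompleteSpace (SeqAlg A) :=
  inferInstanceAs (CompleteSpace (lp A ∞ ⧸ (nullSeq A).toSubmodule))

theorem norm_seqMk_le (x : lp A ∞) : ‖seqMk A x‖ ≤ ‖x‖ :=
  Submodule.Quotient.norm_mk_le _ x

theorem exists_norm_lt (x : SeqAlg A) {ε : ℝ} (hε : 0 < ε) :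
    ∃ y, seqMk A y = x ∧ ‖y‖ < ‖x‖ + ε :=
  Submodule.Quotient.norm_mk_lt x hε

/-- The quotient norm is bounded by every eventual bound of the sequence. -/
theorem norm_seqMk_le_of_eventually (x : lp A ∞) {C : ℝ} (hC : 0 ≤ C)
    (h : ∀ᶠ k in atTop, ‖x k‖ ≤ C) : ‖seqMk A x‖ ≤ C := by
  obtain ⟨N, hN⟩ := eventually_atTop.1 h
  let f : ∀ k, A k := fun k => if N ≤ k then x k else 0
  have hf : ∀ k, ‖f k‖ ≤ C := by
    intro k
    by_cases hk : N ≤ k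
    · simpa [f, hk] using hN k hk
    · simpa [f, hk] using hC
  have hmem : Memℓp f ∞ := memℓp_infty ⟨C, by rintro _ ⟨k, rfl⟩; exact hf k⟩
  have heq : seqMk A x = seqMk A ⟨f, hmem⟩ := by
    rw [seqMk_eq_seqMk]
    refine tendsto_const_nhds.congr' ?_
    filter_upwards [eventually_ge_atTop N] with k hk
    simp [f, hk]
  rw [heq]
  exact (norm_seqMk_le A _).trans (lp.norm_le_of_forall_le hC hf)

/-- `∏ Aₖ / ⨁ Aₖ` is a C⋆-algebra. -/
instance : NonUnitalCStarAlgebra (SeqAlg A) where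
  __ := (inferInstance : NonUnitalRing (SeqAlg A))
  __ := (inferInstance : NormedAddCommGroup (SeqAlg A))
  __ := (inferInstance : StarRing (SeqAlg A))
  __ := (inferInstance : NormedSpace ℂ (SeqAlg A))
  __ := (inferInstance : CompleteSpace (SeqAlg A))
  __ := (inferInstance : IsScalarTower ℂ (SeqAlg A) (SeqAlg A))
  __ := (inferInstance : SMulCommClass ℂ (SeqAlg A) (SeqAlg A))
  __ := (inferInstance : StarModule ℂ (SeqAlg A))
  norm_mul_le x y := by
    refine le_of_forall_pos_le_add fun δ hδ => ?_
    have ht : Tendsto (fun ε : ℝ => (‖x‖ + ε) * (‖y‖ + ε)) (𝓝[>] 0) (𝓝 (‖x‖ * ‖y‖)) := by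
      have : Continuous fun ε : ℝ => (‖x‖ + ε) * (‖y‖ + ε) := by fun_prop
      simpa using (this.tendsto 0).mono_left nhdsWithin_le_nhds
    obtain ⟨ε, hε, hε0⟩ := ((ht.eventually (gt_mem_nhds (lt_add_of_pos_right _ hδ))).and
      self_mem_nhdsWithin).exists
    obtain ⟨a, rfl, ha⟩ := exists_norm_lt A x hε0
    obtain ⟨b, rfl, hb⟩ := exists_norm_lt A y hε0
    have h1 : ‖seqMk A a * seqMk A b‖ ≤ ‖a * b‖ := norm_seqMk_le A (a * b)
    have h2 : ‖a * b‖ ≤ ‖a‖ * ‖b‖ := norm_mul_le a b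
    have h3 : ‖a‖ * ‖b‖ ≤ (‖seqMk A a‖ + ε) * (‖seqMk A b‖ + ε) :=
      mul_le_mul ha.le hb.le (norm_nonneg _) ((norm_nonneg _).trans ha.le)
    linarith
  norm_mul_self_le x := by
    refine le_of_forall_pos_le_add fun δ hδ => ?_
    obtain ⟨a, rfl⟩ := seqMk_surjective A x
    obtain ⟨b, hb, hlt⟩ := exists_norm_lt A (star (seqMk A a) * seqMk A a) (half_pos hδ)
    have hb' : seqMk A (star a * a) = seqMk A b := by
      rw [hb, map_mul, map_star]
    have h0 := (seqMk_eq_seqMk A).1 hb'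
    set C := ‖star (seqMk A a) * seqMk A a‖ + δ with hC
    have hC0 : 0 ≤ C := add_nonneg (norm_nonneg _) hδ.le
    have hev : ∀ᶠ k in atTop, ‖a k‖ ≤ Real.sqrt C := by
      filter_upwards [h0.eventually (gt_mem_nhds (half_pos hδ))] with k hk
      apply Real.le_sqrt_of_sq_le
      have h1 : ‖(star a * a) k‖ = ‖a k‖ * ‖a k‖ := CStarRing.norm_star_mul_self (x := a k)
      have h2 : ‖b k‖ ≤ ‖b‖ := lp.norm_apply_le_norm ENNReal.top_ne_zero b k
      have h3 : ‖(star a * a) k‖ ≤ ‖b k‖ + ‖(star a * a) k - b k‖ :=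
        norm_le_norm_add_norm_sub' _ _
      rw [pow_two]
      linarith
    have h5 := norm_seqMk_le_of_eventually A a (Real.sqrt_nonneg _) hev
    calc ‖seqMk A a‖ * ‖seqMk A a‖ ≤ Real.sqrt C * Real.sqrt C :=
          mul_le_mul h5 h5 (norm_nonneg _) (Real.sqrt_nonneg _)
      _ = C := Real.mul_self_sqrt hC0

end SeqAlg

/-! ### Inductive limits -/

section Limit

variable (A : ℕ → Type*) [∀ k, NonUnitalCStarAlgebra (A k)] (φ : ∀ k, A k →⋆ₙₐ[ℂ] A (k + 1))

/-- The bounded sequences `x` with `x (k + 1) = φ k (x k)` for all large `k`. -/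
def compatSeq : NonUnitalStarSubalgebra ℂ (lp A ∞) where
  carrier := {x | ∀ᶠ k in atTop, x (k + 1) = φ k (x k)}
  zero_mem' := Eventually.of_forall fun k => (map_zero (φ k)).symm
  add_mem' {x y} hx hy := by
    filter_upwards [hx, hy] with k h1 h2
    change x (k + 1) + y (k + 1) = φ k (x k + y k)
    rw [map_add, h1, h2]
  mul_mem' {x y} hx hy := by
    filter_upwards [hx, hy] with k h1 h2
    change x (k + 1) * y (k + 1) = φ k (x k * y k)
    rw [map_mul, h1, h2]
  smul_mem' c x hx := by
    filter_upwards [hx] with k h1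
    change c • x (k + 1) = φ k (c • x k)
    rw [map_smul, h1]
  star_mem' {x} hx := by
    filter_upwards [hx] with k h1
    change star (x (k + 1)) = φ k (star (x k))
    rw [map_star, h1]

/-- The C⋆-algebraic inductive limit of `A 0 → A 1 → A 2 → ⋯`, in its standard realization inside
`∏ Aₖ / ⨁ Aₖ`: the closure of the classes of sequences `(0, …, 0, a, φₙ a, φₙ₊₁ (φₙ a), …)`. -/
def seqLimit : NonUnitalStarSubalgebra ℂ (SeqAlg A) :=
  ((compatSeq A φ).map (seqMk A)).topologicalClosure

end Limit

/-! ### Matrix amplifications, tensoring with UHF algebras and with the compact operators -/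

section Matrix

/-- The C⋆-algebra `M_ι(A) = M_ι ⊗ A` of matrices over a C⋆-algebra `A`. -/
def MatrixAlg (ι : Type*) (A : Type*) : Type _ := CStarMatrix ι ι A

/-- The C⋆-algebra structure of `CStarMatrix`, which Mathlib provides for a C⋆-algebra `A` with its
canonical order. -/
instance (ι : Type*) (A : Type*) [Fintype ι] [NonUnitalCStarAlgebra A] :
    NonUnitalCStarAlgebra (MatrixAlg ι A) :=
  letI := CStarAlgebra.spectralOrder A
  haveI := CStarAlgebra.spectralOrderedRing A
  inferInstanceAs (NonUnitalCStarAlgebra (CStarMatrix ι ι A))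

namespace MatrixAlg

variable {ι A : Type*}

/-- The matrix with given entries. -/
def of (f : ι → ι → A) : MatrixAlg ι A := CStarMatrix.ofMatrix f

/-- The entries of a matrix. -/
def entry (x : MatrixAlg ι A) (i j : ι) : A := CStarMatrix.ofMatrix.symm x i j

theorem ext {x y : MatrixAlg ι A} (h : ∀ i j, x.entry i j = y.entry i j) : x = y :=
  CStarMatrix.ext h

@[simp] theorem entry_of (f : ι → ι → A) (i j : ι) : (of f).entry i j = f i j := rfl

variable [Fintype ι] [NonUnitalCStarAlgebra A]

@[simp] theorem entry_zero (i j : ι) : (0 : MatrixAlg ι A).entry i j = 0 := rfl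
@[simp] theorem entry_add (x y : MatrixAlg ι A) (i j : ι) :
    (x + y).entry i j = x.entry i j + y.entry i j := rfl
@[simp] theorem entry_smul (c : ℂ) (x : MatrixAlg ι A) (i j : ι) :
    (c • x).entry i j = c • x.entry i j := rfl
@[simp] theorem entry_mul (x y : MatrixAlg ι A) (i j : ι) :
    (x * y).entry i j = ∑ l, x.entry i l * y.entry l j := rfl
@[simp] theorem entry_star (x : MatrixAlg ι A) (i j : ι) :
    (star x).entry i j = star (x.entry j i) := rfl

end MatrixAlg

variable (A : Type*) [NonUnitalCStarAlgebra A]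

/-- The embedding `M_{n^k}(A) → M_{n^(k+1)}(A) = M_{n^k}(A) ⊗ M_n`, `x ↦ x ⊗ 1`, where `M_{n^k}` is
indexed by `Fin k → Fin n`. -/
def amplify (n k : ℕ) :
    MatrixAlg (Fin k → Fin n) A →⋆ₙₐ[ℂ] MatrixAlg (Fin (k + 1) → Fin n) A where
  toFun x := .of fun i j =>
    if i (Fin.last k) = j (Fin.last k) then x.entry (Fin.init i) (Fin.init j) else 0
  map_smul' c x := MatrixAlg.ext fun i j => by simp
  map_zero' := MatrixAlg.ext fun i j => by simp
  map_add' x y := MatrixAlg.ext fun i j => by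
    simp only [MatrixAlg.entry_of, MatrixAlg.entry_add]
    split_ifs <;> simp
  map_mul' x y := MatrixAlg.ext fun i j => by
    simp only [MatrixAlg.entry_of, MatrixAlg.entry_mul]
    let e : Fin n × (Fin k → Fin n) ≃ (Fin (k + 1) → Fin n) := Fin.snocEquiv fun _ => Fin n
    have h1 : ∀ q, e q (Fin.last k) = q.1 := fun q => Fin.snoc_last (α := fun _ => Fin n) q.1 q.2
    have h2 : ∀ q, Fin.init (e q) = q.2 := fun q => Fin.init_snoc (α := fun _ => Fin n) q.1 q.2
    rw [← e.sum_comp, Fintype.sum_prod_type]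
    simp only [h1, h2]
    rw [Finset.sum_eq_single (i (Fin.last k))]
    · by_cases h : i (Fin.last k) = j (Fin.last k) <;> simp [h]
    · intro b _ hb
      simp [Ne.symm hb]
    · simp
  map_star' x := MatrixAlg.ext fun i j => by
    simp only [MatrixAlg.entry_of, MatrixAlg.entry_star]
    by_cases h : i (Fin.last k) = j (Fin.last k)
    · simp [h]
    · simp [h, Ne.symm h]

/-- The tensor product `M_{n^∞} ⊗ A` of `A` with the UHF algebra `M_{n^∞} = lim M_{n^k}`, realized
as the inductive limit of the algebras `M_{n^k} ⊗ A = M_{n^k}(A)` along `x ↦ x ⊗ 1`. -/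
def uhfTensor (n : ℕ) :
    NonUnitalStarSubalgebra ℂ (SeqAlg fun k => MatrixAlg (Fin k → Fin n) A) :=
  seqLimit (fun k => MatrixAlg (Fin k → Fin n) A) (amplify A n)

/-- The embedding `M_k(A) → M_{k+1}(A)` as the upper left corner, `x ↦ x ⊕ 0`. -/
def corner (k : ℕ) : MatrixAlg (Fin k) A →⋆ₙₐ[ℂ] MatrixAlg (Fin (k + 1)) A where
  toFun x := .of fun i j =>
    if h : (i : ℕ) < k ∧ (j : ℕ) < k then x.entry ⟨i, h.1⟩ ⟨j, h.2⟩ else 0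
  map_smul' c x := MatrixAlg.ext fun i j => by simp
  map_zero' := MatrixAlg.ext fun i j => by simp
  map_add' x y := MatrixAlg.ext fun i j => by
    simp only [MatrixAlg.entry_of, MatrixAlg.entry_add]
    split_ifs <;> simp
  map_mul' x y := MatrixAlg.ext fun i j => by
    simp only [MatrixAlg.entry_of, MatrixAlg.entry_mul]
    rw [Fin.sum_univ_castSucc]
    by_cases hi : (i : ℕ) < k <;> by_cases hj : (j : ℕ) < k <;> simp [hi, hj]
  map_star' x := MatrixAlg.ext fun i j => by
    simp only [MatrixAlg.entry_of, MatrixAlg.entry_star]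
    by_cases hi : (i : ℕ) < k <;> by_cases hj : (j : ℕ) < k <;> simp [hi, hj]

/-- The stabilization `𝒦 ⊗ A`, where `𝒦 = lim M_k` is the algebra of compact operators on a
separable infinite-dimensional Hilbert space, realized as the inductive limit of the algebras
`M_k ⊗ A = M_k(A)` along the corner embeddings. -/
def stabilization : NonUnitalStarSubalgebra ℂ (SeqAlg fun k => MatrixAlg (Fin k) A) :=
  seqLimit (fun k => MatrixAlg (Fin k) A) (corner A)

/-- `A ≅ M_{n^∞} ⊗ A`. -/
def AbsorbsUHF (n : ℕ) : Prop := Nonempty (A ≃⋆ₐ[ℂ] uhfTensor A n)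

/-- `A` is unital. -/
def IsUnitalAlg : Prop := ∃ e : A, ∀ a : A, e * a = a ∧ a * e = a

/-- `A` is stable: `A ≅ 𝒦 ⊗ A`. -/
def IsStableAlg : Prop := Nonempty (A ≃⋆ₐ[ℂ] stabilization A)

/-- `A` has (topological) stable rank one: the invertible elements of the unitization are dense.
(If `A` has a unit `e`, then `Unitization ℂ A ≅ A × ℂ`, and this holds if and only if the invertible
elements of `A` are dense.) -/
def HasStableRankOne : Prop := Dense {x : Unitization ℂ A | IsUnit x}

end Matrix

/-! ### Approximate unitary equivalence -/

section ApproxUnitary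

variable {A B : Type*} [NonUnitalCStarAlgebra A] [NonUnitalCStarAlgebra B]

/-- Approximate unitary equivalence of `*`-homomorphisms `φ, ψ : A → B`, by unitaries of the
unitization of `B`. (If `B` has a unit `e`, then `Unitization ℂ B ≅ B × ℂ`, and conjugation by a
unitary `(u, z)` acts on `B` as conjugation by `u`; so unitaries of `B` give the same notion.) -/
def ApproxUnitarilyEquiv (φ ψ : A →⋆ₙₐ[ℂ] B) : Prop :=
  ∃ u : ℕ → unitary (Unitization ℂ B), ∀ a : A,
    Tendsto (fun n => (u n : Unitization ℂ B) * (φ a : Unitization ℂ B) *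
      star (u n : Unitization ℂ B)) atTop (𝓝 (ψ a : Unitization ℂ B))

theorem norm_conj_unitary (u : unitary (Unitization ℂ B)) (x : Unitization ℂ B) :
    ‖(u : Unitization ℂ B) * x * star (u : Unitization ℂ B)‖ = ‖x‖ := by
  rw [← Unitary.coe_star, CStarRing.norm_mul_coe_unitary, CStarRing.norm_coe_unitary_mul]

/-- For separable `A`, approximate unitary equivalence can be tested on finite sets. -/
theorem approxUnitarilyEquiv_iff [TopologicalSpace.SeparableSpace A] {φ ψ : A →⋆ₙₐ[ℂ] B} :
    ApproxUnitarilyEquiv φ ψ ↔ ∀ (F : Finset A) (ε : ℝ), 0 < ε →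
      ∃ u : unitary (Unitization ℂ B), ∀ a ∈ F,
        ‖(u : Unitization ℂ B) * (φ a : Unitization ℂ B) * star (u : Unitization ℂ B) -
          (ψ a : Unitization ℂ B)‖ < ε := by
  constructor
  · rintro ⟨u, hu⟩ F ε hε
    have h : ∀ᶠ n in atTop, ∀ a ∈ F, ‖(u n : Unitization ℂ B) * (φ a : Unitization ℂ B) *
        star (u n : Unitization ℂ B) - (ψ a : Unitization ℂ B)‖ < ε := by
      rw [eventually_all_finset]
      intro a _
      have := (Metric.tendsto_nhds.1 (hu a)) ε hε
      simpa [dist_eq_norm] using this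
    obtain ⟨n, hn⟩ := h.exists
    exact ⟨u n, hn⟩
  · intro h
    classical
    let d : ℕ → A := TopologicalSpace.denseSeq A
    choose u hu using fun n : ℕ =>
      h ((Finset.range (n + 1)).image d) (1 / ((n : ℝ) + 1)) (by positivity)
    refine ⟨u, fun a => ?_⟩
    rw [Metric.tendsto_atTop]
    intro ε hε
    obtain ⟨m, hm⟩ := Metric.denseRange_iff.1 (TopologicalSpace.denseRange_denseSeq A) a (ε / 3)
      (by positivity)
    obtain ⟨N, hN⟩ := exists_nat_one_div_lt (show (0 : ℝ) < ε / 3 by positivity)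
    refine ⟨max m N, fun n hn => ?_⟩
    have hmn : m ≤ n := (le_max_left _ _).trans hn
    have hNn : N ≤ n := (le_max_right _ _).trans hn
    have h1 := hu n (d m) (Finset.mem_image_of_mem _ (Finset.mem_range.2 (by omega)))
    have h2 : 1 / ((n : ℝ) + 1) ≤ 1 / ((N : ℝ) + 1) := Nat.one_div_le_one_div hNn
    have hd : ‖a - d m‖ < ε / 3 := by
      rw [← dist_eq_norm]; exact hm
    have h3 : ‖(u n : Unitization ℂ B) * ((φ (a - d m) : B) : Unitization ℂ B) *
        star (u n : Unitization ℂ B)‖ < ε / 3 := by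
      rw [norm_conj_unitary, Unitization.norm_inr]
      exact (NonUnitalStarAlgHom.norm_apply_le φ _).trans_lt hd
    have h4 : ‖((ψ (a - d m) : B) : Unitization ℂ B)‖ < ε / 3 := by
      rw [Unitization.norm_inr]
      exact (NonUnitalStarAlgHom.norm_apply_le ψ _).trans_lt hd
    rw [dist_eq_norm]
    have key : (u n : Unitization ℂ B) * (φ a : Unitization ℂ B) * star (u n : Unitization ℂ B) -
        (ψ a : Unitization ℂ B) =
        (u n : Unitization ℂ B) * ((φ (a - d m) : B) : Unitization ℂ B) *
          star (u n : Unitization ℂ B) +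
        ((u n : Unitization ℂ B) * (φ (d m) : Unitization ℂ B) * star (u n : Unitization ℂ B) -
          (ψ (d m) : Unitization ℂ B)) - ((ψ (a - d m) : B) : Unitization ℂ B) := by
      simp only [map_sub, Unitization.inr_sub, mul_sub, sub_mul]
      abel
    rw [key]
    refine (norm_sub_le _ _).trans_lt ?_
    have h5 := norm_add_le
      ((u n : Unitization ℂ B) * ((φ (a - d m) : B) : Unitization ℂ B) *
        star (u n : Unitization ℂ B))
      ((u n : Unitization ℂ B) * (φ (d m) : Unitization ℂ B) * star (u n : Unitization ℂ B) -
          (ψ (d m) : Unitization ℂ B))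
    linarith

theorem ApproxUnitarilyEquiv.refl (φ : A →⋆ₙₐ[ℂ] B) : ApproxUnitarilyEquiv φ φ :=
  ⟨fun _ => 1, fun a => by simp⟩

theorem ApproxUnitarilyEquiv.symm {φ ψ : A →⋆ₙₐ[ℂ] B} (h : ApproxUnitarilyEquiv φ ψ) :
    ApproxUnitarilyEquiv ψ φ := by
  obtain ⟨u, hu⟩ := h
  refine ⟨fun n => star (u n), fun a => ?_⟩
  have h := hu a
  rw [tendsto_iff_norm_sub_tendsto_zero] at h ⊢
  refine h.congr fun n => ?_
  rw [← norm_conj_unitary (star (u n)), ← norm_neg]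
  congr 1
  have h1 : star (u n : Unitization ℂ B) * (u n : Unitization ℂ B) = 1 :=
    Unitary.coe_star_mul_self _
  simp only [Unitary.coe_star, star_star, mul_sub, sub_mul, neg_sub]
  congr 1
  calc star (u n : Unitization ℂ B) * ((u n : Unitization ℂ B) * (φ a : Unitization ℂ B) *
        star (u n : Unitization ℂ B)) * (u n : Unitization ℂ B)
      = (star (u n : Unitization ℂ B) * (u n : Unitization ℂ B)) * (φ a : Unitization ℂ B) *
        (star (u n : Unitization ℂ B) * (u n : Unitization ℂ B)) := by simp only [mul_assoc]
    _ = _ := by rw [h1, one_mul, mul_one]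

theorem ApproxUnitarilyEquiv.trans [TopologicalSpace.SeparableSpace A] {φ ψ χ : A →⋆ₙₐ[ℂ] B}
    (h₁ : ApproxUnitarilyEquiv φ ψ) (h₂ : ApproxUnitarilyEquiv ψ χ) :
    ApproxUnitarilyEquiv φ χ := by
  rw [approxUnitarilyEquiv_iff] at h₁ h₂ ⊢
  intro F ε hε
  obtain ⟨u, hu⟩ := h₁ F (ε / 2) (half_pos hε)
  obtain ⟨v, hv⟩ := h₂ F (ε / 2) (half_pos hε)
  refine ⟨v * u, fun a ha => ?_⟩
  have h1 := hu a ha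
  have h2 := hv a ha
  rw [← norm_conj_unitary v] at h1
  have key : ((v * u : unitary (Unitization ℂ B)) : Unitization ℂ B) * (φ a : Unitization ℂ B) *
      star ((v * u : unitary (Unitization ℂ B)) : Unitization ℂ B) - (χ a : Unitization ℂ B) =
      (v : Unitization ℂ B) * ((u : Unitization ℂ B) * (φ a : Unitization ℂ B) *
        star (u : Unitization ℂ B) - (ψ a : Unitization ℂ B)) * star (v : Unitization ℂ B) +
      ((v : Unitization ℂ B) * (ψ a : Unitization ℂ B) * star (v : Unitization ℂ B) -
        (χ a : Unitization ℂ B)) := by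
    simp only [Submonoid.coe_mul, star_mul, mul_sub, sub_mul, mul_assoc]
    abel
  rw [key]
  exact (norm_add_le _ _).trans_lt (by linarith)

theorem ApproxUnitarilyEquiv.comp_left {C : Type*} [NonUnitalCStarAlgebra C]
    {φ ψ : A →⋆ₙₐ[ℂ] B} (h : ApproxUnitarilyEquiv φ ψ) (χ : B →⋆ₙₐ[ℂ] C) :
    ApproxUnitarilyEquiv (χ.comp φ) (χ.comp ψ) := by
  obtain ⟨u, hu⟩ := h
  let X := Unitization.starMap χ
  refine ⟨fun n => ⟨X (u n), Unitary.map_mem X (u n).2⟩, fun a => ?_⟩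
  have hX : Continuous X := map_continuous X
  have h := (hX.tendsto _).comp (hu a)
  have hinr : ∀ b : B, X (b : Unitization ℂ B) = ((χ b : C) : Unitization ℂ C) :=
    Unitization.starMap_inr χ
  rw [hinr] at h
  refine h.congr fun n => ?_
  rw [Function.comp_apply, map_mul, map_mul, map_star, hinr]
  rfl

theorem ApproxUnitarilyEquiv.comp_right {C : Type*} [NonUnitalCStarAlgebra C]
    {φ ψ : A →⋆ₙₐ[ℂ] B} (h : ApproxUnitarilyEquiv φ ψ) (χ : C →⋆ₙₐ[ℂ] A) :
    ApproxUnitarilyEquiv (φ.comp χ) (ψ.comp χ) := by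
  obtain ⟨u, hu⟩ := h
  exact ⟨u, fun a => hu (χ a)⟩

variable (A) [TopologicalSpace.SeparableSpace A]

/-- Approximate unitary equivalence as a congruence on the group `A ≃⋆ₐ[ℂ] A` of automorphisms,
whose multiplication is composition. -/
def approxUnitaryCon : Con (A ≃⋆ₐ[ℂ] A) where
  r φ ψ := ApproxUnitarilyEquiv (φ : A →⋆ₙₐ[ℂ] A) (ψ : A →⋆ₙₐ[ℂ] A)
  iseqv := ⟨fun _ => .refl _, fun h => h.symm, fun h₁ h₂ => h₁.trans h₂⟩
  mul' {_ x y _} h₁ h₂ :=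
    (h₁.comp_right (y : A →⋆ₙₐ[ℂ] A)).trans (h₂.comp_left (x : A →⋆ₙₐ[ℂ] A))

/-- The group `Aut(A)/≈ᵤ`. -/
abbrev AutModApprox : Type _ := (approxUnitaryCon A).Quotient

end ApproxUnitary

/-! ### Central sequences and the Rokhlin property -/

section Rokhlin

variable (A : Type*) [NonUnitalCStarAlgebra A]

/-- The sequence algebra `A_∞ = ℓ^∞(ℕ, A) / c₀(ℕ, A)`. -/
abbrev SeqInfty : Type _ := SeqAlg fun _ : ℕ => A

/-- The embedding `A → A_∞` by constant sequences. -/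
def constSeq : A →⋆ₙₐ[ℂ] SeqInfty A where
  toFun a := seqMk _ ⟨fun _ => a, memℓp_infty ⟨‖a‖, by rintro _ ⟨k, rfl⟩; exact le_rfl⟩⟩
  map_smul' _ _ := rfl
  map_zero' := rfl
  map_add' _ _ := rfl
  map_mul' _ _ := rfl
  map_star' _ := rfl

/-- The relative commutant `A_∞ ∩ A'`. -/
abbrev relCommutant : NonUnitalStarSubalgebra ℂ (SeqInfty A) :=
  NonUnitalStarSubalgebra.centralizer ℂ (Set.range (constSeq A))

/-- The annihilator `Ann(A, A_∞) = {x ∈ A_∞ | x b = b x = 0 for all b ∈ A}`, as an ideal of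
`A_∞ ∩ A'`. -/
def annIdeal : StarIdeal (relCommutant A) where
  carrier := {x | ∀ b : A, (x : SeqInfty A) * constSeq A b = 0 ∧ constSeq A b * (x : SeqInfty A) = 0}
  zero_mem' b := by simp
  add_mem' {x y} hx hy b := by
    simp [add_mul, mul_add, hx b, hy b]
  smul_mem' c x hx b := by
    simp [smul_mul_assoc, mul_smul_comm, hx b]
  mul_mem_left' x y hy b := by
    have hxb := ((NonUnitalStarSubalgebra.mem_centralizer_iff ℂ).1 x.2 _ ⟨b, rfl⟩).1
    constructor
    · change (x : SeqInfty A) * y * constSeq A b = 0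
      rw [mul_assoc, (hy b).1, mul_zero]
    · change constSeq A b * ((x : SeqInfty A) * y) = 0
      rw [← mul_assoc, hxb, mul_assoc, (hy b).2, mul_zero]
  mul_mem_right' x y hx b := by
    have hyb := ((NonUnitalStarSubalgebra.mem_centralizer_iff ℂ).1 y.2 _ ⟨b, rfl⟩).1
    constructor
    · change (x : SeqInfty A) * y * constSeq A b = 0
      rw [mul_assoc, ← hyb, ← mul_assoc, (hx b).1, zero_mul]
    · change constSeq A b * ((x : SeqInfty A) * y) = 0
      rw [← mul_assoc, (hx b).2, zero_mul]
  star_mem' x hx b := by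
    have h := hx (star b)
    constructor
    · have := congrArg star h.2
      simpa [star_mul, map_star] using this
    · have := congrArg star h.1
      simpa [star_mul, map_star] using this

/-- An element `x` of `A_∞ ∩ A'` belonging to the annihilator, as a condition in `A_∞`. -/
theorem mem_annIdeal {x : relCommutant A} : x ∈ (annIdeal A).toSubmodule ↔
    ∀ b : A, (x : SeqInfty A) * constSeq A b = 0 ∧ constSeq A b * (x : SeqInfty A) = 0 := Iff.rfl

/-- The central sequence algebra `F_∞(A) = (A_∞ ∩ A') / Ann(A, A_∞)`. -/
abbrev CentralSeq : Type _ := (annIdeal A).Quot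

variable {A}

/-- Componentwise application of an automorphism to bounded sequences. -/
def lpMap (φ : A ≃⋆ₐ[ℂ] A) : lp (fun _ : ℕ => A) ∞ →⋆ₙₐ[ℂ] lp (fun _ : ℕ => A) ∞ where
  toFun x := ⟨fun k => φ (x k), memℓp_infty ⟨‖x‖, by
    rintro _ ⟨k, rfl⟩
    exact (NonUnitalStarAlgHom.norm_apply_le φ (x k)).trans
      (lp.norm_apply_le_norm ENNReal.top_ne_zero x k)⟩⟩
  map_smul' c x := by ext k; exact map_smul φ c (x k)
  map_zero' := by ext k; exact map_zero φ
  map_add' x y := by ext k; exact map_add φ (x k) (y k)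
  map_mul' x y := by ext k; exact map_mul φ (x k) (y k)
  map_star' x := by ext k; exact map_star φ (x k)

/-- The endomorphism of `A_∞` given by componentwise application of an automorphism. -/
def seqInftyMap (φ : A ≃⋆ₐ[ℂ] A) : SeqInfty A →⋆ₙₐ[ℂ] SeqInfty A :=
  StarIdeal.mapQuot _ _ (lpMap φ) fun x hx =>
    squeeze_zero (fun _ => norm_nonneg _)
      (fun k => NonUnitalStarAlgHom.norm_apply_le φ (x k)) hx

theorem seqInftyMap_constSeq (φ : A ≃⋆ₐ[ℂ] A) (a : A) :
    seqInftyMap φ (constSeq A a) = constSeq A (φ a) := rfl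

/-- The restriction of `seqInftyMap φ` to `A_∞ ∩ A'`. -/
def relCommutantMap (φ : A ≃⋆ₐ[ℂ] A) : relCommutant A →⋆ₙₐ[ℂ] relCommutant A :=
  NonUnitalStarAlgHom.codRestrict
    ((seqInftyMap φ).comp (NonUnitalStarSubalgebraClass.subtype (relCommutant A)))
    (relCommutant A) (by
      intro x
      rw [NonUnitalStarSubalgebra.mem_centralizer_iff]
      rintro _ ⟨b, rfl⟩
      have h := (NonUnitalStarSubalgebra.mem_centralizer_iff ℂ).1 x.2 _ ⟨φ.symm b, rfl⟩
      have hb : constSeq A b = seqInftyMap φ (constSeq A (φ.symm b)) := by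
        rw [seqInftyMap_constSeq, StarAlgEquiv.apply_symm_apply]
      change constSeq A b * seqInftyMap φ x = seqInftyMap φ x * constSeq A b ∧
        star (constSeq A b) * seqInftyMap φ x = seqInftyMap φ x * star (constSeq A b)
      rw [hb, ← map_star, ← map_mul, ← map_mul, ← map_mul, ← map_mul, h.1, h.2]
      exact ⟨rfl, rfl⟩)

/-- The map `φ_∞` on `F_∞(A)` induced by componentwise application of `φ ∈ Aut(A)`. -/
def centralSeqMap (φ : A ≃⋆ₐ[ℂ] A) : CentralSeq A →⋆ₙₐ[ℂ] CentralSeq A :=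
  StarIdeal.mapQuot _ _ (relCommutantMap φ) fun x hx b => by
    have h := hx (φ.symm b)
    have hb : constSeq A b = seqInftyMap φ (constSeq A (φ.symm b)) := by
      rw [seqInftyMap_constSeq, StarAlgEquiv.apply_symm_apply]
    change seqInftyMap φ x * constSeq A b = 0 ∧ constSeq A b * seqInftyMap φ x = 0
    rw [hb, ← map_mul, ← map_mul, h.1, h.2, map_zero]
    exact ⟨rfl, rfl⟩

/-- An action `α : G → Aut(A)` of a finite group has the Rokhlin property if there is a unital
`*`-homomorphism `C(G) → F_∞(A)` that is equivariant for the `G`-shift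
`(g • f)(h) = f (g⁻¹ h)` on `C(G)` and `α_∞` on `F_∞(A)`. -/
def HasRokhlinProperty {G : Type*} [Group G] (α : G →* (A ≃⋆ₐ[ℂ] A)) : Prop :=
  ∃ Φ : (G → ℂ) →⋆ₙₐ[ℂ] CentralSeq A,
    (∀ x : CentralSeq A, Φ 1 * x = x ∧ x * Φ 1 = x) ∧
    ∀ (g : G) (f : G → ℂ), Φ (fun h => f (g⁻¹ * h)) = centralSeqMap (α g) (Φ f)

end Rokhlin

/-! ### Rokhlin actions, homomorphisms, and their conjugacy classes -/

section Classes

/-- Conjugacy of group homomorphisms: `ψ₂ = g ψ₁(·) g⁻¹` for some `g`. -/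
def homConj (H₁ H₂ : Type*) [Group H₁] [Group H₂] : Setoid (H₁ →* H₂) where
  r ψ₁ ψ₂ := ∃ g : H₂, ∀ h : H₁, ψ₂ h = g * ψ₁ h * g⁻¹
  iseqv := by
    refine ⟨fun ψ => ⟨1, fun h => by simp⟩, ?_, ?_⟩
    · rintro ψ₁ ψ₂ ⟨g, hg⟩
      exact ⟨g⁻¹, fun h => by rw [hg]; group⟩
    · rintro ψ₁ ψ₂ ψ₃ ⟨g, hg⟩ ⟨g', hg'⟩
      exact ⟨g' * g, fun h => by rw [hg', hg]; group⟩

/-- Group homomorphisms modulo conjugacy. -/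
abbrev HomClasses (H₁ H₂ : Type*) [Group H₁] [Group H₂] : Type _ := Quotient (homConj H₁ H₂)

variable (G : Type*) [Group G] (A : Type*) [NonUnitalCStarAlgebra A]

/-- The set of Rokhlin actions of `G` on `A`. -/
def RokhlinAction : Type _ := {α : G →* (A ≃⋆ₐ[ℂ] A) // HasRokhlinProperty α}

/-- Conjugacy of Rokhlin actions: `β_g = σ ∘ α_g ∘ σ⁻¹` for some `σ ∈ Aut(A)` and all `g`. -/
def rokhlinConj : Setoid (RokhlinAction G A) :=
  (homConj G (A ≃⋆ₐ[ℂ] A)).comap Subtype.val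

/-- Conjugacy classes of Rokhlin actions of `G` on `A`. -/
abbrev RokhlinClasses : Type _ := Quotient (rokhlinConj G A)

variable [TopologicalSpace.SeparableSpace A]

/-- The natural map `α ↦ [g ↦ [α_g]]` from Rokhlin actions to `Hom(G, Aut(A)/≈ᵤ)`. -/
def rokhlinToHom (α : RokhlinAction G A) : G →* AutModApprox A :=
  (approxUnitaryCon A).mk'.comp α.1

/-- The map induced by `rokhlinToHom` on conjugacy classes. -/
def rokhlinToHomClasses : RokhlinClasses G A → HomClasses G (AutModApprox A) :=
  Quotient.map (rokhlinToHom G A) (by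
    rintro α β ⟨σ, hσ⟩
    refine ⟨(approxUnitaryCon A).mk' σ, fun g => ?_⟩
    change (approxUnitaryCon A).mk' (β.1 g) = (approxUnitaryCon A).mk' σ *
      (approxUnitaryCon A).mk' (α.1 g) * ((approxUnitaryCon A).mk' σ)⁻¹
    rw [hσ g, map_mul, map_mul, map_inv])

end Classes

end CStarRokhlin

end

/-! Both halves are approximate intertwining arguments by inner automorphisms. The three
alternatives on A serve only to supply unitaries, and this is isolated in `HasApproxPolar`: left
multiplication by an approximately unitary element of A can be imitated on finite sets by unitaries
of the unitization, with an error governed by the defect of w⋆w. For unital A and for stable rank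
one the unitary is the polar part of an invertible element. For stable A it is a product of two
Cayley transforms in a 2 × 2 block decomposition (`MatrixUnits.exists_unitary_corner`). It follows
that conjugation by permutation matrices is approximately inner, even when the coefficient algebra
has no unit (`MatrixUnits.exists_adAut_perm`).

Existence. In the UHF tensor product, x ⊗ 1 and 1 ⊗ x differ by a permutation of the matrix indices.
Hence absorption provides matrix units E k l ⊗ a inside A, indexed by G, whose amplification a ↦ 1 ⊗
a is approximately unitarily equivalent to the identity (`AbsorbsUHF.exists_matrixUnits`). Lift ψ to
automorphisms α_g, which need not form an action. Consider ι : a ↦ (α_h⁻¹ a)_h from A to the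
functions G → A, and κ : b ↦ ∑ E k k ⊗ α_k b_k back to A. Then κι ≈ id, while ικ ≈ φ for an
endomorphism φ that commutes exactly with the shift of G, and κ turns the shift by g into α_g up to
≈. An Elliott intertwining thus presents A as a limit of copies of G → A along φ. The shift passes
to an honest action γ on this limit, with γ_g ≈ α_g (`exists_limit_action`,
`approxUnitarilyEquiv_limit_action`). The functions supported at single points of G become the
Rokhlin elements (`exists_rokhlin_lift`).

Uniqueness. The Rokhlin property extends A ⊂ A_∞ to an equivariant homomorphism from G → A
(`HasRokhlinProperty.hasRokhlinMap`). If α_g ≈ β_g for all g, choose unitaries u_h that nearly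
implement α_h β_h⁻¹ and glue them along this homomorphism to one unitary v, heuristically ∑ q_h u_h
with q_h the Rokhlin elements. Conjugating β by Ad v brings it close to α, and v is almost central
wherever the two actions were already close (`exists_conj_step`). Correcting β and α alternately, in
the manner of Evans and Kishimoto, gives inner automorphisms converging to Θ and H with Θ α Θ⁻¹ = H
β H⁻¹ (`exists_conj_of_hasRokhlinMap`). Two actions whose induced homomorphisms are conjugate by a
class [σ] are reduced to this case by conjugating one of them with σ. -/

noncomputable section

namespace CStarRokhlin

/-! ### Inner automorphisms -/

section Inner

variable {A : Type*} [NonUnitalCStarAlgebra A]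

/-- Left multiplication by an element of the unitization. -/
def leftMul (u : Unitization ℂ A) (a : A) : A := (u * (a : Unitization ℂ A)).snd

theorem inr_leftMul (u : Unitization ℂ A) (a : A) :
    ((leftMul u a : A) : Unitization ℂ A) = u * (a : Unitization ℂ A) := by
  ext <;> simp [leftMul]

theorem inr_snd_conj (u v : Unitization ℂ A) (a : A) :
    (((u * (a : Unitization ℂ A) * v).snd : A) : Unitization ℂ A) =
      u * (a : Unitization ℂ A) * v := by
  ext <;> simp

theorem norm_leftMul_unitary (u : unitary (Unitization ℂ A)) (a : A) :
    ‖leftMul (u : Unitization ℂ A) a‖ = ‖a‖ := by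
  rw [← Unitization.norm_inr (𝕜 := ℂ), inr_leftMul, CStarRing.norm_coe_unitary_mul,
    Unitization.norm_inr]

/-- Conjugation by a unitary of the unitization, as an endomorphism. -/
def adHom (u : unitary (Unitization ℂ A)) : A →⋆ₙₐ[ℂ] A where
  toFun a := ((u : Unitization ℂ A) * (a : Unitization ℂ A) * star (u : Unitization ℂ A)).snd
  map_smul' c a := Unitization.inr_injective (R := ℂ) <| by
    simp
  map_zero' := by simp
  map_add' a b := Unitization.inr_injective (R := ℂ) <| by
    rw [inr_snd_conj, Unitization.inr_add, Unitization.inr_add, inr_snd_conj, inr_snd_conj,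
      mul_add, add_mul]
  map_mul' a b := Unitization.inr_injective (R := ℂ) <| by
    have h1 : star (u : Unitization ℂ A) * (u : Unitization ℂ A) = 1 :=
      Unitary.coe_star_mul_self _
    rw [inr_snd_conj, Unitization.inr_mul, Unitization.inr_mul, inr_snd_conj, inr_snd_conj]
    calc _ = (u : Unitization ℂ A) * (a : Unitization ℂ A) *
          (star (u : Unitization ℂ A) * (u : Unitization ℂ A)) * (b : Unitization ℂ A) *
            star (u : Unitization ℂ A) := by
            rw [h1, mul_one]; simp only [mul_assoc]
      _ = _ := by simp only [mul_assoc]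
  map_star' a := Unitization.inr_injective (R := ℂ) <| by
    rw [inr_snd_conj, Unitization.inr_star, Unitization.inr_star, inr_snd_conj]
    simp only [star_mul, star_star, mul_assoc]

theorem inr_adHom (u : unitary (Unitization ℂ A)) (a : A) :
    ((adHom u a : A) : Unitization ℂ A) =
      (u : Unitization ℂ A) * (a : Unitization ℂ A) * star (u : Unitization ℂ A) :=
  inr_snd_conj _ _ _

theorem adHom_mul (u v : unitary (Unitization ℂ A)) (a : A) :
    adHom (u * v) a = adHom u (adHom v a) := Unitization.inr_injective (R := ℂ) <| by
  simp only [inr_adHom, Submonoid.coe_mul, star_mul, mul_assoc]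

theorem adHom_one (a : A) : adHom 1 a = a := Unitization.inr_injective (R := ℂ) <| by
  simp [inr_adHom]

/-- Conjugation by a unitary of the unitization, as a homomorphism into the automorphism group. -/
def adAut : unitary (Unitization ℂ A) →* (A ≃⋆ₐ[ℂ] A) where
  toFun u := StarAlgEquiv.ofNonUnitalStarAlgHom (adHom u) (adHom u⁻¹)
    (by ext a; simp [← adHom_mul, adHom_one]) (by ext a; simp [← adHom_mul, adHom_one])
  map_one' := by ext a; exact adHom_one a
  map_mul' u v := by ext a; exact adHom_mul u v a

theorem inr_adAut (u : unitary (Unitization ℂ A)) (a : A) :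
    ((adAut u a : A) : Unitization ℂ A) =
      (u : Unitization ℂ A) * (a : Unitization ℂ A) * star (u : Unitization ℂ A) :=
  inr_adHom u a

theorem norm_aut (θ : A ≃⋆ₐ[ℂ] A) (a : A) : ‖θ a‖ = ‖a‖ :=
  NonUnitalStarAlgHom.norm_map θ (EquivLike.injective θ) a

theorem norm_aut_sub (θ : A ≃⋆ₐ[ℂ] A) (a b : A) : ‖θ a - θ b‖ = ‖a - b‖ := by
  rw [← map_sub, norm_aut]

theorem norm_hom_sub_le {B : Type*} [NonUnitalCStarAlgebra B] (φ : B →⋆ₙₐ[ℂ] A) (a b : B) :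
    ‖φ a - φ b‖ ≤ ‖a - b‖ := by
  rw [← map_sub]; exact NonUnitalStarAlgHom.norm_apply_le φ _

theorem aut_apply_inv_apply (θ : A ≃⋆ₐ[ℂ] A) (a : A) : θ (θ⁻¹ a) = a :=
  θ.apply_symm_apply a

theorem aut_inv_apply_apply (θ : A ≃⋆ₐ[ℂ] A) (a : A) : θ⁻¹ (θ a) = a :=
  θ.symm_apply_apply a

/-- An automorphism intertwines conjugation by `u` and conjugation by the image of `u`. -/
theorem exists_hom_adAut {B : Type*} [NonUnitalCStarAlgebra B] (χ : B →⋆ₙₐ[ℂ] A)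
    (u : unitary (Unitization ℂ B)) :
    ∃ v : unitary (Unitization ℂ A), ∀ b, χ (adAut u b) = adAut v (χ b) := by
  let X := Unitization.starMap χ
  have hinr : ∀ b : B, X (b : Unitization ℂ B) = ((χ b : A) : Unitization ℂ A) :=
    Unitization.starMap_inr χ
  refine ⟨⟨X u, Unitary.map_mem X u.2⟩, fun b => Unitization.inr_injective (R := ℂ) ?_⟩
  rw [inr_adAut, ← hinr, inr_adAut, map_mul, map_mul, map_star, hinr]

variable {B : Type*} [NonUnitalCStarAlgebra B]

theorem norm_adAut_sub_eq (u : unitary (Unitization ℂ A)) (a b : A) :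
    ‖adAut u a - b‖ = ‖(u : Unitization ℂ A) * (a : Unitization ℂ A) *
      star (u : Unitization ℂ A) - (b : Unitization ℂ A)‖ := by
  rw [← inr_adAut, ← Unitization.inr_sub, Unitization.norm_inr]

/-- The finite-set form of approximate unitary equivalence can be tested on a dense set. -/
theorem exists_adAut_of_dense {φ ψ : B →⋆ₙₐ[ℂ] A} {T : Set B} (hT : Dense T)
    (h : ∀ (F : Finset B), (F : Set B) ⊆ T → ∀ ε : ℝ, 0 < ε →
      ∃ u : unitary (Unitization ℂ A), ∀ b ∈ F, ‖adAut u (φ b) - ψ b‖ < ε)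
    (F : Finset B) (ε : ℝ) (hε : 0 < ε) :
    ∃ u : unitary (Unitization ℂ A), ∀ b ∈ F, ‖adAut u (φ b) - ψ b‖ < ε := by
  classical
  choose t ht htd using fun b : B => Metric.dense_iff.1 hT b (ε / 3) (by positivity)
  obtain ⟨u, hu⟩ := h (F.image t) (by
    intro x hx
    obtain ⟨b, _, rfl⟩ := Finset.mem_image.1 (Finset.mem_coe.1 hx)
    exact htd b) (ε / 3) (by positivity)
  refine ⟨u, fun b hb => ?_⟩
  have h1 := hu (t b) (Finset.mem_image_of_mem _ hb)
  have h2 : ‖t b - b‖ < ε / 3 := by rw [← dist_eq_norm]; exact ht b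
  have h3 : ‖adAut u (φ b) - adAut u (φ (t b))‖ ≤ ‖t b - b‖ := by
    rw [norm_aut_sub, norm_sub_rev (t b)]; exact norm_hom_sub_le φ _ _
  have h4 := norm_hom_sub_le ψ (t b) b
  calc ‖adAut u (φ b) - ψ b‖
      = ‖(adAut u (φ b) - adAut u (φ (t b))) + (adAut u (φ (t b)) - ψ (t b)) +
        (ψ (t b) - ψ b)‖ := by congr 1; abel
    _ ≤ _ := norm_add₃_le
    _ < ε := by linarith

/-- Every unitary can be rescaled so that its scalar part is `1`. -/
theorem exists_adAut_fst_eq_one (u : unitary (Unitization ℂ A)) :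
    ∃ v : unitary (Unitization ℂ A), (v : Unitization ℂ A).fst = 1 ∧ adAut v = adAut u := by
  have hu : star (u : Unitization ℂ A) * (u : Unitization ℂ A) = 1 :=
    Unitary.coe_star_mul_self _
  set z := (u : Unitization ℂ A).fst with hz
  have hzz : star z * z = 1 := by
    have := congrArg (fun y => y.fst) hu
    rwa [Unitization.fst_mul, Unitization.fst_star, Unitization.fst_one] at this
  have hzz' : z * star z = 1 := by rw [mul_comm]; exact hzz
  refine ⟨⟨star z • (u : Unitization ℂ A), ?_⟩, ?_, ?_⟩
  · rw [Unitary.mem_iff]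
    constructor
    · rw [star_smul, star_star, smul_mul_smul_comm, hzz', one_smul, hu]
    · rw [star_smul, star_star, smul_mul_smul_comm, hzz, one_smul]
      exact Unitary.coe_mul_star_self _
  · simpa [← hz] using hzz
  · ext a
    refine Unitization.inr_injective (R := ℂ) ?_
    rw [inr_adAut, inr_adAut]
    simp only [star_smul, star_star, smul_mul_assoc, mul_smul_comm, smul_smul, hzz', one_smul]

/-- The unitization of a product has a single scalar part, so unitaries chosen coordinatewise fit
together only after all of them are rescaled to scalar part 1. -/
theorem exists_adAut_pi {ι : Type*} [Fintype ι] (u : ι → unitary (Unitization ℂ A)) :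
    ∃ v : unitary (Unitization ℂ (ι → A)), ∀ (b : ι → A) i, adAut v b i = adAut (u i) (b i) := by
  choose w hw1 hw2 using fun i => exists_adAut_fst_eq_one (u i)
  let x : ι → A := fun i => (w i : Unitization ℂ A).snd
  have hx : ∀ i, (w i : Unitization ℂ A) = 1 + (x i : Unitization ℂ A) := fun i => by
    ext <;> simp [x, hw1]
  -- Unitarity of 1 + x is an equation within the algebra itself, and can therefore be checked
  -- coordinate by coordinate.
  have hl : ∀ i, star (x i) + x i + star (x i) * x i = 0 := fun i => by
    have h : star (1 + (x i : Unitization ℂ A)) * (1 + (x i : Unitization ℂ A)) = 1 := by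
      rw [← hx]; exact Unitary.coe_star_mul_self (w i)
    replace h := congrArg (fun y => y.snd) h
    simpa [add_assoc, add_left_comm] using h
  have hr : ∀ i, star (x i) + x i + x i * star (x i) = 0 := fun i => by
    have h : (1 + (x i : Unitization ℂ A)) * star (1 + (x i : Unitization ℂ A)) = 1 := by
      rw [← hx]; exact Unitary.coe_mul_star_self (w i)
    replace h := congrArg (fun y => y.snd) h
    simpa [add_assoc, add_comm, add_left_comm] using h
  have hv : (1 + (x : Unitization ℂ (ι → A))) ∈ unitary (Unitization ℂ (ι → A)) := by
    rw [Unitary.mem_iff]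
    constructor
    · ext i
      · simp
      · simpa [add_assoc, add_left_comm] using hl i
    · ext i
      · simp
      · simpa [add_assoc, add_comm, add_left_comm] using hr i
  refine ⟨⟨_, hv⟩, fun b i => ?_⟩
  rw [← hw2 i]
  change ((1 + (x : Unitization ℂ (ι → A))) * (b : Unitization ℂ (ι → A)) *
    star (1 + (x : Unitization ℂ (ι → A)))).snd i =
      ((w i : Unitization ℂ A) * (b i : Unitization ℂ A) * star (w i : Unitization ℂ A)).snd
  rw [hx]
  simp

variable [TopologicalSpace.SeparableSpace B]

theorem approxUnitarilyEquiv_iff_adAut {φ ψ : B →⋆ₙₐ[ℂ] A} :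
    ApproxUnitarilyEquiv φ ψ ↔ ∀ (F : Finset B) (ε : ℝ), 0 < ε →
      ∃ u : unitary (Unitization ℂ A), ∀ b ∈ F, ‖adAut u (φ b) - ψ b‖ < ε := by
  simp only [approxUnitarilyEquiv_iff, norm_adAut_sub_eq]

/-- Approximate unitary equivalence of `*`-homomorphisms into a finite product can be tested in
each coordinate. -/
theorem approxUnitarilyEquiv_pi {ι : Type*} [Fintype ι] {φ ψ : B →⋆ₙₐ[ℂ] (ι → A)}
    (f g : ι → B →⋆ₙₐ[ℂ] A) (hf : ∀ b i, φ b i = f i b) (hg : ∀ b i, ψ b i = g i b)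
    (h : ∀ i, ApproxUnitarilyEquiv (f i) (g i)) : ApproxUnitarilyEquiv φ ψ := by
  rw [approxUnitarilyEquiv_iff_adAut]
  intro F ε hε
  choose u hu using fun i => (approxUnitarilyEquiv_iff_adAut.1 (h i)) F ε hε
  obtain ⟨v, hv⟩ := exists_adAut_pi u
  refine ⟨v, fun b hb => (pi_norm_lt_iff hε).2 fun i => ?_⟩
  rw [Pi.sub_apply, hv, hf, hg]
  exact hu i b hb

end Inner

/-! ### Approximate units -/

section ApproxUnit

variable (A : Type*) [NonUnitalCStarAlgebra A]

theorem exists_approxUnit : ∃ l : Filter A, l.NeBot ∧ (∀ᶠ e in l, ‖e‖ ≤ 1 ∧ star e = e) ∧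
    (∀ a, Tendsto (fun e => e * a) l (𝓝 a)) ∧ ∀ a, Tendsto (fun e => a * e) l (𝓝 a) := by
  let _ := CStarAlgebra.spectralOrder A
  have := CStarAlgebra.spectralOrderedRing A
  have h := CStarAlgebra.increasingApproximateUnit A
  exact ⟨_, h.neBot, h.eventually_norm.and h.eventually_star_eq, h.tendsto_mul_right,
    h.tendsto_mul_left⟩

/-- A filter on `A` that is an approximate unit of self-adjoint contractions. -/
def approxUnit : Filter A := (exists_approxUnit A).choose

instance : (approxUnit A).NeBot := (exists_approxUnit A).choose_spec.1

variable {A}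

theorem eventually_approxUnit : ∀ᶠ e in approxUnit A, ‖e‖ ≤ 1 ∧ star e = e :=
  (exists_approxUnit A).choose_spec.2.1

theorem tendsto_approxUnit_mul (a : A) : Tendsto (fun e => e * a) (approxUnit A) (𝓝 a) :=
  (exists_approxUnit A).choose_spec.2.2.1 a

theorem tendsto_mul_approxUnit (a : A) : Tendsto (fun e => a * e) (approxUnit A) (𝓝 a) :=
  (exists_approxUnit A).choose_spec.2.2.2 a

end ApproxUnit

/-! ### Replacing approximate unitaries by unitaries -/

section Polar

/-- (1 + h)² = 1 + (2h + h²) ≥ 1; compress by y and take norms. -/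
theorem norm_le_norm_one_add_mul {B : Type*} [CStarAlgebra B] [PartialOrder B] [StarOrderedRing B]
    {h : B} (hh : 0 ≤ h) (y : B) : ‖y‖ ≤ ‖(1 + h) * y‖ := by
  have hs : star h = h := hh.isSelfAdjoint
  have h1 : star y * y ≤ star ((1 + h) * y) * ((1 + h) * y) := by
    have h2 : star ((1 + h) * y) * ((1 + h) * y) =
        star y * y + (star y * (h + h + star h * h) * y) := by
      simp only [star_mul, star_add, star_one, hs]
      noncomm_ring
    rw [h2]
    refine le_add_of_nonneg_right (star_left_conjugate_nonneg ?_ y)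
    exact add_nonneg (add_nonneg hh hh) (star_mul_self_nonneg h)
  have h3 := CStarAlgebra.norm_le_norm_of_nonneg_of_le (star_mul_self_nonneg y) h1
  rw [CStarRing.norm_star_mul_self, CStarRing.norm_star_mul_self] at h3
  exact abs_le_of_sq_le_sq' (by simpa [sq] using h3) (norm_nonneg _) |>.2

/-- The unitary part of the polar decomposition of an invertible element. -/
theorem exists_unitary_of_isUnit {B : Type*} [CStarAlgebra B] {x : B} (hx : IsUnit x) :
    ∃ u : unitary B, ∀ a : B, ‖(u : B) * a - x * a‖ ≤ ‖star x * x * a - a‖ := by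
  let _ := CStarAlgebra.spectralOrder B
  have := CStarAlgebra.spectralOrderedRing B
  set h := CFC.abs x with hdef
  have hh : h * h = star x * x := CFC.abs_mul_abs x
  have h0 : 0 ≤ h := CFC.abs_nonneg x
  have hs : star h = h := h0.isSelfAdjoint
  have hu : IsUnit h := by
    have : IsUnit (h * h) := by rw [hh]; exact hx.star.mul hx
    exact ((Commute.refl h).isUnit_mul_iff.1 this).1
  obtain ⟨k, hk⟩ := hu
  have hk1 : h * (↑k⁻¹ : B) = 1 := by rw [← hk]; exact k.mul_inv
  have hk2 : (↑k⁻¹ : B) * h = 1 := by rw [← hk]; exact k.inv_mul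
  have hks : star (↑k⁻¹ : B) = ↑k⁻¹ := by
    have h3 : star (↑k⁻¹ : B) * h = 1 := by
      have := congrArg star hk1
      rwa [star_mul, hs, star_one] at this
    calc star (↑k⁻¹ : B) = star (↑k⁻¹ : B) * (h * ↑k⁻¹) := by rw [hk1, mul_one]
      _ = ↑k⁻¹ := by rw [← mul_assoc, h3, one_mul]
  have hu1 : star (x * (↑k⁻¹ : B)) * (x * ↑k⁻¹) = 1 := by
    rw [star_mul, hks]
    calc (↑k⁻¹ : B) * star x * (x * ↑k⁻¹) = ↑k⁻¹ * (star x * x) * ↑k⁻¹ := by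
          simp only [mul_assoc]
      _ = (↑k⁻¹ * h) * (h * ↑k⁻¹) := by rw [← hh]; simp only [mul_assoc]
      _ = 1 := by rw [hk1, hk2, one_mul]
  have huu : IsUnit (x * (↑k⁻¹ : B)) := hx.mul (k⁻¹).isUnit
  -- An invertible isometry is unitary.
  have hu2 : x * (↑k⁻¹ : B) * star (x * ↑k⁻¹) = 1 := by
    obtain ⟨v, hv⟩ := huu
    rw [← hv] at hu1 ⊢
    have : star (v : B) = ↑v⁻¹ := by
      calc star (v : B) = star (v : B) * (v * ↑v⁻¹) := by rw [v.mul_inv, mul_one]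
        _ = ↑v⁻¹ := by rw [← mul_assoc, hu1, one_mul]
    rw [this, v.mul_inv]
  refine ⟨⟨x * ↑k⁻¹, Unitary.mem_iff.2 ⟨hu1, hu2⟩⟩, fun a => ?_⟩
  have e1 : x * (↑k⁻¹ : B) * a - x * a = x * ↑k⁻¹ * (a - h * a) := by
    rw [mul_sub, ← mul_assoc (x * (↑k⁻¹ : B)) h, mul_assoc x _ h, hk2, mul_one]
  calc ‖x * (↑k⁻¹ : B) * a - x * a‖ = ‖a - h * a‖ := by
        rw [e1]
        exact CStarRing.norm_coe_unitary_mul ⟨x * ↑k⁻¹, Unitary.mem_iff.2 ⟨hu1, hu2⟩⟩ _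
    -- Multiplying by 1 + h does not decrease norms, and (1 + h)(1 - h) = 1 - x⋆x is the defect in
    -- the claim.
    _ ≤ ‖(1 + h) * (a - h * a)‖ := norm_le_norm_one_add_mul h0 _
    _ = ‖star x * x * a - a‖ := by
        rw [← norm_neg, ← hh]
        congr 1
        noncomm_ring

/-- The Cayley transform of a skew-adjoint element. -/
theorem exists_unitary_of_star_eq_neg {B : Type*} [CStarAlgebra B] {N : B} (hN : star N = -N) :
    ∃ u : unitary B, ∀ y : B, ‖(u : B) * y - N * y‖ ≤ ‖y + N * (N * y)‖ := by
  let _ := CStarAlgebra.spectralOrder B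
  have := CStarAlgebra.spectralOrderedRing B
  -- The cross terms cancel because N is skew-adjoint, so 1 - N is bounded below by 1.
  have hp : ∀ y : B, ‖y‖ ^ 2 ≤ ‖(1 - N) * y‖ ^ 2 := by
    intro y
    have h2 : star ((1 - N) * y) * ((1 - N) * y) =
        star y * y + star (N * y) * (N * y) := by
      simp only [star_mul, star_sub, star_one, hN]
      noncomm_ring
    have h1 : star y * y ≤ star ((1 - N) * y) * ((1 - N) * y) := by
      rw [h2]
      exact le_add_of_nonneg_right (star_mul_self_nonneg _)
    have h3 := CStarAlgebra.norm_le_norm_of_nonneg_of_le (star_mul_self_nonneg y) h1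
    rw [CStarRing.norm_star_mul_self, CStarRing.norm_star_mul_self] at h3
    simpa [sq] using h3
  -- 1 - N² = 1 + N⋆N ≥ 1 is invertible; the factors 1 - N and 1 + N commute, so each of them is
  -- invertible.
  have hP : IsUnit (1 - N * N) := by
    have h3 : 1 - N * N = star N * N + 1 := by rw [hN]; noncomm_ring
    rw [h3]
    exact CStarAlgebra.isUnit_of_le (1 : B)
      (le_add_of_nonneg_left (star_mul_self_nonneg N) : (1 : B) ≤ star N * N + 1)
  have hc : Commute (1 - N) (1 + N) := by
    rw [commute_iff_eq]; noncomm_ring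
  have hmul : (1 - N) * (1 + N) = 1 - N * N := by noncomm_ring
  obtain ⟨⟨k, hk⟩, ⟨m, hm⟩⟩ := hc.isUnit_mul_iff.1 (by rw [hmul]; exact hP)
  have hks : star (↑k⁻¹ : B) = ↑m⁻¹ := by
    have h5 : star (↑k⁻¹ : B) * m = 1 := by
      have h6 : star (m : B) = k := by rw [hk, hm]; simp [hN, sub_eq_add_neg]
      rw [← star_star (m : B), ← star_mul, h6, k.mul_inv, star_one]
    calc star (↑k⁻¹ : B) = star (↑k⁻¹ : B) * (m * ↑m⁻¹) := by rw [m.mul_inv, mul_one]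
      _ = ↑m⁻¹ := by rw [← mul_assoc, h5, one_mul]
  have hms : star (m : B) = k := by rw [hk, hm]; simp [hN, sub_eq_add_neg]
  have hkm : (k : B) * m = m * k := by rw [hk, hm]; exact hc.eq
  have hu1 : star ((↑k⁻¹ : B) * m) * (↑k⁻¹ * m) = 1 := by
    rw [star_mul, hks, hms]
    have : (↑m⁻¹ : B) * ↑k⁻¹ = ↑k⁻¹ * ↑m⁻¹ := by
      rw [← Units.val_mul, ← Units.val_mul, ← mul_inv_rev, ← mul_inv_rev]
      congr 2
      exact Units.ext hkm
    calc (k : B) * ↑m⁻¹ * (↑k⁻¹ * m) = k * (↑m⁻¹ * ↑k⁻¹) * m := by simp only [mul_assoc]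
      _ = (k * ↑k⁻¹) * (↑m⁻¹ * m) := by rw [this]; simp only [mul_assoc]
      _ = 1 := by rw [k.mul_inv, m.inv_mul, one_mul]
  have hu2 : (↑k⁻¹ : B) * m * star ((↑k⁻¹ : B) * m) = 1 := by
    rw [star_mul, hks, hms]
    calc (↑k⁻¹ : B) * m * (k * ↑m⁻¹) = ↑k⁻¹ * (m * k) * ↑m⁻¹ := by simp only [mul_assoc]
      _ = (↑k⁻¹ * k) * (m * ↑m⁻¹) := by rw [← hkm]; simp only [mul_assoc]
      _ = 1 := by rw [m.mul_inv, k.inv_mul, one_mul]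
  refine ⟨⟨↑k⁻¹ * m, Unitary.mem_iff.2 ⟨hu1, hu2⟩⟩, fun y => ?_⟩
  -- For u = (1 - N)⁻¹(1 + N), multiplying (u - N)y by 1 - N leaves exactly y + N²y.
  refine abs_le_of_sq_le_sq' ((hp _).trans (le_of_eq ?_)) (norm_nonneg _) |>.2
  congr 2
  change (1 - N) * ((↑k⁻¹ : B) * m * y - N * y) = y + N * (N * y)
  rw [mul_sub, mul_assoc (↑k⁻¹ : B), ← mul_assoc (1 - N), ← hk, k.mul_inv, one_mul, hk, hm]
  noncomm_ring

end Polar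

/-! ### Approximate polar decomposition: the unital and stable rank one cases. -/

section HasUnitaries

/-- Every element `w` of `A` for which `w⋆ w` and `w w⋆` approximately fix a certain test element
acts from the left like a unitary, with an error controlled by the defect of `w⋆ w`. -/
def HasApproxPolar (A : Type*) [NonUnitalCStarAlgebra A] : Prop :=
  ∃ e₀ : A, ∀ w : A, ‖star w * w * e₀ - e₀‖ < 1 → ‖w * star w * e₀ - e₀‖ < 1 →
    ∀ (F : Finset A) (ε : ℝ), 0 < ε → ∃ u : unitary (Unitization ℂ A), ∀ a ∈ F,
      ‖leftMul (u : Unitization ℂ A) a - w * a‖ ≤ ‖star w * w * a - a‖ + ε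

variable {A : Type*} [NonUnitalCStarAlgebra A]

theorem norm_leftMul_sub_eq (u : Unitization ℂ A) (a b : A) :
    ‖leftMul u a - b‖ = ‖u * (a : Unitization ℂ A) - (b : Unitization ℂ A)‖ := by
  rw [← inr_leftMul, ← Unitization.inr_sub, Unitization.norm_inr]

/-- The test element is the unit e, so the hypotheses say that w⋆w and ww⋆ are invertible in A.
Since the unitization has a larger unit, w is completed to x = w + (1 - e), whose polar part acts on
A as required. -/
theorem hasApproxPolar_of_unital (h : IsUnitalAlg A) : HasApproxPolar A := by
  obtain ⟨e, he⟩ := h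
  have hes : star e = e := by
    calc star e = star e * e := ((he _).2).symm
      _ = star (star e * e) := by rw [star_mul, star_star]
      _ = e := by rw [(he _).2, star_star]
  refine ⟨e, fun w h1 h2 F ε hε => ?_⟩
  rw [(he _).2] at h1 h2
  have hie : ∀ a : A, (e : Unitization ℂ A) * a = a ∧ (a : Unitization ℂ A) * e = a := fun a => by
    rw [← Unitization.inr_mul, ← Unitization.inr_mul, (he a).1, (he a).2]; exact ⟨rfl, rfl⟩
  set x : Unitization ℂ A := (w : Unitization ℂ A) + (1 - (e : Unitization ℂ A)) with hx
  have hxs : star x = ((star w : A) : Unitization ℂ A) + (1 - (e : Unitization ℂ A)) := by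
    rw [hx, star_add, star_sub, star_one, ← Unitization.inr_star, ← Unitization.inr_star, hes]
  have hmul : ∀ a b : A, ((a : Unitization ℂ A) + (1 - (e : Unitization ℂ A))) *
      ((b : Unitization ℂ A) + (1 - (e : Unitization ℂ A))) =
      1 - ((e - a * b : A) : Unitization ℂ A) := by
    intro a b
    rw [Unitization.inr_sub, Unitization.inr_mul]
    have h3 := (hie a).2
    have h4 := (hie b).1
    have h5 := (hie e).1
    simp only [mul_add, add_mul, mul_sub, sub_mul, mul_one, one_mul, h3, h4, h5]
    abel
  have hu1 : IsUnit (star x * x) := by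
    rw [hxs, hx, hmul]
    refine isUnit_one_sub_of_norm_lt_one ?_
    rwa [Unitization.norm_inr, norm_sub_rev]
  have hu2 : IsUnit (x * star x) := by
    rw [hxs, hx, hmul]
    refine isUnit_one_sub_of_norm_lt_one ?_
    rwa [Unitization.norm_inr, norm_sub_rev]
  -- Invertibility of x x⋆ gives a right inverse of x, that of x⋆x a left inverse.
  have hxu : IsUnit x := by
    obtain ⟨p, hp⟩ := hu1
    obtain ⟨q, hq⟩ := hu2
    refine isUnit_iff_exists_and_exists.2 ⟨⟨star x * ↑q⁻¹, ?_⟩, ⟨↑p⁻¹ * star x, ?_⟩⟩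
    · rw [← mul_assoc, ← hq, q.mul_inv]
    · rw [mul_assoc, ← hp, p.inv_mul]
  obtain ⟨u, hu⟩ := exists_unitary_of_isUnit hxu
  refine ⟨u, fun a _ => ?_⟩
  have hxa : ∀ a : A, x * (a : Unitization ℂ A) = ((w * a : A) : Unitization ℂ A) := fun a => by
    rw [hx, add_mul, sub_mul, one_mul, (hie a).1, sub_self, add_zero, Unitization.inr_mul]
  have hxa' : ∀ a : A, star x * (a : Unitization ℂ A) = ((star w * a : A) : Unitization ℂ A) :=
    fun a => by
      rw [hxs, add_mul, sub_mul, one_mul, (hie a).1, sub_self, add_zero, Unitization.inr_mul]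
  have h6 := hu a
  rw [mul_assoc (star x), hxa, hxa', ← Unitization.inr_sub, Unitization.norm_inr] at h6
  rw [norm_leftMul_sub_eq, mul_assoc]
  linarith

/-- Replace w by an invertible x of the unitization with x a and x⋆x a close to w a and w⋆w a on the
finite set, and take the polar part of x. No condition on w is needed, and the test element 0 makes
both conditions vacuous. -/
theorem hasApproxPolar_of_stableRankOne (h : HasStableRankOne A) : HasApproxPolar A := by
  refine ⟨0, fun w _ _ F ε hε => ?_⟩
  have hU : IsOpen {x : Unitization ℂ A | ∀ a ∈ F,
      ‖x * (a : Unitization ℂ A) - (w : Unitization ℂ A) * (a : Unitization ℂ A)‖ +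
      ‖star x * x * (a : Unitization ℂ A) -
        star (w : Unitization ℂ A) * (w : Unitization ℂ A) * (a : Unitization ℂ A)‖ < ε} := by
    have : {x : Unitization ℂ A | ∀ a ∈ F,
      ‖x * (a : Unitization ℂ A) - (w : Unitization ℂ A) * (a : Unitization ℂ A)‖ +
      ‖star x * x * (a : Unitization ℂ A) -
        star (w : Unitization ℂ A) * (w : Unitization ℂ A) * (a : Unitization ℂ A)‖ < ε} =
      ⋂ a ∈ F, {x : Unitization ℂ A |
      ‖x * (a : Unitization ℂ A) - (w : Unitization ℂ A) * (a : Unitization ℂ A)‖ +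
      ‖star x * x * (a : Unitization ℂ A) -
        star (w : Unitization ℂ A) * (w : Unitization ℂ A) * (a : Unitization ℂ A)‖ < ε} := by
      ext; simp
    rw [this]
    exact isOpen_biInter_finset fun a _ => isOpen_lt (by fun_prop) continuous_const
  obtain ⟨x, hxF, hx⟩ := h.exists_mem_open hU ⟨(w : Unitization ℂ A), by simpa using fun _ _ => hε⟩
  obtain ⟨u, hu⟩ := exists_unitary_of_isUnit hxF
  refine ⟨u, fun a ha => ?_⟩
  have h1 := hu a
  have h2 := hx a ha
  rw [norm_leftMul_sub_eq, ← Unitization.norm_inr (𝕜 := ℂ) (star w * w * a - a)]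
  simp only [Unitization.inr_sub, Unitization.inr_mul, Unitization.inr_star]
  have h3 := norm_sub_le_norm_sub_add_norm_sub ((u : Unitization ℂ A) * (a : Unitization ℂ A))
    (x * (a : Unitization ℂ A)) ((w : Unitization ℂ A) * (a : Unitization ℂ A))
  have h4 := norm_sub_le_norm_sub_add_norm_sub (star x * x * (a : Unitization ℂ A))
    (star (w : Unitization ℂ A) * (w : Unitization ℂ A) * (a : Unitization ℂ A))
    (a : Unitization ℂ A)
  linarith

/-- Conjugation by an approximate unitary of `A` is approximated by an inner automorphism. -/
theorem HasApproxPolar.exists_adAut (h : HasApproxPolar A) : ∃ e₀ : A, ∀ w : A,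
    ‖star w * w * e₀ - e₀‖ < 1 → ‖w * star w * e₀ - e₀‖ < 1 →
    ∀ (F : Finset A) (ε : ℝ), 0 < ε → ∃ u : unitary (Unitization ℂ A), ∀ a ∈ F,
      ‖adAut u a - w * a * star w‖ ≤
        ‖star w * w * a - a‖ + ‖w‖ * ‖star w * w * star a - star a‖ + ε := by
  classical
  obtain ⟨e₀, he⟩ := h
  refine ⟨e₀, fun w h1 h2 F ε hε => ?_⟩
  -- Adjoints are included because u a u⋆ - w a w⋆ = (u a - w a) u⋆ + w (u a⋆ - w a⋆)⋆. The second
  -- summand carries a factor ‖w‖, whence the tolerance ε / (1 + ‖w‖).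
  obtain ⟨u, hu⟩ := he w h1 h2 (F ∪ F.image star) (ε / (1 + ‖w‖)) (by positivity)
  refine ⟨u, fun a ha => ?_⟩
  have h3 := hu a (Finset.mem_union_left _ ha)
  have h4 := hu (star a) (Finset.mem_union_right _ (Finset.mem_image_of_mem _ ha))
  set U := (u : Unitization ℂ A)
  have key : ((adAut u a - w * a * star w : A) : Unitization ℂ A) =
      ((leftMul U a - w * a : A) : Unitization ℂ A) * ((star u : unitary _) : Unitization ℂ A) +
        ((w * star (leftMul U (star a) - w * star a) : A) : Unitization ℂ A) := by
    simp only [Unitization.inr_sub, Unitization.inr_mul, Unitization.inr_star, inr_adAut,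
      inr_leftMul, star_sub, star_mul, star_star, Unitary.coe_star, U, sub_mul, mul_sub,
      mul_assoc]
    abel
  have h5 : ‖adAut u a - w * a * star w‖ ≤
      ‖leftMul U a - w * a‖ + ‖w‖ * ‖leftMul U (star a) - w * star a‖ := by
    rw [← Unitization.norm_inr (𝕜 := ℂ), key]
    refine (norm_add_le _ _).trans (add_le_add ?_ ?_)
    · rw [CStarRing.norm_mul_coe_unitary, Unitization.norm_inr]
    · rw [Unitization.norm_inr]
      refine (norm_mul_le _ _).trans ?_
      rw [norm_star]
  have h6 := mul_le_mul_of_nonneg_left h4 (norm_nonneg w)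
  have h7 : ε / (1 + ‖w‖) + ‖w‖ * (ε / (1 + ‖w‖)) = ε := by
    field_simp
  linarith

end HasUnitaries

/-- The `*`-homomorphism into a product with given coordinates. -/
def piHom {ι A B : Type*} [NonUnitalCStarAlgebra A] [NonUnitalCStarAlgebra B]
    (f : ι → B →⋆ₙₐ[ℂ] A) : B →⋆ₙₐ[ℂ] (ι → A) where
  toFun b i := f i b
  map_smul' c b := funext fun i => map_smul (f i) c b
  map_zero' := funext fun i => map_zero (f i)
  map_add' a b := funext fun i => map_add (f i) a b
  map_mul' a b := funext fun i => map_mul (f i) a b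
  map_star' b := funext fun i => map_star (f i) b

@[simp] theorem piHom_apply {ι A B : Type*} [NonUnitalCStarAlgebra A] [NonUnitalCStarAlgebra B]
    (f : ι → B →⋆ₙₐ[ℂ] A) (b : B) (i : ι) : piHom f b i = f i b := rfl

theorem continuous_hom {A B : Type*} [NonUnitalCStarAlgebra A] [NonUnitalCStarAlgebra B]
    (φ : A →⋆ₙₐ[ℂ] B) : Continuous φ :=
  AddMonoidHomClass.continuous_of_bound φ 1 fun a => by
    simpa using NonUnitalStarAlgHom.norm_apply_le φ a

theorem perm_inv_apply_self {ι : Type*} (π : Equiv.Perm ι) (i : ι) : π⁻¹ (π i) = i :=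
  π.symm_apply_apply i

/-! ### Systems of matrix units -/

/-- A system of matrix units with coefficients in `A` inside `C`: linear maps
`a ↦ E i j ⊗ a` with the multiplication and adjoint rules of matrix units. -/
structure MatrixUnits (ι A C : Type*) [NonUnitalCStarAlgebra A] [NonUnitalCStarAlgebra C] where
  unit : ι → ι → A →ₗ[ℂ] C
  mul_same : ∀ i j k a b, unit i j a * unit j k b = unit i k (a * b)
  mul_ne : ∀ i j k l a b, j ≠ k → unit i j a * unit k l b = 0
  star_unit : ∀ i j a, star (unit i j a) = unit j i (star a)

namespace MatrixUnits

variable {ι κ A C D : Type*} [NonUnitalCStarAlgebra A] [NonUnitalCStarAlgebra C]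
  [NonUnitalCStarAlgebra D]

/-- The corner homomorphism `a ↦ E i i ⊗ a`. -/
def cornerHom (R : MatrixUnits ι A C) (i : ι) : A →⋆ₙₐ[ℂ] C where
  toFun := R.unit i i
  map_smul' c a := map_smul (R.unit i i) c a
  map_zero' := map_zero (R.unit i i)
  map_add' a b := map_add (R.unit i i) a b
  map_mul' a b := (R.mul_same i i i a b).symm
  map_star' a := (R.star_unit i i a).symm

/-- By the C⋆-identity the norm squared is that of E j j ⊗ a⋆a, and the corner map is a contractive
`*`-homomorphism. -/
theorem norm_unit_le (R : MatrixUnits ι A C) (i j : ι) (a : A) : ‖R.unit i j a‖ ≤ ‖a‖ := by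
  have h : ‖R.unit i j a‖ * ‖R.unit i j a‖ ≤ ‖a‖ * ‖a‖ := by
    rw [← CStarRing.norm_star_mul_self, ← CStarRing.norm_star_mul_self, R.star_unit, R.mul_same]
    exact NonUnitalStarAlgHom.norm_apply_le (R.cornerHom j) _
  exact abs_le_of_sq_le_sq' (by simpa [sq] using h) (norm_nonneg _) |>.2

theorem continuous_unit (R : MatrixUnits ι A C) (i j : ι) : Continuous (R.unit i j) :=
  AddMonoidHomClass.continuous_of_bound (R.unit i j) 1 fun a => by
    simpa using R.norm_unit_le i j a

/-- Post-composition of a system of matrix units with a `*`-homomorphism. -/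
def map (R : MatrixUnits ι A C) (χ : C →⋆ₙₐ[ℂ] D) : MatrixUnits ι A D where
  unit i j := (χ : C →ₗ[ℂ] D).comp (R.unit i j)
  mul_same i j k a b := by
    change χ _ * χ _ = χ _
    rw [← map_mul, R.mul_same]
  mul_ne i j k l a b h := by
    change χ _ * χ _ = 0
    rw [← map_mul, R.mul_ne _ _ _ _ _ _ h, map_zero]
  star_unit i j a := by
    change star (χ _) = χ _
    rw [← map_star, R.star_unit]

@[simp] theorem map_unit (R : MatrixUnits ι A C) (χ : C →⋆ₙₐ[ℂ] D) (i j : ι) (a : A) :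
    (R.map χ).unit i j a = χ (R.unit i j a) := rfl

/-- Pre-composition of a system of matrix units with a `*`-homomorphism. -/
def comap (R : MatrixUnits ι A C) (χ : D →⋆ₙₐ[ℂ] A) : MatrixUnits ι D C where
  unit i j := (R.unit i j).comp (χ : D →ₗ[ℂ] A)
  mul_same i j k a b := by
    change R.unit _ _ (χ _) * R.unit _ _ (χ _) = R.unit _ _ (χ _)
    rw [R.mul_same, map_mul χ]
  mul_ne i j k l a b h := R.mul_ne _ _ _ _ _ _ h
  star_unit i j a := by
    change star (R.unit _ _ (χ _)) = R.unit _ _ (χ _)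
    rw [R.star_unit, map_star χ]

/-- Reindexing of a system of matrix units. -/
def reindex (R : MatrixUnits ι A C) (e : κ ≃ ι) : MatrixUnits κ A C where
  unit i j := R.unit (e i) (e j)
  mul_same _ _ _ a b := R.mul_same _ _ _ a b
  mul_ne _ _ _ _ a b h := R.mul_ne _ _ _ _ a b (e.injective.ne h)
  star_unit _ _ a := R.star_unit _ _ a

/-- The composite `E i j ⊗ E k l ⊗ a` of two systems of matrix units. -/
def prod (R : MatrixUnits ι C D) (S : MatrixUnits κ A C) : MatrixUnits (ι × κ) A D where
  unit p q := (R.unit p.1 q.1).comp (S.unit p.2 q.2)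
  mul_same i j k a b := by
    change R.unit _ _ (S.unit _ _ _) * R.unit _ _ (S.unit _ _ _) = R.unit _ _ (S.unit _ _ _)
    rw [R.mul_same, S.mul_same]
  mul_ne i j k l a b h := by
    change R.unit _ _ (S.unit _ _ _) * R.unit _ _ (S.unit _ _ _) = 0
    by_cases h1 : j.1 = k.1
    · have h2 : j.2 ≠ k.2 := fun h2 => h (Prod.ext h1 h2)
      rw [h1, R.mul_same, S.mul_ne _ _ _ _ _ _ h2, map_zero]
    · exact R.mul_ne _ _ _ _ _ _ h1
  star_unit i j a := by
    change star (R.unit _ _ (S.unit _ _ _)) = R.unit _ _ (S.unit _ _ _)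
    rw [R.star_unit, S.star_unit]

section Sums

variable [Fintype ι] [Fintype κ] (R : MatrixUnits ι A C)

/-- The direct sum homomorphism `(aᵢ)ᵢ ↦ ∑ᵢ E i i ⊗ aᵢ`. -/
def diag : (ι → A) →⋆ₙₐ[ℂ] C where
  toFun b := ∑ i, R.unit i i (b i)
  map_smul' c b := by simp [Finset.smul_sum]
  map_zero' := by simp
  map_add' a b := by simp [Finset.sum_add_distrib]
  map_mul' a b := by
    classical
    rw [Finset.sum_mul]
    refine Finset.sum_congr rfl fun i _ => ?_
    rw [Finset.mul_sum, Finset.sum_eq_single i]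
    · rw [R.mul_same]; rfl
    · exact fun j _ h => R.mul_ne _ _ _ _ _ _ h.symm
    · simp
  map_star' b := by
    rw [star_sum]
    refine Finset.sum_congr rfl fun i _ => ?_
    rw [R.star_unit]; rfl

theorem diag_apply (b : ι → A) : R.diag b = ∑ i, R.unit i i (b i) := rfl

/-- The amplification `a ↦ 1 ⊗ a`. -/
def amp : A →⋆ₙₐ[ℂ] C := R.diag.comp (piHom fun _ => .id ℂ A)

theorem amp_apply (a : A) : R.amp a = ∑ i, R.unit i i a := rfl

/-- The element `∑ E i j ⊗ x i j`. -/
def matSum (x : ι → ι → A) : C := ∑ i, ∑ j, R.unit i j (x i j)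

/-- The permutation matrix `∑ E (π i) i ⊗ e`. -/
def perm (π : Equiv.Perm ι) (e : A) : C := ∑ i, R.unit (π i) i e

theorem perm_mul_unit (π : Equiv.Perm ι) (e : A) (i j : ι) (a : A) :
    R.perm π e * R.unit i j a = R.unit (π i) j (e * a) := by
  classical
  rw [perm, Finset.sum_mul, Finset.sum_eq_single i]
  · exact R.mul_same _ _ _ _ _
  · exact fun k _ h => R.mul_ne _ _ _ _ _ _ h
  · simp

theorem star_perm (π : Equiv.Perm ι) (e : A) : star (R.perm π e) = R.perm π⁻¹ (star e) := by
  rw [perm, perm, star_sum]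
  conv_rhs => rw [← Equiv.sum_comp π]
  refine Finset.sum_congr rfl fun i _ => ?_
  rw [R.star_unit, perm_inv_apply_self]

theorem unit_mul_perm (π : Equiv.Perm ι) (e : A) (i j : ι) (a : A) :
    R.unit i j a * R.perm π e = R.unit i (π⁻¹ j) (a * e) := by
  have h := congrArg star (R.perm_mul_unit π⁻¹ (star e) j i (star a))
  rw [star_mul, R.star_unit, star_perm, R.star_unit, star_star, star_star, inv_inv, star_mul,
    star_star, star_star] at h
  exact h

/-- Without a unit in A a permutation matrix must carry a coefficient. For e far along an
approximate unit, this identity makes it an approximate unitary. -/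
theorem perm_mul_perm_inv (π : Equiv.Perm ι) (e f : A) :
    R.perm π e * R.perm π⁻¹ f = R.amp (e * f) := by
  conv_lhs => rw [perm, Finset.sum_mul]
  conv_rhs => rw [amp_apply, ← Equiv.sum_comp π]
  refine Finset.sum_congr rfl fun i _ => ?_
  rw [unit_mul_perm, inv_inv]

theorem perm_mul_matSum_mul_star (π : Equiv.Perm ι) (e : A) (x : ι → ι → A) :
    R.perm π e * R.matSum x * star (R.perm π e) =
      R.matSum fun i j => e * x (π⁻¹ i) (π⁻¹ j) * star e := by
  conv_rhs => rw [matSum, ← Equiv.sum_comp π]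
  rw [star_perm, matSum, Finset.mul_sum, Finset.sum_mul]
  refine Finset.sum_congr rfl fun i _ => ?_
  conv_rhs => rw [← Equiv.sum_comp π]
  rw [Finset.mul_sum, Finset.sum_mul]
  refine Finset.sum_congr rfl fun j _ => ?_
  rw [perm_mul_unit, unit_mul_perm, inv_inv, perm_inv_apply_self, perm_inv_apply_self]

theorem norm_perm_le (π : Equiv.Perm ι) (e : A) : ‖R.perm π e‖ ≤ ‖e‖ := by
  have h : ‖R.perm π e‖ * ‖R.perm π e‖ ≤ ‖e‖ * ‖e‖ := by
    rw [← CStarRing.norm_self_mul_star, ← CStarRing.norm_self_mul_star, star_perm,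
      perm_mul_perm_inv]
    exact NonUnitalStarAlgHom.norm_apply_le R.amp _
  exact abs_le_of_sq_le_sq' (by simpa [sq] using h) (norm_nonneg _) |>.2

end Sums

end MatrixUnits

/-- A `*`-homomorphism `φ : A → C` is nondegenerate: the image of an approximate unit of `A` is
an approximate unit for `C`. -/
def Nondegenerate {A C : Type*} [NonUnitalCStarAlgebra A] [NonUnitalCStarAlgebra C]
    (φ : A →⋆ₙₐ[ℂ] C) : Prop :=
  ∀ c : C, Tendsto (fun e => φ e * c) (approxUnit A) (𝓝 c)

section Nondeg

variable {A C D : Type*} [NonUnitalCStarAlgebra A] [NonUnitalCStarAlgebra C]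
  [NonUnitalCStarAlgebra D]

/-- No bound on d and no uniformity is needed: φ(e)φ(d)c = φ(ed)c tends to φ(d)c along the
approximate unit, since e d tends to d. -/
theorem nondegenerate_of_approx {φ : A →⋆ₙₐ[ℂ] C} {T : Set C} (hT : Dense T)
    (h : ∀ c ∈ T, ∀ ε > 0, ∃ d : A, ‖φ d * c - c‖ < ε) : Nondegenerate φ := by
  intro c
  rw [Metric.tendsto_nhds]
  intro ε hε
  obtain ⟨c', hc', hT'⟩ := Metric.dense_iff.1 hT c (ε / 6) (by positivity)
  rw [Metric.mem_ball, dist_eq_norm] at hc'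
  obtain ⟨d, hd⟩ := h c' hT' (ε / 6) (by positivity)
  have h1 : Tendsto (fun e => φ e * (φ d * c')) (approxUnit A) (𝓝 (φ d * c')) := by
    have h2 : Tendsto (fun e => φ (e * d) * c') (approxUnit A) (𝓝 (φ d * c')) :=
      (((continuous_hom φ).tendsto d).comp (tendsto_approxUnit_mul d)).mul_const c'
    refine h2.congr fun e => ?_
    rw [map_mul, mul_assoc]
  filter_upwards [Metric.tendsto_nhds.1 h1 (ε / 6) (by positivity), eventually_approxUnit]
    with e he he1
  rw [dist_eq_norm] at he ⊢
  have hle : ∀ y : C, ‖φ e * y‖ ≤ ‖y‖ := fun y => (norm_mul_le _ _).trans <|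
    mul_le_of_le_one_left (norm_nonneg _)
      ((NonUnitalStarAlgHom.norm_apply_le φ e).trans he1.1)
  have h3 := hle (c' - c)
  have h4 := hle (φ d * c' - c')
  -- The errors of d on c' and of c' against c each occur twice, which with the remaining term makes
  -- five contributions below ε / 6.
  have key : φ e * c - c = (φ e * (φ d * c') - φ d * c') - φ e * (φ d * c' - c') -
      φ e * (c' - c) + (φ d * c' - c') + (c' - c) := by
    simp only [mul_sub]; abel
  rw [key]
  have h5 := norm_add_le ((φ e * (φ d * c') - φ d * c') - φ e * (φ d * c' - c') -
      φ e * (c' - c) + (φ d * c' - c')) (c' - c)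
  have h6 := norm_add_le ((φ e * (φ d * c') - φ d * c') - φ e * (φ d * c' - c') -
      φ e * (c' - c)) (φ d * c' - c')
  have h7 := norm_sub_le ((φ e * (φ d * c') - φ d * c') - φ e * (φ d * c' - c'))
      (φ e * (c' - c))
  have h8 := norm_sub_le (φ e * (φ d * c') - φ d * c') (φ e * (φ d * c' - c'))
  linarith

theorem Nondegenerate.comp {φ : A →⋆ₙₐ[ℂ] C} {ψ : C →⋆ₙₐ[ℂ] D} (hψ : Nondegenerate ψ)
    (hφ : Nondegenerate φ) : Nondegenerate (ψ.comp φ) := by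
  refine nondegenerate_of_approx dense_univ fun d _ ε hε => ?_
  obtain ⟨c, hc⟩ := (Metric.tendsto_nhds.1 (hψ d) (ε / 3) (by positivity)).exists
  have h1 : Tendsto (fun e => ψ (φ e * c) * d) (approxUnit A) (𝓝 (ψ c * d)) :=
    (((continuous_hom ψ).tendsto c).comp (hφ c)).mul_const d
  have hnb : Tendsto (fun e => ψ (φ e) * (ψ c * d)) (approxUnit A) (𝓝 (ψ c * d)) :=
    h1.congr fun e => by rw [map_mul, mul_assoc]
  obtain ⟨e, he, he1⟩ := ((Metric.tendsto_nhds.1 hnb (ε / 3) (by positivity)).and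
    eventually_approxUnit).exists
  rw [dist_eq_norm] at hc he
  refine ⟨e, ?_⟩
  have h3 : ‖ψ (φ e) * (ψ c * d - d)‖ ≤ ‖ψ c * d - d‖ := (norm_mul_le _ _).trans <|
    mul_le_of_le_one_left (norm_nonneg _) ((NonUnitalStarAlgHom.norm_apply_le (ψ.comp φ) e).trans
      he1.1)
  have key : ψ (φ e) * d - d = (ψ (φ e) * (ψ c * d) - ψ c * d) - ψ (φ e) * (ψ c * d - d) +
      (ψ c * d - d) := by
    rw [mul_sub]; abel
  change ‖ψ (φ e) * d - d‖ < ε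
  rw [key]
  have h4 := norm_add_le ((ψ (φ e) * (ψ c * d) - ψ c * d) - ψ (φ e) * (ψ c * d - d)) (ψ c * d - d)
  have h5 := norm_sub_le (ψ (φ e) * (ψ c * d) - ψ c * d) (ψ (φ e) * (ψ c * d - d))
  linarith

theorem nondegenerate_equiv (θ : A ≃⋆ₐ[ℂ] C) : Nondegenerate (θ : A →⋆ₙₐ[ℂ] C) := by
  refine nondegenerate_of_approx dense_univ fun c _ ε hε => ?_
  obtain ⟨d, hd⟩ := (Metric.tendsto_nhds.1 (tendsto_approxUnit_mul c) ε hε).exists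
  refine ⟨θ.symm d, ?_⟩
  change ‖θ (θ.symm d) * c - c‖ < ε
  rwa [θ.apply_symm_apply, ← dist_eq_norm]

/-- Squares are needed because w⋆w = ww⋆ is the amplification of e² when w is a permutation matrix
with self-adjoint coefficient e. -/
theorem Nondegenerate.mul {φ : A →⋆ₙₐ[ℂ] C} (hφ : Nondegenerate φ) (c : C) :
    Tendsto (fun e => φ (e * e) * c) (approxUnit A) (𝓝 c) := by
  have h := hφ c
  rw [tendsto_iff_norm_sub_tendsto_zero] at h ⊢
  have h2 : Tendsto (fun e => ‖φ e * c - c‖ + ‖φ e * c - c‖) (approxUnit A) (𝓝 0) := by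
    simpa using h.add h
  refine squeeze_zero' (Eventually.of_forall fun _ => norm_nonneg _) ?_ h2
  filter_upwards [eventually_approxUnit] with e he
  have key : φ (e * e) * c - c = φ e * (φ e * c - c) + (φ e * c - c) := by
    rw [map_mul, mul_sub, mul_assoc]; abel
  rw [key]
  refine (norm_add_le _ _).trans (add_le_add ?_ le_rfl)
  exact (norm_mul_le _ _).trans (mul_le_of_le_one_left (norm_nonneg _)
    ((NonUnitalStarAlgHom.norm_apply_le φ e).trans he.1))

theorem tendsto_approxUnit_conj (a : A) :
    Tendsto (fun e => e * a * e) (approxUnit A) (𝓝 a) := by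
  have h := tendsto_mul_approxUnit a
  have h1 := tendsto_approxUnit_mul a
  rw [tendsto_iff_norm_sub_tendsto_zero] at h h1 ⊢
  have h2 : Tendsto (fun e => ‖e * a - a‖ + ‖a * e - a‖) (approxUnit A) (𝓝 0) := by
    simpa using h1.add h
  refine squeeze_zero' (Eventually.of_forall fun _ => norm_nonneg _) ?_ h2
  filter_upwards [eventually_approxUnit] with e he
  have key : e * a * e - a = (e * a - a) * e + (a * e - a) := by rw [sub_mul]; abel
  rw [key]
  exact (norm_add_le _ _).trans (add_le_add ((norm_mul_le _ _).trans
    (mul_le_of_le_one_right (norm_nonneg _) he.1)) le_rfl)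

/-- In the presence of approximate polar decompositions, conjugation by a permutation matrix is
approximately inner. -/
theorem MatrixUnits.exists_adAut_perm {ι : Type*} [Fintype ι] (R : MatrixUnits ι A C)
    (hC : HasApproxPolar C) (hR : Nondegenerate R.amp) (π : Equiv.Perm ι)
    {J : Type*} (S : Finset J) (x : J → ι → ι → A) (ε : ℝ) (hε : 0 < ε) :
    ∃ u : unitary (Unitization ℂ C), ∀ s ∈ S,
      ‖adAut u (R.matSum (x s)) - R.matSum fun i j => x s (π⁻¹ i) (π⁻¹ j)‖ < ε := by
  classical
  obtain ⟨e₀, he⟩ := hC.exists_adAut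
  have hconv : ∀ s, Tendsto (fun e => R.matSum fun i j => e * x s (π⁻¹ i) (π⁻¹ j) * e)
      (approxUnit A) (𝓝 (R.matSum fun i j => x s (π⁻¹ i) (π⁻¹ j))) := fun s =>
    tendsto_finsetSum _ fun i _ => tendsto_finsetSum _ fun j _ =>
      ((R.continuous_unit i j).tendsto _).comp (tendsto_approxUnit_conj _)
  have ev1 := Metric.tendsto_nhds.1 (hR.mul e₀) 1 one_pos
  have ev2 : ∀ᶠ e in approxUnit A, ∀ s ∈ S,
      ‖R.amp (e * e) * R.matSum (x s) - R.matSum (x s)‖ < ε / 4 ∧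
      ‖R.amp (e * e) * star (R.matSum (x s)) - star (R.matSum (x s))‖ < ε / 4 ∧
      ‖(R.matSum fun i j => e * x s (π⁻¹ i) (π⁻¹ j) * e) -
        R.matSum fun i j => x s (π⁻¹ i) (π⁻¹ j)‖ < ε / 4 := by
    rw [eventually_all_finset]
    intro s _
    have h1 := Metric.tendsto_nhds.1 (hR.mul (R.matSum (x s))) (ε / 4) (by positivity)
    have h2 := Metric.tendsto_nhds.1 (hR.mul (star (R.matSum (x s)))) (ε / 4) (by positivity)
    have h3 := Metric.tendsto_nhds.1 (hconv s) (ε / 4) (by positivity)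
    simp only [dist_eq_norm] at h1 h2 h3
    exact h1.and (h2.and h3)
  -- Far enough along the approximate unit, the permutation matrix with coefficient e is
  -- approximately unitary on e₀ and on the test elements, and its action on them is close to the
  -- pure permutation of entries.
  obtain ⟨e, ⟨hn, hs⟩, h1, h2⟩ := (eventually_approxUnit.and (ev1.and ev2)).exists
  rw [dist_eq_norm] at h1
  have hw1 : star (R.perm π e) * R.perm π e = R.amp (e * e) := by
    have := R.perm_mul_perm_inv π⁻¹ (star e) e
    rw [inv_inv] at this
    rw [star_perm, this, hs]
  have hw2 : R.perm π e * star (R.perm π e) = R.amp (e * e) := by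
    rw [star_perm, perm_mul_perm_inv, hs]
  obtain ⟨u, hu⟩ := he (R.perm π e) (by rwa [hw1]) (by rwa [hw2])
    (S.image fun s => R.matSum (x s)) (ε / 4) (by positivity)
  refine ⟨u, fun s hsS => ?_⟩
  have h3 := hu _ (Finset.mem_image_of_mem _ hsS)
  obtain ⟨h4, h5, h6⟩ := h2 s hsS
  rw [hw1, perm_mul_matSum_mul_star, hs] at h3
  have h7 : ‖R.perm π e‖ * ‖R.amp (e * e) * star (R.matSum (x s)) - star (R.matSum (x s))‖ ≤
      ‖R.amp (e * e) * star (R.matSum (x s)) - star (R.matSum (x s))‖ :=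
    mul_le_of_le_one_left (norm_nonneg _) ((R.norm_perm_le π e).trans hn)
  have h8 := norm_sub_le_norm_sub_add_norm_sub (adAut u (R.matSum (x s)))
    (R.matSum fun i j => e * x s (π⁻¹ i) (π⁻¹ j) * e) (R.matSum fun i j => x s (π⁻¹ i) (π⁻¹ j))
  linarith

end Nondeg

/-! ### Inductive limits: the canonical maps -/

section Limit

variable (A : ℕ → Type*) [∀ k, NonUnitalCStarAlgebra (A k)] (φ : ∀ k, A k →⋆ₙₐ[ℂ] A (k + 1))

instance isClosed_seqLimit : IsClosed (seqLimit A φ : Set (SeqAlg A)) :=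
  NonUnitalStarSubalgebra.isClosed_topologicalClosure _

instance : NonUnitalCStarAlgebra (seqLimit A φ) := inferInstance

/-- The transition map `A k → A l`, extended by zero to `l < k`. -/
def transHom (k l : ℕ) : A k →⋆ₙₐ[ℂ] A l :=
  if h : k ≤ l then
    Nat.leRecOn (C := fun j => A k →⋆ₙₐ[ℂ] A j) h (fun {j} f => (φ j).comp f) (.id ℂ (A k))
  else 0

theorem transHom_self (k : ℕ) (x : A k) : transHom A φ k k x = x := by
  rw [transHom, dif_pos le_rfl, Nat.leRecOn_self]; rfl

theorem transHom_succ {k l : ℕ} (h : k ≤ l) (x : A k) :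
    transHom A φ k (l + 1) x = φ l (transHom A φ k l x) := by
  rw [transHom, transHom, dif_pos h, dif_pos (h.trans l.le_succ), Nat.leRecOn_succ h]; rfl

theorem transHom_succ_left {k l : ℕ} (h : k + 1 ≤ l) (x : A k) :
    transHom A φ (k + 1) l (φ k x) = transHom A φ k l x := by
  induction l, h using Nat.le_induction with
  | base => rw [transHom_self, transHom_succ A φ le_rfl, transHom_self]
  | succ l h ih => rw [transHom_succ A φ h, ih, transHom_succ A φ (k.le_succ.trans h)]

/-- The bounded sequence `(0, …, 0, x, φ x, …)`. -/
def toLp (k : ℕ) : A k →⋆ₙₐ[ℂ] lp A ∞ where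
  toFun x := ⟨fun l => transHom A φ k l x, memℓp_infty ⟨‖x‖, by
    rintro _ ⟨l, rfl⟩
    exact NonUnitalStarAlgHom.norm_apply_le _ x⟩⟩
  map_smul' c x := by ext l; exact map_smul (transHom A φ k l) c x
  map_zero' := by ext l; exact map_zero (transHom A φ k l)
  map_add' x y := by ext l; exact map_add (transHom A φ k l) x y
  map_mul' x y := by ext l; exact map_mul (transHom A φ k l) x y
  map_star' x := by ext l; exact map_star (transHom A φ k l) x

theorem toLp_mem_compatSeq (k : ℕ) (x : A k) : toLp A φ k x ∈ compatSeq A φ := by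
  change ∀ᶠ l in atTop, _
  filter_upwards [eventually_ge_atTop k] with l hl
  exact transHom_succ A φ hl x

/-- The canonical map from the `k`-th algebra to the inductive limit. -/
def toLimit (k : ℕ) : A k →⋆ₙₐ[ℂ] seqLimit A φ :=
  NonUnitalStarAlgHom.codRestrict ((seqMk A).comp (toLp A φ k)) (seqLimit A φ) fun x =>
    NonUnitalStarSubalgebra.le_topologicalClosure _ ⟨_, toLp_mem_compatSeq A φ k x, rfl⟩

theorem coe_toLimit (k : ℕ) (x : A k) :
    (toLimit A φ k x : SeqAlg A) = seqMk A (toLp A φ k x) := rfl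

theorem toLimit_succ (k : ℕ) (x : A k) : toLimit A φ (k + 1) (φ k x) = toLimit A φ k x := by
  refine Subtype.ext ?_
  rw [coe_toLimit, coe_toLimit, seqMk_eq_seqMk]
  refine tendsto_const_nhds.congr' ?_
  filter_upwards [eventually_ge_atTop (k + 1)] with l hl
  change (0 : ℝ) = ‖transHom A φ (k + 1) l (φ k x) - transHom A φ k l x‖
  rw [transHom_succ_left A φ hl, sub_self, norm_zero]

/-- A sequence compatible from index N on agrees, modulo null sequences, with the thread started at
its N-th entry. -/
theorem dense_toLimit : Dense {c : seqLimit A φ | ∃ k x, toLimit A φ k x = c} := by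
  rw [Metric.dense_iff]
  intro c ε hε
  have hc : (c : SeqAlg A) ∈ closure (((compatSeq A φ).map (seqMk A) :
      NonUnitalStarSubalgebra ℂ (SeqAlg A)) : Set (SeqAlg A)) := c.2
  obtain ⟨_, ⟨y, hy, rfl⟩, hd⟩ := Metric.mem_closure_iff.1 hc ε hε
  obtain ⟨N, hN⟩ := eventually_atTop.1 (show ∀ᶠ k in atTop, y (k + 1) = φ k (y k) from hy)
  have h1 : ∀ l, N ≤ l → transHom A φ N l (y N) = y l := by
    intro l hl
    induction l, hl using Nat.le_induction with
    | base => rw [transHom_self]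
    | succ l h ih => rw [transHom_succ A φ h, ih, hN l h]
  refine ⟨toLimit A φ N (y N), ?_, N, y N, rfl⟩
  rw [Metric.mem_ball, dist_comm, Subtype.dist_eq, coe_toLimit]
  have h2 : seqMk A (toLp A φ N (y N)) = seqMk A y := by
    rw [seqMk_eq_seqMk]
    refine tendsto_const_nhds.congr' ?_
    filter_upwards [eventually_ge_atTop N] with l hl
    change (0 : ℝ) = ‖transHom A φ N l (y N) - y l‖
    rw [h1 l hl, sub_self, norm_zero]
  rw [h2]
  exact hd

variable {A φ} {ι : Type*} (T : ∀ k, MatrixUnits ι (A k) (A (k + 1)))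

/-- The entries of the shifted sequence `(E i j ⊗ x (k - 1))ₖ`. -/
def shiftFun (i j : ι) (x : ∀ l, A l) : ∀ l, A l
  | 0 => 0
  | l + 1 => (T l).unit i j (x l)

theorem norm_shiftFun_le (i j : ι) (x : lp A ∞) (l : ℕ) : ‖shiftFun T i j x l‖ ≤ ‖x‖ := by
  cases l with
  | zero => exact norm_zero.trans_le (norm_nonneg x)
  | succ l =>
    exact ((T l).norm_unit_le i j (x l)).trans (lp.norm_apply_le_norm ENNReal.top_ne_zero x l)

/-- The entrywise shift `(x k)ₖ ↦ (E i j ⊗ x (k - 1))ₖ`. -/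
def shiftLp (i j : ι) : lp A ∞ →ₗ[ℂ] lp A ∞ where
  toFun x := ⟨shiftFun T i j x, memℓp_infty ⟨‖x‖, by
    rintro _ ⟨l, rfl⟩
    exact norm_shiftFun_le T i j x l⟩⟩
  map_add' x y := by
    ext l
    cases l with
    | zero => exact (add_zero _).symm
    | succ l => exact map_add ((T l).unit i j) (x l) (y l)
  map_smul' c x := by
    ext l
    cases l with
    | zero => exact (smul_zero _).symm
    | succ l => exact map_smul ((T l).unit i j) c (x l)

theorem shiftLp_succ (i j : ι) (x : lp A ∞) (l : ℕ) :
    shiftLp T i j x (l + 1) = (T l).unit i j (x l) := rfl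

theorem shiftLp_mem_nullSeq (i j : ι) (x : lp A ∞) (hx : x ∈ (nullSeq A).toSubmodule) :
    shiftLp T i j x ∈ (nullSeq A).toSubmodule := by
  rw [mem_nullSeq] at hx ⊢
  rw [← tendsto_add_atTop_iff_nat 1]
  exact squeeze_zero (fun _ => norm_nonneg _) (fun l => (T l).norm_unit_le i j (x l)) hx

/-- The shifts on the sequence algebra form a system of matrix units. -/
def seqUnits : MatrixUnits ι (SeqAlg A) (SeqAlg A) where
  unit i j := Submodule.mapQ (nullSeq A).toSubmodule (nullSeq A).toSubmodule (shiftLp T i j)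
    (shiftLp_mem_nullSeq T i j)
  mul_same i j k a b := by
    obtain ⟨x, rfl⟩ := seqMk_surjective A a
    obtain ⟨y, rfl⟩ := seqMk_surjective A b
    have h : shiftLp T i j x * shiftLp T j k y = shiftLp T i k (x * y) := by
      ext l
      cases l with
      | zero => exact zero_mul _
      | succ l => exact (T l).mul_same _ _ _ _ _
    exact congrArg (seqMk A) h
  mul_ne i j k l a b hjk := by
    obtain ⟨x, rfl⟩ := seqMk_surjective A a
    obtain ⟨y, rfl⟩ := seqMk_surjective A b
    have h : shiftLp T i j x * shiftLp T k l y = 0 := by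
      ext m
      cases m with
      | zero => exact zero_mul _
      | succ m => exact (T m).mul_ne _ _ _ _ _ _ hjk
    exact congrArg (seqMk A) h
  star_unit i j a := by
    obtain ⟨x, rfl⟩ := seqMk_surjective A a
    have h : star (shiftLp T i j x) = shiftLp T j i (star x) := by
      ext l
      cases l with
      | zero => exact star_zero _
      | succ l => exact (T l).star_unit _ _ _
    exact congrArg (seqMk A) h

theorem seqUnits_seqMk (i j : ι) (x : lp A ∞) :
    (seqUnits T).unit i j (seqMk A x) = seqMk A (shiftLp T i j x) := rfl

theorem seqUnits_mem
    (hT : ∀ k i j x, φ (k + 1) ((T k).unit i j x) = (T (k + 1)).unit i j (φ k x))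
    (i j : ι) (c : SeqAlg A) (hc : c ∈ seqLimit A φ) :
    (seqUnits T).unit i j c ∈ seqLimit A φ := by
  refine map_mem_closure ((seqUnits T).continuous_unit i j) hc ?_
  rintro _ ⟨y, hy, rfl⟩
  refine ⟨shiftLp T i j y, ?_, rfl⟩
  change ∀ᶠ l in atTop, _
  obtain ⟨N, hN⟩ := eventually_atTop.1 (show ∀ᶠ k in atTop, y (k + 1) = φ k (y k) from hy)
  -- The shift delays compatibility by one index.
  filter_upwards [eventually_ge_atTop (N + 1)] with l hl
  obtain ⟨l, rfl⟩ : ∃ m, l = m + 1 := ⟨l - 1, by omega⟩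
  rw [shiftLp_succ, shiftLp_succ, hN l (by omega), hT]

/-- The system of matrix units on the inductive limit induced by compatible systems of matrix
units from each level to the next. -/
def limitUnits
    (hT : ∀ k i j x, φ (k + 1) ((T k).unit i j x) = (T (k + 1)).unit i j (φ k x)) :
    MatrixUnits ι (seqLimit A φ) (seqLimit A φ) where
  unit i j :=
    { toFun := fun c => ⟨(seqUnits T).unit i j c, seqUnits_mem T hT i j c c.2⟩
      map_add' := fun a b => Subtype.ext (map_add ((seqUnits T).unit i j) (a : SeqAlg A) b)
      map_smul' := fun c a => Subtype.ext (map_smul ((seqUnits T).unit i j) c (a : SeqAlg A)) }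
  mul_same i j k a b := Subtype.ext ((seqUnits T).mul_same i j k a b)
  mul_ne i j k l a b h := Subtype.ext ((seqUnits T).mul_ne i j k l a b h)
  star_unit i j a := by
    apply Subtype.ext
    exact (seqUnits T).star_unit i j (a : SeqAlg A)

theorem limitUnits_toLimit
    (hT : ∀ k i j x, φ (k + 1) ((T k).unit i j x) = (T (k + 1)).unit i j (φ k x))
    (i j : ι) (k : ℕ) (x : A k) :
    (limitUnits T hT).unit i j (toLimit A φ k x) = toLimit A φ (k + 1) ((T k).unit i j x) := by
  refine Subtype.ext ?_
  change (seqUnits T).unit i j (seqMk A (toLp A φ k x)) = seqMk A (toLp A φ (k + 1) _)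
  rw [seqUnits_seqMk, seqMk_eq_seqMk]
  refine tendsto_const_nhds.congr' ?_
  have key : ∀ l, k ≤ l → (T l).unit i j (transHom A φ k l x) =
      transHom A φ (k + 1) (l + 1) ((T k).unit i j x) := by
    intro l hl
    induction l, hl using Nat.le_induction with
    | base => rw [transHom_self, transHom_self]
    | succ l h ih => rw [transHom_succ A φ h, ← hT, ih, ← transHom_succ A φ (by omega)]
  filter_upwards [eventually_ge_atTop (k + 1)] with l hl
  obtain ⟨l, rfl⟩ : ∃ m, l = m + 1 := ⟨l - 1, by omega⟩
  change (0 : ℝ) = ‖(T l).unit i j (transHom A φ k l x) -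
    transHom A φ (k + 1) (l + 1) ((T k).unit i j x)‖
  rw [key l (by omega), sub_self, norm_zero]

end Limit

/-! ### Matrix algebras -/

section MatrixAlg

variable {ι A : Type*} [Fintype ι] [NonUnitalCStarAlgebra A]

/-- Taking entries as an additive map. -/
def MatrixAlg.entryHom (i j : ι) : MatrixAlg ι A →+ A where
  toFun x := x.entry i j
  map_zero' := rfl
  map_add' _ _ := rfl

theorem MatrixAlg.entry_sum {J : Type*} (s : Finset J) (f : J → MatrixAlg ι A) (i j : ι) :
    (∑ k ∈ s, f k).entry i j = ∑ k ∈ s, (f k).entry i j :=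
  map_sum (MatrixAlg.entryHom i j) f s

theorem MatrixUnits.amp_mul_unit {C : Type*} [NonUnitalCStarAlgebra C] (R : MatrixUnits ι A C)
    (e : A) (i j : ι) (a : A) : R.amp e * R.unit i j a = R.unit i j (e * a) :=
  R.perm_mul_unit 1 e i j a

variable (ι A) [DecidableEq ι]

/-- The standard matrix units of `M_ι(A)`. -/
def stdUnits : MatrixUnits ι A (MatrixAlg ι A) where
  unit i j :=
    { toFun := fun a => .of fun i' j' => if i' = i ∧ j' = j then a else 0
      map_add' := fun a b => MatrixAlg.ext fun i' j' => by
        simp only [MatrixAlg.entry_of, MatrixAlg.entry_add]; split_ifs <;> simp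
      map_smul' := fun c a => MatrixAlg.ext fun i' j' => by simp }
  mul_same i j k a b := MatrixAlg.ext fun i' k' => by
    simp only [LinearMap.coe_mk, AddHom.coe_mk, MatrixAlg.entry_mul, MatrixAlg.entry_of]
    rw [Finset.sum_eq_single j (fun l _ h => by simp [h]) (by simp)]
    by_cases h1 : i' = i <;> by_cases h2 : k' = k <;> simp [h1, h2]
  mul_ne i j k l a b h := MatrixAlg.ext fun i' l' => by
    simp only [LinearMap.coe_mk, AddHom.coe_mk, MatrixAlg.entry_mul, MatrixAlg.entry_of,
      MatrixAlg.entry_zero]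
    refine Finset.sum_eq_zero fun m _ => ?_
    by_cases h1 : m = j
    · simp [h1, h]
    · simp [h1]
  star_unit i j a := MatrixAlg.ext fun i' j' => by
    simp only [LinearMap.coe_mk, AddHom.coe_mk, MatrixAlg.entry_star, MatrixAlg.entry_of]
    by_cases h1 : i' = j <;> by_cases h2 : j' = i <;> simp [h1, h2]

variable {ι A}

theorem stdUnits_entry (i j : ι) (a : A) (i' j' : ι) :
    ((stdUnits ι A).unit i j a).entry i' j' = if i' = i ∧ j' = j then a else 0 := rfl

theorem entry_matSum_stdUnits (x : ι → ι → A) (i j : ι) :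
    ((stdUnits ι A).matSum x).entry i j = x i j := by
  rw [MatrixUnits.matSum, MatrixAlg.entry_sum, Finset.sum_eq_single i, MatrixAlg.entry_sum,
    Finset.sum_eq_single j, stdUnits_entry]
  · simp
  · intro k _ h; simp [stdUnits_entry, h.symm]
  · simp
  · intro k _ h
    rw [MatrixAlg.entry_sum]
    refine Finset.sum_eq_zero fun l _ => ?_
    simp [stdUnits_entry, h.symm]
  · simp

theorem matSum_stdUnits_entry (x : MatrixAlg ι A) : (stdUnits ι A).matSum x.entry = x :=
  MatrixAlg.ext fun i j => entry_matSum_stdUnits _ i j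

theorem entry_amp_stdUnits (e : A) (i j : ι) :
    ((stdUnits ι A).amp e).entry i j = if i = j then e else 0 := by
  rw [MatrixUnits.amp_apply, MatrixAlg.entry_sum, Finset.sum_eq_single i, stdUnits_entry]
  · by_cases h : i = j
    · simp [h]
    · simp [h, Ne.symm h]
  · intro k _ h; simp [stdUnits_entry, h.symm]
  · simp

theorem nondegenerate_amp_stdUnits : Nondegenerate (stdUnits ι A).amp := by
  intro c
  rw [← matSum_stdUnits_entry c]
  simp only [MatrixUnits.matSum, Finset.mul_sum, MatrixUnits.amp_mul_unit]
  exact tendsto_finsetSum _ fun i _ => tendsto_finsetSum _ fun j _ =>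
    (((stdUnits ι A).continuous_unit i j).tendsto _).comp (tendsto_approxUnit_mul _)

end MatrixAlg

/-- Transport of a system of matrix units along an isomorphism. -/
def MatrixUnits.conj {ι C D : Type*} [NonUnitalCStarAlgebra C] [NonUnitalCStarAlgebra D]
    (R : MatrixUnits ι C C) (Λ : D ≃⋆ₐ[ℂ] C) : MatrixUnits ι D D :=
  (R.comap (Λ : D →⋆ₙₐ[ℂ] C)).map (Λ.symm : C →⋆ₙₐ[ℂ] D)

theorem MatrixUnits.conj_unit {ι C D : Type*} [NonUnitalCStarAlgebra C] [NonUnitalCStarAlgebra D]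
    (R : MatrixUnits ι C C) (Λ : D ≃⋆ₐ[ℂ] C) (i j : ι) (c : C) :
    (R.conj Λ).unit i j (Λ.symm c) = Λ.symm (R.unit i j c) := by
  change Λ.symm (R.unit i j (Λ (Λ.symm c))) = _
  rw [Λ.apply_symm_apply]

/-! ### Algebras that are inductive limits -/

/-- The homomorphisms from the levels of an inductive system to a C⋆-algebra `D` in which their
images are dense. -/
structure LimitMaps (A : ℕ → Type*) [∀ k, NonUnitalCStarAlgebra (A k)]
    (φ : ∀ k, A k →⋆ₙₐ[ℂ] A (k + 1)) (D : Type*) [NonUnitalCStarAlgebra D] where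
  hom : ∀ k, A k →⋆ₙₐ[ℂ] D
  hom_succ : ∀ k x, hom (k + 1) (φ k x) = hom k x
  dense : Dense {c | ∃ k x, hom k x = c}

section LimitMaps

variable {A : ℕ → Type*} [∀ k, NonUnitalCStarAlgebra (A k)] {φ : ∀ k, A k →⋆ₙₐ[ℂ] A (k + 1)}
  {D : Type*} [NonUnitalCStarAlgebra D]

/-- The level homomorphisms of an algebra isomorphic to an inductive limit. -/
def LimitMaps.ofEquiv (Λ : D ≃⋆ₐ[ℂ] seqLimit A φ) : LimitMaps A φ D where
  hom k := (Λ.symm : seqLimit A φ →⋆ₙₐ[ℂ] D).comp (toLimit A φ k)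
  hom_succ k x := congrArg Λ.symm (toLimit_succ A φ k x)
  dense := by
    have h : Dense (Λ.symm '' {c | ∃ k x, toLimit A φ k x = c}) :=
      (EquivLike.surjective Λ.symm).denseRange.dense_image
        (continuous_hom (Λ.symm : seqLimit A φ →⋆ₙₐ[ℂ] D)) (dense_toLimit A φ)
    refine h.mono ?_
    rintro _ ⟨c, ⟨k, x, rfl⟩, rfl⟩
    exact ⟨k, x, rfl⟩

theorem LimitMaps.hom_transHom (μ : LimitMaps A φ D) {k l : ℕ} (h : k ≤ l) (x : A k) :
    μ.hom l (transHom A φ k l x) = μ.hom k x := by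
  induction l, h using Nat.le_induction with
  | base => rw [transHom_self]
  | succ l h ih => rw [transHom_succ A φ h, μ.hom_succ, ih]

/-- Finitely many elements coming from finite levels come from a common level. -/
theorem LimitMaps.exists_common (μ : LimitMaps A φ D) (F : Finset D)
    (hF : (F : Set D) ⊆ {c | ∃ k x, μ.hom k x = c}) : ∃ k, ∀ c ∈ F, ∃ x, μ.hom k x = c := by
  classical
  choose! k x hx using fun c (hc : c ∈ F) => hF hc
  refine ⟨F.sup k, fun c hc => ⟨transHom A φ (k c) _ (x c), ?_⟩⟩
  rw [μ.hom_transHom (Finset.le_sup hc), hx c hc]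

end LimitMaps

/-! ### Matrix units in UHF-absorbing algebras -/

section UHF

variable (A : Type*) [NonUnitalCStarAlgebra A] (n : ℕ)

/-- The front insertion `x ↦ E i j ⊗ x` from `M_{n^k}(A)` to `M_{n^(k+1)}(A)`. -/
def frontUnits (k : ℕ) : MatrixUnits (Fin n) (MatrixAlg (Fin k → Fin n) A)
    (MatrixAlg (Fin (k + 1) → Fin n) A) where
  unit i j :=
    { toFun := fun x => .of fun I J =>
        if I 0 = i ∧ J 0 = j then x.entry (Fin.tail I) (Fin.tail J) else 0
      map_add' := fun a b => MatrixAlg.ext fun I J => by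
        simp only [MatrixAlg.entry_of, MatrixAlg.entry_add]; split_ifs <;> simp
      map_smul' := fun c a => MatrixAlg.ext fun I J => by simp }
  mul_same i j l a b := MatrixAlg.ext fun I J => by
    simp only [LinearMap.coe_mk, AddHom.coe_mk, MatrixAlg.entry_mul, MatrixAlg.entry_of]
    rw [← (Fin.consEquiv fun _ => Fin n).sum_comp, Fintype.sum_prod_type]
    have h0 : ∀ q : Fin n × (Fin k → Fin n), (Fin.consEquiv fun _ => Fin n) q 0 = q.1 :=
      fun q => Fin.cons_zero (α := fun _ => Fin n) q.1 q.2
    have h3 : ∀ q : Fin n × (Fin k → Fin n), Fin.tail ((Fin.consEquiv fun _ => Fin n) q) = q.2 :=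
      fun q => Fin.tail_cons (α := fun _ => Fin n) q.1 q.2
    simp only [h0, h3]
    rw [Finset.sum_eq_single j (fun m _ h => by simp [h]) (by simp)]
    by_cases h1 : I 0 = i <;> by_cases h2 : J 0 = l <;> simp [h1, h2]
  mul_ne i j k l a b h := MatrixAlg.ext fun I J => by
    simp only [LinearMap.coe_mk, AddHom.coe_mk, MatrixAlg.entry_mul, MatrixAlg.entry_of,
      MatrixAlg.entry_zero]
    refine Finset.sum_eq_zero fun m _ => ?_
    by_cases h1 : m 0 = j
    · simp [h1, h]
    · simp [h1]
  star_unit i j a := MatrixAlg.ext fun I J => by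
    simp only [LinearMap.coe_mk, AddHom.coe_mk, MatrixAlg.entry_star, MatrixAlg.entry_of]
    by_cases h1 : I 0 = j <;> by_cases h2 : J 0 = i <;> simp [h1, h2]

variable {A n}

theorem frontUnits_entry (k : ℕ) (i j : Fin n) (x : MatrixAlg (Fin k → Fin n) A)
    (I J : Fin (k + 1) → Fin n) : ((frontUnits A n k).unit i j x).entry I J =
      if I 0 = i ∧ J 0 = j then x.entry (Fin.tail I) (Fin.tail J) else 0 := rfl

theorem amplify_entry (k : ℕ) (x : MatrixAlg (Fin k → Fin n) A) (I J : Fin (k + 1) → Fin n) :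
    (amplify A n k x).entry I J = if I (Fin.last k) = J (Fin.last k) then
      x.entry (Fin.init I) (Fin.init J) else 0 := rfl

/-- Front insertion touches the first tensor factor and the connecting map the last one. Because
they commute, front insertion descends to matrix units on the limit with coefficients in the limit
itself. -/
theorem amplify_frontUnits (k : ℕ) (i j : Fin n) (x : MatrixAlg (Fin k → Fin n) A) :
    amplify A n (k + 1) ((frontUnits A n k).unit i j x) =
      (frontUnits A n (k + 1)).unit i j (amplify A n k x) := MatrixAlg.ext fun I J => by
  rw [amplify_entry, frontUnits_entry, frontUnits_entry, amplify_entry]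
  have h0 : ∀ I : Fin (k + 2) → Fin n, Fin.init I 0 = I 0 := fun I => rfl
  have h1 : ∀ I : Fin (k + 2) → Fin n, Fin.tail I (Fin.last k) = I (Fin.last (k + 1)) :=
    fun I => rfl
  have h2 : ∀ I : Fin (k + 2) → Fin n, Fin.init (Fin.tail I) = Fin.tail (Fin.init I) :=
    fun I => rfl
  rw [h0, h0, h1, h1, h2, h2]
  split_ifs <;> rfl

theorem amp_frontUnits_entry (k : ℕ) (x : MatrixAlg (Fin k → Fin n) A)
    (I J : Fin (k + 1) → Fin n) : ((frontUnits A n k).amp x).entry I J =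
      if I 0 = J 0 then x.entry (Fin.tail I) (Fin.tail J) else 0 := by
  rw [MatrixUnits.amp_apply, MatrixAlg.entry_sum, Finset.sum_eq_single (I 0), frontUnits_entry]
  · by_cases h : I 0 = J 0
    · simp [h]
    · simp [h, Ne.symm h]
  · intro k _ h; simp [frontUnits_entry, h.symm]
  · simp

theorem amplify_amp_stdUnits (k : ℕ) (e : A) :
    amplify A n k ((stdUnits (Fin k → Fin n) A).amp e) = (stdUnits (Fin (k + 1) → Fin n) A).amp e :=
  MatrixAlg.ext fun I J => by
    rw [amplify_entry, entry_amp_stdUnits, entry_amp_stdUnits]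
    have h : I = J ↔ I (Fin.last k) = J (Fin.last k) ∧ Fin.init I = Fin.init J := by
      constructor
      · rintro rfl; exact ⟨rfl, rfl⟩
      · rintro ⟨h1, h2⟩
        rw [← Fin.snoc_init_self I, ← Fin.snoc_init_self J, h1, h2]
    simp only [h]
    split_ifs <;> simp_all

theorem amp_frontUnits_amp_stdUnits (k : ℕ) (e : A) :
    (frontUnits A n k).amp ((stdUnits (Fin k → Fin n) A).amp e) =
      (stdUnits (Fin (k + 1) → Fin n) A).amp e :=
  MatrixAlg.ext fun I J => by
    rw [amp_frontUnits_entry, entry_amp_stdUnits, entry_amp_stdUnits]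
    have h : I = J ↔ I 0 = J 0 ∧ Fin.tail I = Fin.tail J := by
      constructor
      · rintro rfl; exact ⟨rfl, rfl⟩
      · rintro ⟨h1, h2⟩
        rw [← Fin.cons_self_tail I, ← Fin.cons_self_tail J, h1, h2]
    simp only [h]
    split_ifs <;> simp_all

/-- The rotation that moves the first coordinate to the last place. -/
def rotateCoord (n k : ℕ) : Equiv.Perm (Fin (k + 1) → Fin n) :=
  (Fin.consEquiv fun _ => Fin n).symm.trans (Fin.snocEquiv fun _ => Fin n)

theorem rotateCoord_apply (k : ℕ) (I : Fin (k + 1) → Fin n) :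
    rotateCoord n k I = Fin.snoc (α := fun _ => Fin n) (Fin.tail I) (I 0) := rfl

/-- x ⊗ 1 and 1 ⊗ x differ only by the order of tensor factors, that is, by a permutation of matrix
indices. This is the source of the equivalence between the amplification and the identity. -/
theorem amplify_rotateCoord (k : ℕ) (x : MatrixAlg (Fin k → Fin n) A) :
    (fun I J => (amplify A n k x).entry (rotateCoord n k I) (rotateCoord n k J)) =
      ((frontUnits A n k).amp x).entry := by
  funext I J
  rw [amplify_entry, amp_frontUnits_entry, rotateCoord_apply, rotateCoord_apply, Fin.snoc_last,
    Fin.snoc_last, Fin.init_snoc, Fin.init_snoc]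

theorem map_amp {ι B C D : Type*} [Fintype ι] [NonUnitalCStarAlgebra B] [NonUnitalCStarAlgebra C]
    [NonUnitalCStarAlgebra D] (R : MatrixUnits ι B C) (χ : C →⋆ₙₐ[ℂ] D) (b : B) :
    (R.map χ).amp b = χ (R.amp b) := by
  simp [MatrixUnits.amp_apply]

theorem map_matSum {ι B C D : Type*} [Fintype ι] [NonUnitalCStarAlgebra B]
    [NonUnitalCStarAlgebra C] [NonUnitalCStarAlgebra D] (R : MatrixUnits ι B C)
    (χ : C →⋆ₙₐ[ℂ] D) (x : ι → ι → B) : (R.map χ).matSum x = χ (R.matSum x) := by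
  simp [MatrixUnits.matSum]


/-! ### Level matrix units and the approximate innerness of x ↦ 1 ⊗ x. -/

section System

variable {D : Type*} [NonUnitalCStarAlgebra D]
  (μ : LimitMaps (fun k => MatrixAlg (Fin k → Fin n) A) (amplify A n) D)

/-- The matrix units of `M_{n^k}(A)` inside an algebra with a UHF system. -/
def levelUnits (k : ℕ) : MatrixUnits (Fin k → Fin n) A D :=
  (stdUnits (Fin k → Fin n) A).map (μ.hom k)

/-- The connecting maps send 1 ⊗ e to 1 ⊗ e. Thus one copy of A in D serves all levels, and its
nondegeneracy can be tested on each level separately. -/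
theorem levelUnits_amp_eq (k : ℕ) (e : A) :
    (levelUnits μ k).amp e = (levelUnits μ 0).amp e := by
  induction k with
  | zero => rfl
  | succ k ih =>
    rw [← ih, levelUnits, levelUnits, map_amp, map_amp, ← amplify_amp_stdUnits]
    exact μ.hom_succ k _

theorem nondegenerate_levelUnits (k : ℕ) : Nondegenerate (levelUnits μ k).amp := by
  refine nondegenerate_of_approx μ.dense ?_
  rintro _ ⟨l, y, rfl⟩ ε hε
  obtain ⟨e, he⟩ := (Metric.tendsto_nhds.1 (nondegenerate_amp_stdUnits y) ε hε).exists
  refine ⟨e, ?_⟩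
  rw [levelUnits_amp_eq, ← levelUnits_amp_eq μ l, levelUnits, map_amp, ← map_mul]
  rw [dist_eq_norm] at he
  exact (norm_hom_sub_le (μ.hom l) _ _).trans_lt he

variable (R : MatrixUnits (Fin n) D D)

theorem amp_hom_of_front (hR : ∀ i j k x,
    R.unit i j (μ.hom k x) = μ.hom (k + 1) ((frontUnits A n k).unit i j x))
    (k : ℕ) (x : MatrixAlg (Fin k → Fin n) A) :
    R.amp (μ.hom k x) = μ.hom (k + 1) ((frontUnits A n k).amp x) := by
  rw [MatrixUnits.amp_apply, MatrixUnits.amp_apply, map_sum]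
  exact Finset.sum_congr rfl fun i _ => hR i i k x

theorem nondegenerate_amp_of_front (hR : ∀ i j k x,
    R.unit i j (μ.hom k x) = μ.hom (k + 1) ((frontUnits A n k).unit i j x)) :
    Nondegenerate R.amp := by
  refine nondegenerate_of_approx dense_univ fun c _ ε hε => ?_
  obtain ⟨e, he⟩ := (Metric.tendsto_nhds.1 (nondegenerate_levelUnits μ 1 c) ε hε).exists
  refine ⟨(levelUnits μ 0).amp e, ?_⟩
  rw [dist_eq_norm] at he
  rw [levelUnits, map_amp, amp_hom_of_front μ R hR, amp_frontUnits_amp_stdUnits]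
  rwa [levelUnits, map_amp] at he

/-- Seen at level k + 1, the element itself is x ⊗ 1 and its amplification is 1 ⊗ x; conjugation by
the rotation of coordinates, which is approximately inner, carries one to the other. -/
theorem exists_adAut_hom (hR : ∀ i j k x,
    R.unit i j (μ.hom k x) = μ.hom (k + 1) ((frontUnits A n k).unit i j x))
    (hP : HasApproxPolar D) (k : ℕ)
    {J : Type*} (S : Finset J) (x : J → MatrixAlg (Fin k → Fin n) A) (ε : ℝ) (hε : 0 < ε) :
    ∃ u : unitary (Unitization ℂ D), ∀ s ∈ S,
      ‖adAut u (μ.hom k (x s)) - R.amp (μ.hom k (x s))‖ < ε := by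
  obtain ⟨u, hu⟩ := (levelUnits μ (k + 1)).exists_adAut_perm hP (nondegenerate_levelUnits μ _)
    -- Conjugation by the matrix of π moves entries by π⁻¹, so the inverse rotation is the one
    -- required.
    (rotateCoord n k)⁻¹ S (fun s => (amplify A n k (x s)).entry) ε hε
  refine ⟨u, fun s hs => ?_⟩
  have h1 : (levelUnits μ (k + 1)).matSum (amplify A n k (x s)).entry = μ.hom k (x s) := by
    rw [levelUnits, map_matSum, matSum_stdUnits_entry]
    exact μ.hom_succ k _
  have h2 : (levelUnits μ (k + 1)).matSum ((frontUnits A n k).amp (x s)).entry =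
      R.amp (μ.hom k (x s)) := by
    rw [levelUnits, map_matSum, matSum_stdUnits_entry, amp_hom_of_front μ R hR]
  have h3 := hu s hs
  rw [inv_inv, amplify_rotateCoord] at h3
  rwa [h1, h2] at h3

theorem exists_adAut_amp (hR : ∀ i j k x,
    R.unit i j (μ.hom k x) = μ.hom (k + 1) ((frontUnits A n k).unit i j x))
    (hP : HasApproxPolar D) (F : Finset D) (ε : ℝ) (hε : 0 < ε) :
    ∃ u : unitary (Unitization ℂ D), ∀ c ∈ F, ‖adAut u c - R.amp c‖ < ε := by
  classical
  refine exists_adAut_of_dense (φ := .id ℂ _) (ψ := R.amp) μ.dense ?_ F ε hε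
  intro F hF ε hε
  obtain ⟨k, hk⟩ := μ.exists_common F hF
  choose! x hx using hk
  obtain ⟨u, hu⟩ := exists_adAut_hom μ R hR hP k F x ε hε
  refine ⟨u, fun c hc => ?_⟩
  have h := hu c hc
  rwa [hx c hc] at h

end System

/-- A separable algebra absorbing `M_{n^∞}` contains a system of `n × n` matrix units with
coefficients in the algebra itself whose amplification is approximately inner. -/
theorem AbsorbsUHF.exists_matrixUnits [TopologicalSpace.SeparableSpace A] (h : AbsorbsUHF A n)
    (hP : HasApproxPolar A) : ∃ R : MatrixUnits (Fin n) A A, Nondegenerate R.amp ∧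
      ApproxUnitarilyEquiv R.amp (.id ℂ A) := by
  obtain ⟨Λ⟩ : Nonempty (A ≃⋆ₐ[ℂ] seqLimit (fun k => MatrixAlg (Fin k → Fin n) A)
    (amplify A n)) := h
  let R : MatrixUnits (Fin n) A A := (limitUnits (frontUnits A n) amplify_frontUnits).conj Λ
  have hR : ∀ i j k x, R.unit i j ((LimitMaps.ofEquiv Λ).hom k x) =
      (LimitMaps.ofEquiv Λ).hom (k + 1) ((frontUnits A n k).unit i j x) := fun i j k x =>
    (MatrixUnits.conj_unit _ Λ i j _).trans
      (congrArg Λ.symm (limitUnits_toLimit (frontUnits A n) amplify_frontUnits i j k x))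
  exact ⟨R, nondegenerate_amp_of_front _ R hR, ApproxUnitarilyEquiv.symm
    (approxUnitarilyEquiv_iff_adAut.2 fun F ε hε => exists_adAut_amp _ R hR hP F ε hε)⟩

end UHF

/-! ### Stable algebras -/

section Stable

variable {ι κ A C D : Type*} [NonUnitalCStarAlgebra A] [NonUnitalCStarAlgebra C]
  [NonUnitalCStarAlgebra D]

/-- Both elements have the same product x⋆x, namely E j j ⊗ a⋆a. -/
theorem MatrixUnits.norm_unit_eq (R : MatrixUnits ι A C) (i j : ι) (a : A) :
    ‖R.unit i j a‖ = ‖R.unit j j a‖ := by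
  have h : ‖R.unit i j a‖ * ‖R.unit i j a‖ = ‖R.unit j j a‖ * ‖R.unit j j a‖ := by
    rw [← CStarRing.norm_star_mul_self, ← CStarRing.norm_star_mul_self, R.star_unit, R.mul_same,
      R.star_unit, R.mul_same]
  exact (mul_self_inj_of_nonneg (norm_nonneg _) (norm_nonneg _)).1 h

/-- The system of matrix units with coefficients in a matrix algebra obtained by cutting matrices
into blocks. -/
def MatrixUnits.block [Fintype κ] (R : MatrixUnits (ι × κ) A C) :
    MatrixUnits ι (MatrixAlg κ A) C where
  unit i j :=
    { toFun := fun x => ∑ p, ∑ q, R.unit (i, p) (j, q) (x.entry p q)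
      map_add' := fun x y => by simp [Finset.sum_add_distrib]
      map_smul' := fun c x => by simp [Finset.smul_sum] }
  mul_same i j k x y := by
    classical
    change (∑ p, ∑ q, R.unit (i, p) (j, q) (x.entry p q)) *
      (∑ p, ∑ q, R.unit (j, p) (k, q) (y.entry p q)) =
      ∑ p, ∑ q, R.unit (i, p) (k, q) ((x * y).entry p q)
    simp only [Finset.sum_mul, MatrixAlg.entry_mul, map_sum]
    refine Finset.sum_congr rfl fun p _ => ?_
    conv_rhs => rw [Finset.sum_comm]
    refine Finset.sum_congr rfl fun l _ => ?_
    rw [Finset.mul_sum, Finset.sum_eq_single l, Finset.mul_sum]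
    · exact Finset.sum_congr rfl fun r _ => R.mul_same _ _ _ _ _
    · intro l' _ hl
      rw [Finset.mul_sum]
      exact Finset.sum_eq_zero fun r _ => R.mul_ne _ _ _ _ _ _ (by simpa using hl.symm)
    · simp
  mul_ne i j k l x y h := by
    change (∑ p, ∑ q, R.unit (i, p) (j, q) (x.entry p q)) *
      (∑ p, ∑ q, R.unit (k, p) (l, q) (y.entry p q)) = 0
    simp only [Finset.sum_mul, Finset.mul_sum]
    refine Finset.sum_eq_zero fun _ _ => Finset.sum_eq_zero fun _ _ => Finset.sum_eq_zero
      fun _ _ => Finset.sum_eq_zero fun _ _ => R.mul_ne _ _ _ _ _ _ ?_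
    simp [h]
  star_unit i j x := by
    change star (∑ p, ∑ q, R.unit (i, p) (j, q) (x.entry p q)) =
      ∑ p, ∑ q, R.unit (j, p) (i, q) ((star x).entry p q)
    simp only [star_sum, R.star_unit, MatrixAlg.entry_star]
    exact Finset.sum_comm

theorem MatrixUnits.block_unit [Fintype κ] (R : MatrixUnits (ι × κ) A C) (i j : ι)
    (x : MatrixAlg κ A) :
    R.block.unit i j x = ∑ p, ∑ q, R.unit (i, p) (j, q) (x.entry p q) := rfl

/-- Left multiplication by a corner element `w` of a `2 × 2` block decomposition is approximated by
a unitary. -/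
theorem MatrixUnits.exists_unitary_corner (c : MatrixUnits Bool C D) (w : C) (Y : Finset C)
    (ε : ℝ) (hε : 0 < ε) : ∃ u : unitary (Unitization ℂ D), ∀ y ∈ Y,
      ‖leftMul (u : Unitization ℂ D) (c.unit false false y) - c.unit false false (w * y)‖ ≤
        ‖c.unit false false (star w * w * y - y)‖ + ε := by
  -- For v in C, the matrix with rows (0, v) and (-v⋆, 0) is skew-adjoint and has a Cayley
  -- transform, which acts nearly as this matrix wherever its square is nearly -1.
  have hskew : ∀ v : C, star ((c.unit false true v - c.unit true false (star v) : D) :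
      Unitization ℂ D) = -((c.unit false true v - c.unit true false (star v) : D) :
      Unitization ℂ D) := fun v => by
    rw [← Unitization.inr_star, ← Unitization.inr_neg, star_sub, c.star_unit, c.star_unit,
      star_star, neg_sub]
  have h00 : ∀ v y, (c.unit false true v - c.unit true false (star v)) * c.unit false false y =
      -c.unit true false (star v * y) := fun v y => by
    rw [sub_mul, c.mul_ne _ _ _ _ _ _ (by decide), c.mul_same, zero_sub]
  have h10 : ∀ v y, (c.unit false true v - c.unit true false (star v)) * c.unit true false y =
      c.unit false false (v * y) := fun v y => by
    rw [sub_mul, c.mul_ne true false _ _ _ _ (by decide), c.mul_same, sub_zero]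
  have hpol : ∀ v : C, ∃ u : unitary (Unitization ℂ D), ∀ y : D,
      ‖leftMul (u : Unitization ℂ D) y - (c.unit false true v - c.unit true false (star v)) * y‖ ≤
        ‖y + (c.unit false true v - c.unit true false (star v)) *
          ((c.unit false true v - c.unit true false (star v)) * y)‖ := by
    intro v
    obtain ⟨u, hu⟩ := exists_unitary_of_star_eq_neg (hskew v)
    refine ⟨u, fun y => ?_⟩
    have h := hu (y : Unitization ℂ D)
    rwa [← Unitization.inr_mul, ← Unitization.inr_mul, ← Unitization.inr_add,
      Unitization.norm_inr, ← norm_leftMul_sub_eq] at h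
  have ev : ∀ᶠ e in approxUnit C, ∀ y ∈ Y, ‖e * y - y‖ < ε / 3 := by
    rw [eventually_all_finset]
    intro y _
    simpa [dist_eq_norm] using
      Metric.tendsto_nhds.1 (tendsto_approxUnit_mul y) (ε / 3) (by positivity)
  obtain ⟨e, he, he1, hes⟩ := (ev.and eventually_approxUnit).exists
  -- The matrix for -e carries a corner element y to e y in the lower left block, and the matrix for
  -- w carries y from there back to w y in the corner. The product of the two Cayley transforms
  -- therefore acts like w, and only the factor for w contributes a defect that is not small.
  obtain ⟨u₁, hu₁⟩ := hpol w
  obtain ⟨u₂, hu₂⟩ := hpol (-e)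
  refine ⟨u₁ * u₂, fun y hy => ?_⟩
  have a1 := hu₁ (c.unit true false y)
  have a2 := hu₂ (c.unit false false y)
  have a3 := he y hy
  rw [h10, h00, ← sub_eq_add_neg, ← map_sub, c.norm_unit_eq, ← mul_assoc,
    ← norm_neg (c.unit false false _), ← map_neg, neg_sub] at a1
  rw [h00, ← map_neg, h10, star_neg, hes, neg_mul, neg_neg, neg_mul, ← map_add,
    ← sub_eq_add_neg] at a2
  have a4 : ‖c.unit false false (y - e * (e * y))‖ ≤ ε / 3 + ε / 3 := by
    refine (c.norm_unit_le _ _ _).trans ?_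
    have key : y - e * (e * y) = -(e * (e * y - y)) - (e * y - y) := by
      rw [mul_sub]; abel
    rw [key]
    refine (norm_sub_le _ _).trans (add_le_add ?_ a3.le)
    rw [norm_neg]
    exact (norm_mul_le _ _).trans ((mul_le_of_le_one_left (norm_nonneg _) he1).trans a3.le)
  have a5 : ‖c.unit true false (e * y) - c.unit true false y‖ ≤ ε / 3 := by
    rw [← map_sub]
    exact (c.norm_unit_le _ _ _).trans a3.le
  have l1 : ∀ x y : D, leftMul (u₁ : Unitization ℂ D) x - leftMul (u₁ : Unitization ℂ D) y =
      leftMul (u₁ : Unitization ℂ D) (x - y) := fun x y =>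
    Unitization.inr_injective (R := ℂ) <| by
      simp only [Unitization.inr_sub, inr_leftMul, mul_sub]
  have l2 : leftMul ((u₁ * u₂ : unitary (Unitization ℂ D)) : Unitization ℂ D)
      (c.unit false false y) =
      leftMul (u₁ : Unitization ℂ D) (leftMul (u₂ : Unitization ℂ D) (c.unit false false y)) :=
    Unitization.inr_injective (R := ℂ) <| by
      simp only [inr_leftMul, Submonoid.coe_mul, mul_assoc]
  have b1 : ‖leftMul (u₁ : Unitization ℂ D) (leftMul (u₂ : Unitization ℂ D)
      (c.unit false false y)) - leftMul (u₁ : Unitization ℂ D) (c.unit true false (e * y))‖ ≤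
      ε / 3 + ε / 3 := by
    rw [l1, norm_leftMul_unitary]; exact a2.trans a4
  have b2 : ‖leftMul (u₁ : Unitization ℂ D) (c.unit true false (e * y)) -
      leftMul (u₁ : Unitization ℂ D) (c.unit true false y)‖ ≤ ε / 3 := by
    rw [l1, norm_leftMul_unitary]; exact a5
  rw [l2]
  have t1 := norm_sub_le_norm_sub_add_norm_sub (leftMul (u₁ : Unitization ℂ D)
    (leftMul (u₂ : Unitization ℂ D) (c.unit false false y)))
    (leftMul (u₁ : Unitization ℂ D) (c.unit true false (e * y))) (c.unit false false (w * y))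
  have t2 := norm_sub_le_norm_sub_add_norm_sub (leftMul (u₁ : Unitization ℂ D)
    (c.unit true false (e * y))) (leftMul (u₁ : Unitization ℂ D) (c.unit true false y))
    (c.unit false false (w * y))
  linarith

theorem entry_transHom_corner {k l : ℕ} (h : k ≤ l) (x : MatrixAlg (Fin k) A) (i j : Fin l) :
    (transHom (fun k => MatrixAlg (Fin k) A) (corner A) k l x).entry i j =
      if h : (i : ℕ) < k ∧ (j : ℕ) < k then x.entry ⟨i, h.1⟩ ⟨j, h.2⟩ else 0 := by
  induction l, h using Nat.le_induction with
  | base => rw [transHom_self]; simp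
  | succ l h ih =>
    rw [transHom_succ _ _ h]
    change (if h : (i : ℕ) < l ∧ (j : ℕ) < l then
      (transHom (fun k => MatrixAlg (Fin k) A) (corner A) k l x).entry ⟨i, h.1⟩ ⟨j, h.2⟩ else 0) = _
    by_cases h1 : (i : ℕ) < l ∧ (j : ℕ) < l
    · rw [dif_pos h1, ih]
    · rw [dif_neg h1, dif_neg fun h2 => h1 ⟨h2.1.trans_le h, h2.2.trans_le h⟩]

theorem matSum_castAdd (k m : ℕ) (x : MatrixAlg (Fin k) A) :
    ∑ p, ∑ q, (stdUnits (Fin (k + m)) A).unit (Fin.castAdd m p) (Fin.castAdd m q) (x.entry p q) =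
      transHom (fun k => MatrixAlg (Fin k) A) (corner A) k (k + m) x := by
  refine MatrixAlg.ext fun i j => ?_
  rw [entry_transHom_corner (Nat.le_add_right k m)]
  simp only [MatrixAlg.entry_sum, stdUnits_entry]
  by_cases hi : (i : ℕ) < k
  · by_cases hj : (j : ℕ) < k
    · rw [dif_pos ⟨hi, hj⟩, Finset.sum_eq_single ⟨i, hi⟩, Finset.sum_eq_single ⟨j, hj⟩]
      · rw [if_pos]; exact ⟨Fin.ext rfl, Fin.ext rfl⟩
      · intro q _ hq
        rw [if_neg]
        rintro ⟨-, h⟩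
        exact hq (Fin.ext (congrArg Fin.val h).symm)
      · simp
      · intro p _ hp
        refine Finset.sum_eq_zero fun q _ => if_neg ?_
        rintro ⟨h, -⟩
        exact hp (Fin.ext (congrArg Fin.val h).symm)
      · simp
    · rw [dif_neg fun h => hj h.2]
      refine Finset.sum_eq_zero fun p _ => Finset.sum_eq_zero fun q _ => if_neg ?_
      rintro ⟨-, h⟩
      exact hj ((congrArg Fin.val h).trans_lt q.2)
  · rw [dif_neg fun h => hi h.1]
    refine Finset.sum_eq_zero fun p _ => Finset.sum_eq_zero fun q _ => if_neg ?_
    rintro ⟨h, -⟩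
    exact hi ((congrArg Fin.val h).trans_lt p.2)

/-- M_{2k}(A) is M_2 over M_k(A), and the connecting maps place M_k(A) in its upper left block. -/
theorem exists_corner_units (μ : LimitMaps (fun k => MatrixAlg (Fin k) A) (corner A) D) (k : ℕ) :
    ∃ c : MatrixUnits Bool (MatrixAlg (Fin k) A) D, ∀ x, c.unit false false x = μ.hom k x := by
  let e : Bool × Fin k ≃ Fin (k + k) := (Equiv.boolProdEquivSum (Fin k)).trans finSumFinEquiv
  refine ⟨(((stdUnits (Fin (k + k)) A).map (μ.hom (k + k))).reindex e).block, fun x => ?_⟩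
  rw [← μ.hom_transHom (Nat.le_add_right k k), ← matSum_castAdd, MatrixUnits.block_unit]
  simp only [map_sum]
  rfl

/-- A stable algebra has room: every finite level is a corner of a 2 × 2 block decomposition, where
`MatrixUnits.exists_unitary_corner` applies to any w. Density moves w and the test elements to a
common level. As w is arbitrary, the test element is 0. -/
theorem hasApproxPolar_of_limitMaps
    (μ : LimitMaps (fun k => MatrixAlg (Fin k) A) (corner A) D) : HasApproxPolar D := by
  classical
  refine ⟨0, fun w _ _ F ε hε => ?_⟩
  have hU : IsOpen {v : D | ∀ a ∈ F,
      ‖v * a - w * a‖ + ‖star v * v * a - star w * w * a‖ < ε / 4} := by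
    have : {v : D | ∀ a ∈ F, ‖v * a - w * a‖ + ‖star v * v * a - star w * w * a‖ < ε / 4} =
      ⋂ a ∈ F, {v : D | ‖v * a - w * a‖ + ‖star v * v * a - star w * w * a‖ < ε / 4} := by
      ext; simp
    rw [this]
    exact isOpen_biInter_finset fun a _ => isOpen_lt (by fun_prop) continuous_const
  obtain ⟨v, hvT, hv⟩ := μ.dense.exists_mem_open hU ⟨w, by
    simp only [Set.mem_ofPred_eq, sub_self, norm_zero, add_zero]
    exact fun _ _ => by positivity⟩
  -- The approximants of the test elements are chosen after v, since their quality is measured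
  -- against v. The term ‖b - a‖ is counted twice: it enters once through the isometry u and once
  -- through the defect.
  have hV : ∀ a : D, ∃ b ∈ {c | ∃ k x, μ.hom k x = c},
      ‖b - a‖ + ‖b - a‖ + ‖v * b - v * a‖ + ‖star v * v * b - star v * v * a‖ < ε / 4 := fun a =>
    (μ.dense.exists_mem_open (U := {b : D | ‖b - a‖ + ‖b - a‖ + ‖v * b - v * a‖ +
      ‖star v * v * b - star v * v * a‖ < ε / 4}) (isOpen_lt (by fun_prop) continuous_const)
      ⟨a, by
        simp only [Set.mem_ofPred_eq, sub_self, norm_zero, add_zero]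
        positivity⟩)
  choose b hbT hb using hV
  obtain ⟨k, hk⟩ := μ.exists_common (insert v (F.image b)) (by
    intro c hc
    rcases Finset.mem_insert.1 (Finset.mem_coe.1 hc) with rfl | hc
    · exact hvT
    · obtain ⟨a, _, rfl⟩ := Finset.mem_image.1 hc
      exact hbT a)
  obtain ⟨x, rfl⟩ := hk v (Finset.mem_insert_self _ _)
  choose! y hy using fun a (ha : a ∈ F) =>
    hk (b a) (Finset.mem_insert_of_mem (Finset.mem_image_of_mem _ ha))
  obtain ⟨c, hc⟩ := exists_corner_units μ k
  obtain ⟨u, hu⟩ := c.exists_unitary_corner x (F.image y) (ε / 4) (by positivity)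
  refine ⟨u, fun a ha => ?_⟩
  have h1 := hu (y a) (Finset.mem_image_of_mem _ ha)
  rw [hc, hc, hc, map_sub, map_mul, map_mul, map_mul, map_star, hy a ha] at h1
  have h2 := hv a ha
  have h3 := hb a
  set v := μ.hom k x
  have h4 : ‖leftMul (u : Unitization ℂ D) a - leftMul (u : Unitization ℂ D) (b a)‖ =
      ‖b a - a‖ := by
    rw [norm_sub_rev, ← norm_leftMul_unitary u (b a - a)]
    congr 1
    exact Unitization.inr_injective (R := ℂ) <| by
      simp only [Unitization.inr_sub, inr_leftMul, mul_sub]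
  have t1 := norm_sub_le_norm_sub_add_norm_sub (leftMul (u : Unitization ℂ D) a)
    (leftMul (u : Unitization ℂ D) (b a)) (w * a)
  have t2 := norm_sub_le_norm_sub_add_norm_sub (leftMul (u : Unitization ℂ D) (b a))
    (v * b a) (w * a)
  have t3 := norm_sub_le_norm_sub_add_norm_sub (v * b a) (v * a) (w * a)
  have t4 := norm_sub_le_norm_sub_add_norm_sub (star v * v * b a) (star v * v * a) (b a)
  have t5 := norm_sub_le_norm_sub_add_norm_sub (star v * v * a) (star w * w * a) (b a)
  have t6 := norm_sub_le_norm_sub_add_norm_sub (star w * w * a) a (b a)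
  rw [norm_sub_rev a (b a)] at t6
  have h5 : 0 ≤ ‖v * b a - v * a‖ := norm_nonneg _
  linarith [norm_nonneg (v * a - w * a)]

theorem hasApproxPolar_of_stable (h : IsStableAlg A) : HasApproxPolar A := by
  obtain ⟨Λ⟩ : Nonempty (A ≃⋆ₐ[ℂ] seqLimit (fun k => MatrixAlg (Fin k) A) (corner A)) := h
  exact hasApproxPolar_of_limitMaps (LimitMaps.ofEquiv Λ)

end Stable

/-! ### Approximate relations between diagonal sums -/

/-- Evaluation at a coordinate. -/
def evalHom {ι : Type*} (A : Type*) [NonUnitalCStarAlgebra A] (i : ι) : (ι → A) →⋆ₙₐ[ℂ] A where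
  toFun b := b i
  map_smul' _ _ := rfl
  map_zero' := rfl
  map_add' _ _ := rfl
  map_mul' _ _ := rfl
  map_star' _ := rfl

@[simp] theorem evalHom_apply {ι A : Type*} [NonUnitalCStarAlgebra A] (i : ι) (b : ι → A) :
    evalHom A i b = b i := rfl

section Approx

variable {ι A B C : Type*} [NonUnitalCStarAlgebra A] [NonUnitalCStarAlgebra B]
  [NonUnitalCStarAlgebra C]

theorem approxUnitarilyEquiv_of_con [TopologicalSpace.SeparableSpace A] {θ η : A ≃⋆ₐ[ℂ] A}
    (h : (approxUnitaryCon A).mk' θ = (approxUnitaryCon A).mk' η) :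
    ApproxUnitarilyEquiv (θ : A →⋆ₙₐ[ℂ] A) (η : A →⋆ₙₐ[ℂ] A) :=
  (Con.eq _).1 h

theorem approxUnitarilyEquiv_adAut_comp (u : unitary (Unitization ℂ A)) (φ : B →⋆ₙₐ[ℂ] A) :
    ApproxUnitarilyEquiv φ ((adAut u : A →⋆ₙₐ[ℂ] A).comp φ) :=
  ⟨fun _ => u, fun b => by
    have h := inr_adAut u (φ b)
    change Tendsto _ _ (𝓝 ((adAut u (φ b) : A) : Unitization ℂ A))
    rw [h]
    exact tendsto_const_nhds⟩

theorem ApproxUnitarilyEquiv.norm_eq [TopologicalSpace.SeparableSpace B] {φ ψ : B →⋆ₙₐ[ℂ] A}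
    (h : ApproxUnitarilyEquiv φ ψ) (b : B) : ‖φ b‖ = ‖ψ b‖ := by
  obtain ⟨u, hu⟩ := h
  have h1 := (hu b).norm
  simp only [norm_conj_unitary, Unitization.norm_inr] at h1
  exact tendsto_nhds_unique tendsto_const_nhds h1

variable [Fintype ι]

theorem MatrixUnits.diag_comp_congr [TopologicalSpace.SeparableSpace B] (R : MatrixUnits ι A C)
    {f g : ι → B →⋆ₙₐ[ℂ] A}
    (h : ∀ i, ApproxUnitarilyEquiv (f i) (g i)) :
    ApproxUnitarilyEquiv (R.diag.comp (piHom f)) (R.diag.comp (piHom g)) :=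
  (approxUnitarilyEquiv_pi f g (fun _ _ => rfl) (fun _ _ => rfl) h).comp_left R.diag

theorem MatrixUnits.matSum_diagonal [DecidableEq ι] (R : MatrixUnits ι A C) (b : ι → A) :
    R.matSum (fun i j => if i = j then b i else 0) = R.diag b := by
  rw [MatrixUnits.matSum, MatrixUnits.diag_apply]
  refine Finset.sum_congr rfl fun i _ => ?_
  rw [Finset.sum_eq_single i (fun j _ h => by rw [if_neg h.symm, map_zero]) (by simp), if_pos rfl]

/-- Permuting the summands of a diagonal sum is approximately inner. -/
theorem MatrixUnits.diag_comp_perm [TopologicalSpace.SeparableSpace A] (R : MatrixUnits ι A C)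
    (hC : HasApproxPolar C)
    (hR : Nondegenerate R.amp) (π : Equiv.Perm ι) :
    ApproxUnitarilyEquiv (R.diag.comp (piHom fun i => evalHom A (π i))) R.diag := by
  classical
  refine approxUnitarilyEquiv_iff_adAut.2 fun F ε hε => ?_
  obtain ⟨u, hu⟩ := R.exists_adAut_perm hC hR π F
    (fun b i j => if i = j then b (π i) else 0) ε hε
  refine ⟨u, fun b hb => ?_⟩
  have h := hu b hb
  have h1 : (fun i j => if π⁻¹ i = π⁻¹ j then b (π (π⁻¹ i)) else 0) =
      fun i j => if i = j then b i else 0 := by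
    funext i j
    simp only [EmbeddingLike.apply_eq_iff_eq]
    rw [show π (π⁻¹ i) = i from π.apply_symm_apply i]
  rw [h1, R.matSum_diagonal b] at h
  rwa [R.matSum_diagonal fun i => b (π i)] at h

/-- A diagonal sum approximately intertwines an automorphism with its coordinatewise
application. -/
theorem MatrixUnits.aut_comp_diag [TopologicalSpace.SeparableSpace A] (R : MatrixUnits ι A A)
    (hA : HasApproxPolar A)
    (hR : Nondegenerate R.amp) (hid : ApproxUnitarilyEquiv R.amp (.id ℂ A)) (θ : A ≃⋆ₐ[ℂ] A) :
    ApproxUnitarilyEquiv ((θ : A →⋆ₙₐ[ℂ] A).comp R.diag)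
      (R.diag.comp (piHom fun i => (θ : A →⋆ₙₐ[ℂ] A).comp (evalHom A i))) := by
  classical
  -- In the double sum over (i, j) of R inside θ(R), exchanging i and j is approximately inner.
  -- Feeding in functions of one index alone compares 1 ⊗ θ(diag b) with diag(θ(1 ⊗ b_i)), and both
  -- amplifications can be removed because `R.amp` is equivalent to the identity.
  let T : MatrixUnits (ι × ι) A A := R.prod (R.map (θ : A →⋆ₙₐ[ℂ] A))
  have hT : ∀ b : ι × ι → A, T.diag b =
      R.diag fun i => θ (R.diag fun j => b (i, j)) := fun b => by
    simp only [MatrixUnits.diag_apply, map_sum]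
    exact Fintype.sum_prod_type _
  have hTamp : T.amp = R.amp.comp ((θ : A →⋆ₙₐ[ℂ] A).comp R.amp) := by
    ext a
    exact hT fun _ => a
  have hTn : Nondegenerate T.amp := by
    rw [hTamp]
    exact hR.comp ((nondegenerate_equiv θ).comp hR)
  have h1 := (T.diag_comp_perm hA hTn (Equiv.prodComm ι ι)).comp_right
    (piHom fun p : ι × ι => evalHom A p.1)
  have e1 : (T.diag.comp (piHom fun i => evalHom A (Equiv.prodComm ι ι i))).comp
      (piHom fun p : ι × ι => evalHom A p.1) = R.amp.comp ((θ : A →⋆ₙₐ[ℂ] A).comp R.diag) := by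
    ext b
    exact hT fun p => b p.2
  have e2 : T.diag.comp (piHom fun p : ι × ι => evalHom A p.1) =
      R.diag.comp (piHom fun i => ((θ : A →⋆ₙₐ[ℂ] A).comp R.amp).comp (evalHom A i)) := by
    ext b
    exact hT fun p => b p.1
  rw [e1, e2] at h1
  have h2 : ApproxUnitarilyEquiv (R.amp.comp ((θ : A →⋆ₙₐ[ℂ] A).comp R.diag))
      ((θ : A →⋆ₙₐ[ℂ] A).comp R.diag) := hid.comp_right ((θ : A →⋆ₙₐ[ℂ] A).comp R.diag)
  refine (h2.symm.trans h1).trans (R.diag_comp_congr fun i => ?_)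
  exact (hid.comp_left (θ : A →⋆ₙₐ[ℂ] A)).comp_right (evalHom A i)

end Approx

/-! ### The model system -/

section Model

variable {G A : Type*} [Fintype G] [NonUnitalCStarAlgebra A] (R : MatrixUnits G A A)
  (α : G → A ≃⋆ₐ[ℂ] A)

/-- The homomorphism `a ↦ (h ↦ αₕ⁻¹ a)`. -/
def orbitHom : A →⋆ₙₐ[ℂ] (G → A) := piHom fun h => (((α h)⁻¹ : A ≃⋆ₐ[ℂ] A) : A →⋆ₙₐ[ℂ] A)

/-- The homomorphism `b ↦ ∑ E k k ⊗ αₖ bₖ`. -/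
def sumHom : (G → A) →⋆ₙₐ[ℂ] A :=
  R.diag.comp (piHom fun k => (α k : A →⋆ₙₐ[ℂ] A).comp (evalHom A k))

-- The automorphisms cancel exactly in each summand, so the composite is the amplification itself.
variable {R α} in
theorem sumHom_comp_orbitHom (hid : ApproxUnitarilyEquiv R.amp (.id ℂ A)) :
    ApproxUnitarilyEquiv ((sumHom R α).comp (orbitHom α)) (.id ℂ A) := by
  have h : (sumHom R α).comp (orbitHom α) = R.amp := by
    ext a
    change R.diag (fun k => α k ((α k)⁻¹ a)) = R.diag fun _ => a
    simp only [aut_apply_inv_apply]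
  rwa [h]

variable [Group G]

/-- The shift of `G` on functions on `G`. -/
def shiftHom (A : Type*) [NonUnitalCStarAlgebra A] (g : G) : (G → A) →⋆ₙₐ[ℂ] (G → A) :=
  piHom fun h => evalHom A (g⁻¹ * h)

theorem shiftHom_apply (g : G) (b : G → A) (h : G) : shiftHom A g b h = b (g⁻¹ * h) := rfl

/-- The shift-equivariant endomorphism `b ↦ (h ↦ ∑ E k k ⊗ αₖ (b (h k)))`. -/
def modelHom : (G → A) →⋆ₙₐ[ℂ] (G → A) :=
  piHom fun h => R.diag.comp (piHom fun k => (α k : A →⋆ₙₐ[ℂ] A).comp (evalHom A (h * k)))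

theorem modelHom_shiftHom (g : G) (b : G → A) :
    modelHom R α (shiftHom A g b) = shiftHom A g (modelHom R α b) := by
  funext h
  simp only [modelHom, shiftHom, piHom_apply, NonUnitalStarAlgHom.comp_apply, evalHom_apply,
    mul_assoc]
  rfl

variable {R α}

variable [TopologicalSpace.SeparableSpace A] {ψ : G →* AutModApprox A}

/-- In coordinate h, pull α_h⁻¹ inside the diagonal sum, replace α_h⁻¹α_k by α_{h⁻¹k} (allowed since
ψ is a homomorphism), and reindex k by h k at the cost of a permutation. The resulting formula
involves h only through b(h k), which makes it shift-equivariant. -/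
theorem orbitHom_comp_sumHom (hα : ∀ g, (approxUnitaryCon A).mk' (α g) = ψ g)
    (hA : HasApproxPolar A) (hR : Nondegenerate R.amp)
    (hid : ApproxUnitarilyEquiv R.amp (.id ℂ A)) :
    ApproxUnitarilyEquiv ((orbitHom α).comp (sumHom R α)) (modelHom R α) := by
  refine approxUnitarilyEquiv_pi
    (fun h => (((α h)⁻¹ : A ≃⋆ₐ[ℂ] A) : A →⋆ₙₐ[ℂ] A).comp (sumHom R α))
    (fun h => R.diag.comp (piHom fun k => (α k : A →⋆ₙₐ[ℂ] A).comp (evalHom A (h * k))))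
    (fun _ _ => rfl) (fun _ _ => rfl) fun h => ?_
  have h1 := (R.aut_comp_diag hA hR hid (α h)⁻¹).comp_right
    (piHom fun k => (α k : A →⋆ₙₐ[ℂ] A).comp (evalHom A k))
  have h2 : ApproxUnitarilyEquiv
      (R.diag.comp (piHom fun k => (((α h)⁻¹ * α k : A ≃⋆ₐ[ℂ] A) : A →⋆ₙₐ[ℂ] A).comp (evalHom A k)))
      (R.diag.comp (piHom fun k => (α (h⁻¹ * k) : A →⋆ₙₐ[ℂ] A).comp (evalHom A k))) :=
    R.diag_comp_congr fun k => (approxUnitarilyEquiv_of_con (by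
      rw [map_mul, map_inv, hα, hα, hα, map_mul, map_inv])).comp_right (evalHom A k)
  have h3 := (R.diag_comp_perm hA hR (Equiv.mulLeft h)).comp_right
    (piHom fun k => (α (h⁻¹ * k) : A →⋆ₙₐ[ℂ] A).comp (evalHom A k))
  have e3 : (R.diag.comp (piHom fun k => evalHom A (Equiv.mulLeft h k))).comp
      (piHom fun k => (α (h⁻¹ * k) : A →⋆ₙₐ[ℂ] A).comp (evalHom A k)) =
      R.diag.comp (piHom fun k => (α k : A →⋆ₙₐ[ℂ] A).comp (evalHom A (h * k))) := by
    ext b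
    change R.diag (fun k => α (h⁻¹ * (h * k)) (b (h * k))) = R.diag fun k => α k (b (h * k))
    simp only [inv_mul_cancel_left]
  rw [e3] at h3
  exact (h1.trans h2).trans h3.symm

/-- Again α_g moves inside the sum, α_g α_k becomes α_{gk}, and a permutation of the summands turns
this into the shift. -/
theorem sumHom_comp_shiftHom (hα : ∀ g, (approxUnitaryCon A).mk' (α g) = ψ g)
    (hA : HasApproxPolar A) (hR : Nondegenerate R.amp)
    (hid : ApproxUnitarilyEquiv R.amp (.id ℂ A)) (g : G) :
    ApproxUnitarilyEquiv ((α g : A →⋆ₙₐ[ℂ] A).comp (sumHom R α))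
      ((sumHom R α).comp (shiftHom A g)) := by
  have h1 := (R.aut_comp_diag hA hR hid (α g)).comp_right
    (piHom fun k => (α k : A →⋆ₙₐ[ℂ] A).comp (evalHom A k))
  have h2 : ApproxUnitarilyEquiv
      (R.diag.comp (piHom fun k => ((α g * α k : A ≃⋆ₐ[ℂ] A) : A →⋆ₙₐ[ℂ] A).comp (evalHom A k)))
      (R.diag.comp (piHom fun k => (α (g * k) : A →⋆ₙₐ[ℂ] A).comp (evalHom A k))) :=
    R.diag_comp_congr fun k => (approxUnitarilyEquiv_of_con (by
      rw [map_mul, hα, hα, hα, map_mul])).comp_right (evalHom A k)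
  have h3 := (R.diag_comp_perm hA hR (Equiv.mulLeft g⁻¹)).comp_right
    (piHom fun k => (α (g * k) : A →⋆ₙₐ[ℂ] A).comp (evalHom A k))
  have e3 : (R.diag.comp (piHom fun k => evalHom A (Equiv.mulLeft g⁻¹ k))).comp
      (piHom fun k => (α (g * k) : A →⋆ₙₐ[ℂ] A).comp (evalHom A k)) =
      (sumHom R α).comp (shiftHom A g) := by
    ext b
    change R.diag (fun k => α (g * (g⁻¹ * k)) (b (g⁻¹ * k))) = R.diag fun k => α k (b (g⁻¹ * k))
    simp only [mul_inv_cancel_left]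
  rw [e3] at h3
  exact (h1.trans h2).trans h3.symm

end Model

/-! ### Limits of actions along an approximate intertwining -/

section LimitAction

variable {G A B : Type*} [Group G] [NonUnitalCStarAlgebra A] [NonUnitalCStarAlgebra B]
  {j : ℕ → B →⋆ₙₐ[ℂ] A} {σ : G → B →⋆ₙₐ[ℂ] B}

/-- The distance from a to the range of j n tends to 0, so nearly optimal approximants converge. -/
theorem exists_tendsto_hom (h : ∀ (a : A) (ε : ℝ), 0 < ε → ∃ y : ℕ → B,
    ∀ᶠ n in atTop, ‖j n (y n) - a‖ < ε) (a : A) :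
    ∃ z : ℕ → B, Tendsto (fun n => j n (z n)) atTop (𝓝 a) := by
  have hne : ∀ n, (Set.range (j n)).Nonempty := fun n => ⟨_, 0, rfl⟩
  have h1 : ∀ n : ℕ, ∃ z : B,
      ‖j n z - a‖ < Metric.infDist a (Set.range (j n)) + 1 / ((n : ℝ) + 1) := by
    intro n
    obtain ⟨_, ⟨z, rfl⟩, hz⟩ := (Metric.infDist_lt_iff (x := a) (hne n)
      (r := Metric.infDist a (Set.range (j n)) + 1 / ((n : ℝ) + 1))).1
      (lt_add_of_pos_right _ (by positivity))
    exact ⟨z, by rwa [dist_comm, dist_eq_norm] at hz⟩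
  choose z hz using h1
  refine ⟨z, Metric.tendsto_nhds.2 fun ε hε => ?_⟩
  obtain ⟨y, hy⟩ := h a (ε / 2) (half_pos hε)
  filter_upwards [hy, tendsto_one_div_add_atTop_nhds_zero_nat.eventually
    (gt_mem_nhds (half_pos hε))] with n h2 h3
  have h4 : Metric.infDist a (Set.range (j n)) ≤ ‖j n (y n) - a‖ := by
    rw [← dist_eq_norm, dist_comm]
    exact Metric.infDist_le_dist_of_mem ⟨_, rfl⟩
  rw [dist_eq_norm]
  linarith [hz n]

/-- The action does not change the seminorms ‖j n ·‖, so two sequences with close images stay close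
after applying σ g. Comparison with sequences whose translates are known to converge gives the
Cauchy property. -/
theorem exists_tendsto_hom_apply (hnorm : ∀ n g b, ‖j n (σ g b)‖ = ‖j n b‖) (h1 : ∀ b, σ 1 b = b)
    (hdense : ∀ (a : A) (ε : ℝ), 0 < ε → ∃ (y : ℕ → B) (c : G → A),
      (∀ g, Tendsto (fun n => j n (σ g (y n))) atTop (𝓝 (c g))) ∧ ‖c 1 - a‖ < ε)
    {a : A} {z : ℕ → B} (hz : Tendsto (fun n => j n (z n)) atTop (𝓝 a)) (g : G) :
    ∃ c, Tendsto (fun n => j n (σ g (z n))) atTop (𝓝 c) := by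
  refine cauchySeq_tendsto_of_complete (Metric.cauchySeq_iff'.2 fun ε hε => ?_)
  obtain ⟨y, c, hy, hc⟩ := hdense a (ε / 4) (by positivity)
  have hy1 := hy 1
  simp only [h1] at hy1
  have h2 : ∀ᶠ n in atTop, ‖j n (σ g (z n)) - c g‖ < ε / 2 := by
    rw [norm_sub_rev] at hc
    filter_upwards [(hz.sub hy1).norm.eventually (gt_mem_nhds hc),
      Metric.tendsto_nhds.1 (hy g) (ε / 4) (by positivity)] with n h3 h4
    rw [dist_eq_norm] at h4
    have h5 := hnorm n g (z n - y n)
    rw [map_sub, map_sub, map_sub] at h5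
    have h6 := norm_sub_le_norm_sub_add_norm_sub (j n (σ g (z n))) (j n (σ g (y n))) (c g)
    linarith
  obtain ⟨N, hN⟩ := eventually_atTop.1 h2
  refine ⟨N, fun n hn => ?_⟩
  have h3 := hN n hn
  have h4 := hN N le_rfl
  rw [dist_eq_norm]
  have h5 := norm_sub_le_norm_sub_add_norm_sub (j n (σ g (z n))) (c g) (j N (σ g (z N)))
  rw [norm_sub_rev (c g)] at h5
  linarith

/-- If the maps `j n : B → A` become dense and asymptotically isometric for the action `σ` on `B`,
then `σ` induces an action on `A` in the limit. -/
theorem exists_limit_action (hnorm : ∀ n g b, ‖j n (σ g b)‖ = ‖j n b‖) (h1 : ∀ b, σ 1 b = b)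
    (hmul : ∀ g h b, σ (g * h) b = σ g (σ h b))
    (hdense : ∀ (a : A) (ε : ℝ), 0 < ε → ∃ (y : ℕ → B) (c : G → A),
      (∀ g, Tendsto (fun n => j n (σ g (y n))) atTop (𝓝 (c g))) ∧ ‖c 1 - a‖ < ε) :
    ∃ γ : G →* (A ≃⋆ₐ[ℂ] A), ∀ (a : A) (z : ℕ → B), Tendsto (fun n => j n (z n)) atTop (𝓝 a) →
      ∀ g, Tendsto (fun n => j n (σ g (z n))) atTop (𝓝 (γ g a)) := by
  choose z hz using exists_tendsto_hom (j := j) fun a ε hε => by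
    obtain ⟨y, c, hy, hc⟩ := hdense a ε hε
    refine ⟨y, ?_⟩
    have := hy 1
    simp only [h1] at this
    exact (this.sub_const a).norm.eventually (gt_mem_nhds hc)
  choose f hf using fun (g : G) (a : A) => exists_tendsto_hom_apply hnorm h1 hdense (hz a) g
  -- The limit after applying σ g depends only on the limit before, again by invariance of the
  -- seminorms. Every algebraic identity can therefore be verified on any convenient representing
  -- sequence.
  have key : ∀ (a : A) (y : ℕ → B), Tendsto (fun n => j n (y n)) atTop (𝓝 a) →
      ∀ g, Tendsto (fun n => j n (σ g (y n))) atTop (𝓝 (f g a)) := by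
    intro a y hy g
    have h2 : Tendsto (fun n => j n (σ g (y n)) - j n (σ g (z a n))) atTop (𝓝 0) := by
      rw [tendsto_zero_iff_norm_tendsto_zero]
      have h3 := (hy.sub (hz a)).norm
      rw [sub_self, norm_zero] at h3
      refine h3.congr fun n => ?_
      rw [← map_sub, ← map_sub, ← map_sub, hnorm]
    simpa using h2.add (hf g a)
  have huniq : ∀ {a c : A} {y : ℕ → B} {g : G}, Tendsto (fun n => j n (y n)) atTop (𝓝 a) →
      Tendsto (fun n => j n (σ g (y n))) atTop (𝓝 c) → f g a = c := fun hy hc =>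
    tendsto_nhds_unique (key _ _ hy _) hc
  let F : G → A →⋆ₙₐ[ℂ] A := fun g =>
    { toFun := f g
      map_smul' := fun c a => huniq (y := fun n => c • z a n)
        (by simpa only [map_smul] using (hz a).const_smul c)
        (by simp only [map_smul]; exact (hf g a).const_smul c)
      map_zero' := huniq (y := fun _ => 0) (by simp) (by simp)
      map_add' := fun a b => huniq (y := fun n => z a n + z b n)
        (by simpa only [map_add] using (hz a).add (hz b))
        (by simpa only [map_add] using (hf g a).add (hf g b))
      map_mul' := fun a b => huniq (y := fun n => z a n * z b n)
        (by simpa only [map_mul] using (hz a).mul (hz b))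
        (by simpa only [map_mul] using (hf g a).mul (hf g b))
      map_star' := fun a => huniq (y := fun n => star (z a n))
        (by simpa only [map_star] using (hz a).star)
        (by simpa only [map_star] using (hf g a).star) }
  have hF1 : ∀ a, F 1 a = a := fun a => huniq (hz a) (by simpa only [h1] using hz a)
  have hFm : ∀ g h a, F (g * h) a = F g (F h a) := fun g h a =>
    huniq (hz a) (by simp only [hmul]; exact key _ _ (hf h a) g)
  refine ⟨{ toFun := fun g => StarAlgEquiv.ofNonUnitalStarAlgHom (F g) (F g⁻¹)
              (by ext a; simp [← hFm, hF1]) (by ext a; simp [← hFm, hF1])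
            map_one' := by ext a; exact hF1 a
            map_mul' := fun g h => by ext a; exact hFm g h a }, key⟩

/-- The limit action is pointwise approximately unitarily equivalent to any family of automorphisms
that is compatible with the maps `j n` up to approximate unitary equivalence. -/
theorem approxUnitarilyEquiv_limit_action [TopologicalSpace.SeparableSpace A]
    [TopologicalSpace.SeparableSpace B] {θ η : A ≃⋆ₐ[ℂ] A} {τ : B →⋆ₙₐ[ℂ] B}
    (hj : ∀ a : A, ∃ z : ℕ → B, Tendsto (fun n => j n (z n)) atTop (𝓝 a))
    (hη : ∀ (a : A) (z : ℕ → B), Tendsto (fun n => j n (z n)) atTop (𝓝 a) →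
      Tendsto (fun n => j n (τ (z n))) atTop (𝓝 (η a)))
    (hθ : ∀ n, ApproxUnitarilyEquiv ((θ : A →⋆ₙₐ[ℂ] A).comp (j n)) ((j n).comp τ)) :
    ApproxUnitarilyEquiv (θ : A →⋆ₙₐ[ℂ] A) (η : A →⋆ₙₐ[ℂ] A) := by
  classical
  refine approxUnitarilyEquiv_iff_adAut.2 fun F ε hε => ?_
  choose z hz using hj
  have ev : ∀ᶠ n in atTop, ∀ a ∈ F, ‖j n (z a n) - a‖ < ε / 3 ∧
      ‖j n (τ (z a n)) - η a‖ < ε / 3 := by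
    rw [eventually_all_finset]
    intro a _
    have h1 := Metric.tendsto_nhds.1 (hz a) (ε / 3) (by positivity)
    have h2 := Metric.tendsto_nhds.1 (hη a _ (hz a)) (ε / 3) (by positivity)
    simp only [dist_eq_norm] at h1 h2
    exact h1.and h2
  obtain ⟨n, hn⟩ := ev.exists
  obtain ⟨u, hu⟩ := approxUnitarilyEquiv_iff_adAut.1 (hθ n) (F.image fun a => z a n) (ε / 3)
    (by positivity)
  refine ⟨u, fun a ha => ?_⟩
  have h1 : ‖adAut u (θ (j n (z a n))) - j n (τ (z a n))‖ < ε / 3 :=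
    hu _ (Finset.mem_image_of_mem _ ha)
  obtain ⟨h2, h3⟩ := hn a ha
  rw [← norm_aut_sub θ, ← norm_aut_sub (adAut u), norm_sub_rev] at h2
  have h4 := norm_sub_le_norm_sub_add_norm_sub (adAut u (θ a)) (adAut u (θ (j n (z a n)))) (η a)
  have h5 := norm_sub_le_norm_sub_add_norm_sub (adAut u (θ (j n (z a n)))) (j n (τ (z a n))) (η a)
  change ‖adAut u (θ a) - η a‖ < ε
  linarith

end LimitAction

/-! ### A criterion for the Rokhlin property -/

section Criterion

variable {G A : Type*} [Group G] [Fintype G] [NonUnitalCStarAlgebra A]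

theorem seqMk_eq_zero {x : lp (fun _ : ℕ => A) ∞} :
    seqMk _ x = 0 ↔ Tendsto (fun n => x n) atTop (𝓝 0) := by
  have h : (fun n => ‖x n - (0 : lp (fun _ : ℕ => A) ∞) n‖) = fun n => ‖x n‖ :=
    funext fun n => congrArg norm (sub_zero (x n))
  rw [← map_zero (seqMk fun _ : ℕ => A), seqMk_eq_seqMk, h]
  exact tendsto_zero_iff_norm_tendsto_zero.symm

/-- The bounded sequence with given entries. -/
def bddSeq (f : ℕ → A) (hf : ∀ n, ‖f n‖ ≤ 1) : lp (fun _ : ℕ => A) ∞ :=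
  ⟨f, memℓp_infty ⟨1, by rintro _ ⟨k, rfl⟩; exact hf k⟩⟩

/-- Asymptotically central orthogonal positive contractions that sum up to a unit and are permuted
by an action give rise to a Rokhlin homomorphism. -/
theorem hasRokhlinProperty_of_sequences (γ : G →* (A ≃⋆ₐ[ℂ] A)) (f : G → ℕ → A)
    (hb : ∀ h n, ‖f h n‖ ≤ 1) (hs : ∀ h n, star (f h n) = f h n)
    (ho : ∀ h k n, h ≠ k → f h n * f k n = 0)
    (hc : ∀ h a, Tendsto (fun n => f h n * a - a * f h n) atTop (𝓝 0))
    (hu : ∀ a, Tendsto (fun n => (∑ h, f h n) * a) atTop (𝓝 a))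
    (hγ : ∀ g h, Tendsto (fun n => γ g (f h n) - f (g * h) n) atTop (𝓝 0)) :
    HasRokhlinProperty γ := by
  classical
  let p : G → SeqInfty A := fun h => seqMk _ (bddSeq (f h) (hb h))
  have hps : ∀ h, star (p h) = p h := fun h => by
    change star (seqMk _ _) = _
    rw [← map_star]
    congr 1
    ext n
    exact hs h n
  have hpo : ∀ h k, h ≠ k → p h * p k = 0 := fun h k hk => by
    change seqMk _ _ * seqMk _ _ = _
    rw [← map_mul, ← map_zero (seqMk fun _ : ℕ => A)]
    congr 1
    ext n
    exact ho h k n hk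
  have hpc : ∀ h a, p h * constSeq A a = constSeq A a * p h := fun h a => by
    rw [← sub_eq_zero]
    change seqMk _ _ * seqMk _ _ - seqMk _ _ * seqMk _ _ = 0
    rw [← map_mul, ← map_mul, ← map_sub, seqMk_eq_zero]
    exact hc h a
  have hpu : ∀ a, (∑ h, p h) * constSeq A a = constSeq A a := fun a => by
    rw [← sub_eq_zero]
    have h1 : ∑ h, p h = seqMk _ (∑ h, bddSeq (f h) (hb h)) := (map_sum _ _ _).symm
    rw [h1]
    change seqMk _ _ * seqMk _ _ - seqMk _ _ = 0
    rw [← map_mul, ← map_sub, seqMk_eq_zero]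
    have h2 := (hu a).sub_const a
    rw [sub_self] at h2
    refine h2.congr fun n => ?_
    change (∑ h, f h n) * a - a = (∑ h, bddSeq (f h) (hb h) : lp (fun _ : ℕ => A) ∞) n * a - a
    rw [lp.coeFn_sum, Finset.sum_apply]
    rfl
  have hpu' : ∀ a, constSeq A a * (∑ h, p h) = constSeq A a := fun a => by
    have h1 := congrArg star (hpu (star a))
    rw [star_mul, map_star, star_star, star_sum] at h1
    simpa only [hps] using h1
  have hpγ : ∀ g h, seqInftyMap (γ g) (p h) = p (g * h) := fun g h => by
    rw [← sub_eq_zero]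
    change seqMk _ (lpMap (γ g) _) - seqMk _ _ = 0
    rw [← map_sub, seqMk_eq_zero]
    exact hγ g h
  -- The p h need not be projections in A_∞. They are idempotent modulo the annihilator, because
  -- their sum acts as a unit on A and they are orthogonal.
  have hpp : ∀ h a, (p h * p h - p h) * constSeq A a = 0 := fun h a => by
    have h1 : p h * (∑ k, p k) = p h * p h := by
      rw [Finset.mul_sum, Finset.sum_eq_single h (fun k _ hk => hpo h k hk.symm) (by simp)]
    rw [← h1, sub_mul, mul_assoc, hpu, sub_self]
  have hmem : ∀ h, p h ∈ relCommutant A := fun h => by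
    rw [NonUnitalStarSubalgebra.mem_centralizer_iff]
    rintro _ ⟨b, rfl⟩
    rw [← map_star]
    exact ⟨(hpc h b).symm, (hpc h _).symm⟩
  let q : G → relCommutant A := fun h => ⟨p h, hmem h⟩
  have hqo : ∀ h k, h ≠ k → q h * q k = 0 := fun h k hk => Subtype.ext (hpo h k hk)
  have hqq : ∀ h, (annIdeal A).cls (q h) * (annIdeal A).cls (q h) = (annIdeal A).cls (q h) := by
    intro h
    rw [← StarIdeal.cls_mul, StarIdeal.cls_eq_cls, mem_annIdeal]
    intro b
    have h1 := hpp h b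
    refine ⟨h1, ?_⟩
    have h2 := congrArg star (hpp h (star b))
    rw [star_mul, star_zero, map_star, star_star, star_sub, star_mul, hps] at h2
    exact h2
  let Q : G → CentralSeq A := fun h => (annIdeal A).cls (q h)
  have hQo : ∀ h k, h ≠ k → Q h * Q k = 0 := fun h k hk =>
    congrArg (annIdeal A).cls (hqo h k hk)
  have hQs : ∀ h, star (Q h) = Q h := fun h =>
    congrArg (annIdeal A).cls (Subtype.ext (hps h) : star (q h) = q h)
  refine ⟨{ toFun := fun c => ∑ h, c h • Q h
            map_smul' := fun c x => by simp [Finset.smul_sum, mul_smul]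
            map_zero' := by simp
            map_add' := fun c d => by simp [add_smul, Finset.sum_add_distrib]
            map_mul' := fun c d => ?_
            map_star' := fun c => ?_ }, ?_, ?_⟩
  · rw [Finset.sum_mul]
    refine Finset.sum_congr rfl fun h _ => ?_
    rw [Finset.mul_sum, Finset.sum_eq_single h]
    · rw [smul_mul_smul_comm, hqq]; rfl
    · intro k _ hk
      rw [smul_mul_smul_comm, hQo _ _ hk.symm, smul_zero]
    · simp
  · rw [star_sum]
    refine Finset.sum_congr rfl fun h _ => ?_
    rw [star_smul, hQs]; rfl
  · intro x
    obtain ⟨x, rfl⟩ := (annIdeal A).cls_surjective x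
    have h1 : ∑ h, (1 : G → ℂ) h • Q h = (annIdeal A).cls (∑ h, q h) := by
      simp only [Pi.one_apply, one_smul]
      exact (map_sum (annIdeal A).mkHom q Finset.univ).symm
    have h2 : ((∑ h, q h : relCommutant A) : SeqInfty A) = ∑ h, p h :=
      map_sum (NonUnitalStarSubalgebraClass.subtype (relCommutant A)) q Finset.univ
    have h3 : ∀ b, constSeq A b * (x : SeqInfty A) = x * constSeq A b := fun b =>
      ((NonUnitalStarSubalgebra.mem_centralizer_iff ℂ).1 x.2 _ ⟨b, rfl⟩).1
    change (∑ h, (1 : G → ℂ) h • Q h) * _ = _ ∧ _ * (∑ h, (1 : G → ℂ) h • Q h) = _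
    rw [h1, ← StarIdeal.cls_mul, ← StarIdeal.cls_mul, StarIdeal.cls_eq_cls,
      StarIdeal.cls_eq_cls, mem_annIdeal, mem_annIdeal]
    constructor
    · intro b
      change ((∑ h, q h : relCommutant A) * (x : SeqInfty A) - x) * constSeq A b = 0 ∧
        constSeq A b * ((∑ h, q h : relCommutant A) * (x : SeqInfty A) - x) = 0
      rw [h2, sub_mul, mul_sub, mul_assoc, ← h3, ← mul_assoc, ← mul_assoc, hpu, hpu', sub_self]
      exact ⟨rfl, rfl⟩
    · intro b
      change ((x : SeqInfty A) * (∑ h, q h : relCommutant A) - x) * constSeq A b = 0 ∧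
        constSeq A b * ((x : SeqInfty A) * (∑ h, q h : relCommutant A) - x) = 0
      rw [h2, sub_mul, mul_sub, mul_assoc, hpu, ← mul_assoc, h3, mul_assoc, hpu', sub_self]
      exact ⟨rfl, rfl⟩
  · intro g c
    change ∑ h, c (g⁻¹ * h) • Q h = centralSeqMap (γ g) (∑ h, c h • Q h)
    rw [← Equiv.sum_comp (Equiv.mulLeft g), map_sum]
    refine Finset.sum_congr rfl fun h _ => ?_
    rw [map_smul]
    simp only [Equiv.coe_mulLeft, inv_mul_cancel_left]
    congr 1
    change _ = (annIdeal A).cls (relCommutantMap (γ g) (q h))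
    exact congrArg (annIdeal A).cls (Subtype.ext (hpγ g h).symm)

end Criterion

/-! ### Existence of Rokhlin actions -/

section Existence

variable {A B : Type*} [NonUnitalCStarAlgebra A] [NonUnitalCStarAlgebra B]

/-- Convergence to zero of a uniformly Lipschitz sequence of maps can be tested on a dense
sequence. -/
theorem tendsto_zero_of_denseRange {T : ℕ → A → A} {C : ℝ} (hC : 0 < C)
    (hT : ∀ n a b, ‖T n a - T n b‖ ≤ C * ‖a - b‖) {d : ℕ → A} (hd : DenseRange d)
    (h : ∀ i, Tendsto (fun n => T n (d i)) atTop (𝓝 0)) (a : A) :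
    Tendsto (fun n => T n a) atTop (𝓝 0) := by
  refine Metric.tendsto_nhds.2 fun ε hε => ?_
  obtain ⟨i, hi⟩ := Metric.denseRange_iff.1 hd a (ε / (2 * C)) (by positivity)
  rw [dist_eq_norm] at hi
  filter_upwards [Metric.tendsto_nhds.1 (h i) (ε / 2) (half_pos hε)] with n hn
  rw [dist_zero_right] at hn ⊢
  have h1 := hT n a (d i)
  have h2 : C * ‖a - d i‖ < ε / 2 := by
    calc C * ‖a - d i‖ < C * (ε / (2 * C)) := mul_lt_mul_of_pos_left hi hC
      _ = ε / 2 := by field_simp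
  have h3 := norm_le_norm_add_norm_sub (T n (d i)) (T n a)
  rw [norm_sub_rev] at h3
  linarith

/-- Along the thread y, φ y, φ² y, … consecutive images differ by a geometric sequence. The
truncated subtraction k - m is harmless, as only k ≥ m matters for the limit. -/
theorem exists_tendsto_iterate {j : ℕ → B →⋆ₙₐ[ℂ] A} {φ : B → B} {Y : ℕ → Finset B}
    (hj : ∀ n, ∀ y ∈ Y n, ‖j (n + 1) (φ y) - j n y‖ < (1 / 2) ^ n)
    (hY : ∀ n, ∀ y ∈ Y n, φ y ∈ Y (n + 1)) {m : ℕ} {y : B} (hy : y ∈ Y m) :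
    ∃ c, Tendsto (fun k => j k (φ^[k - m] y)) atTop (𝓝 c) ∧ ‖c - j m y‖ ≤ 2 * (1 / 2) ^ m := by
  have hmem : ∀ k, φ^[k] y ∈ Y (m + k) := by
    intro k
    induction k with
    | zero => exact hy
    | succ k ih => rw [Function.iterate_succ_apply']; exact hY _ _ ih
  have hd : ∀ k, dist (j (m + k) (φ^[k] y)) (j (m + (k + 1)) (φ^[k + 1] y)) ≤
      (1 / 2) ^ m * (1 / 2) ^ k := fun k => by
    rw [dist_comm, dist_eq_norm, Function.iterate_succ_apply', ← pow_add]
    exact (hj _ _ (hmem k)).le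
  obtain ⟨c, hc⟩ := cauchySeq_tendsto_of_complete
    (cauchySeq_of_le_geometric (1 / 2 : ℝ) _ (by norm_num) hd)
  refine ⟨c, ?_, ?_⟩
  · rw [← tendsto_add_atTop_iff_nat m]
    refine hc.congr fun k => ?_
    rw [Nat.add_sub_cancel, add_comm]
  · have h := dist_le_of_le_geometric_of_tendsto₀ (1 / 2 : ℝ) _ (by norm_num) hd hc
    rw [dist_comm, dist_eq_norm] at h
    refine h.trans (le_of_eq ?_)
    norm_num
    ring

variable {κ : B →⋆ₙₐ[ℂ] A} {ι : A →⋆ₙₐ[ℂ] B} {φ : B →⋆ₙₐ[ℂ] B}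
  [TopologicalSpace.SeparableSpace A] [TopologicalSpace.SeparableSpace B]

/-- The step of the approximate intertwining. -/
theorem exists_intertwining_step (h₁ : ApproxUnitarilyEquiv (κ.comp ι) (.id ℂ A))
    (h₂ : ApproxUnitarilyEquiv (ι.comp κ) φ) (W : unitary (Unitization ℂ A)) (F : Finset B)
    (X : Finset A) (ε : ℝ) (hε : 0 < ε) : ∃ W' : unitary (Unitization ℂ A),
      (∀ b ∈ F, ‖adAut W' (κ (φ b)) - adAut W (κ b)‖ < ε) ∧
      ∀ x ∈ X, ∃ z, ‖adAut W' (κ z) - x‖ < ε := by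
  classical
  -- t turns φ into ικ on F, and v undoes κι. With t' the image of t under κ, the unitary W v t'
  -- makes the new stage extend the old one along φ, and Ad(t)⁻¹ ι Ad(W)⁻¹ supplies preimages of the
  -- elements of X.
  obtain ⟨t, ht⟩ := approxUnitarilyEquiv_iff_adAut.1 h₂.symm F (ε / 2) (half_pos hε)
  obtain ⟨v, hv⟩ := approxUnitarilyEquiv_iff_adAut.1 h₁
    (F.image κ ∪ X.image ((adAut W)⁻¹ : A ≃⋆ₐ[ℂ] A))
    (ε / 2) (half_pos hε)
  obtain ⟨t', ht'⟩ := exists_hom_adAut κ t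
  refine ⟨W * v * t', fun b hb => ?_, fun x hx => ⟨(adAut t)⁻¹ (ι ((adAut W)⁻¹ x)), ?_⟩⟩
  · have h3 : ‖adAut t (φ b) - ι (κ b)‖ < ε / 2 := ht b hb
    have h4 : ‖adAut v (κ (ι (κ b))) - κ b‖ < ε / 2 :=
      hv _ (Finset.mem_union_left _ (Finset.mem_image_of_mem _ hb))
    have h5 := norm_hom_sub_le κ (adAut t (φ b)) (ι (κ b))
    rw [ht', ← norm_aut_sub (adAut v)] at h5
    rw [map_mul, map_mul, mul_assoc, StarAlgEquiv.mul_apply, norm_aut_sub, StarAlgEquiv.mul_apply]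
    have h6 := norm_sub_le_norm_sub_add_norm_sub (adAut v (adAut t' (κ (φ b))))
      (adAut v (κ (ι (κ b)))) (κ b)
    linarith
  · have h4 : ‖adAut v (κ (ι ((adAut W)⁻¹ x))) - (adAut W)⁻¹ x‖ < ε / 2 :=
      hv _ (Finset.mem_union_right _ (Finset.mem_image_of_mem _ hx))
    rw [map_mul, map_mul, StarAlgEquiv.mul_apply, StarAlgEquiv.mul_apply, ← ht',
      aut_apply_inv_apply]
    rw [← norm_aut_sub (adAut W), aut_apply_inv_apply] at h4
    linarith

end Existence

/-! ### Functions supported at one point of the group. -/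

section Single

variable {G A : Type*} [DecidableEq G] [NonUnitalCStarAlgebra A]

theorem norm_single_le [Fintype G] (h : G) (e : A) : ‖(Pi.single h e : G → A)‖ ≤ ‖e‖ :=
  (pi_norm_le_iff_of_nonneg (norm_nonneg _)).2 fun k => by
    by_cases hk : k = h
    · subst hk; simp
    · simp [hk]

theorem single_mul' (h : G) (e : A) (z : G → A) :
    (Pi.single h e : G → A) * z = Pi.single h (e * z h) := by
  funext k
  by_cases hk : k = h
  · subst hk; simp
  · simp [hk]

theorem mul_single' (h : G) (e : A) (z : G → A) :
    z * (Pi.single h e : G → A) = Pi.single h (z h * e) := by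
  funext k
  by_cases hk : k = h
  · subst hk; simp
  · simp [hk]

theorem shiftHom_single [Group G] [Fintype G] (g h : G) (e : A) :
    shiftHom A g (Pi.single h e) = Pi.single (g * h) e := by
  funext k
  rw [shiftHom_apply, Pi.single_apply, Pi.single_apply]
  simp only [inv_mul_eq_iff_eq_mul]

end Single

/-! ### The equivariant intertwining and the Rokhlin lift. -/

section Existence

variable {G A : Type*} [Group G] [Fintype G] [DecidableEq G] [NonUnitalCStarAlgebra A]
  [TopologicalSpace.SeparableSpace A]

/-- The conditions on consecutive stages of the approximate intertwining. -/
def IntertwiningStep (κ : (G → A) →⋆ₙₐ[ℂ] A) (φ : (G → A) →⋆ₙₐ[ℂ] (G → A)) (d : ℕ → A) (n : ℕ)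
    (s t : unitary (Unitization ℂ A) × Finset (G → A)) : Prop :=
  (∀ y ∈ s.2, ‖adAut t.1 (κ (φ y)) - adAut s.1 (κ y)‖ < (1 / 2) ^ n) ∧
  (∀ y ∈ s.2, φ y ∈ t.2) ∧ (∀ y ∈ t.2, ∀ g, shiftHom A g y ∈ t.2) ∧
  ∃ (z : ℕ → G → A) (e : A), ‖e‖ ≤ 1 ∧ star e = e ∧ (∀ h, Pi.single h e ∈ t.2) ∧
    ∀ i ≤ n, z i ∈ t.2 ∧ ‖adAut t.1 (κ (z i)) - d i‖ < (1 / 2) ^ n ∧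
      ∀ h, ‖e * z i h - z i h‖ < (1 / 2) ^ n ∧ ‖z i h * e - z i h‖ < (1 / 2) ^ n

/-- The order of choices matters: first the unitary, then preimages z of the dense sequence, then e
as an approximate unit for all values of z. The finite set is finally saturated under the shift. -/
theorem exists_intertwiningStep {κ : (G → A) →⋆ₙₐ[ℂ] A} {ι : A →⋆ₙₐ[ℂ] (G → A)}
    {φ : (G → A) →⋆ₙₐ[ℂ] (G → A)} (h₁ : ApproxUnitarilyEquiv (κ.comp ι) (.id ℂ A))
    (h₂ : ApproxUnitarilyEquiv (ι.comp κ) φ) (d : ℕ → A) (n : ℕ)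
    (s : unitary (Unitization ℂ A) × Finset (G → A)) : ∃ t, IntertwiningStep κ φ d n s t := by
  classical
  have hε : (0 : ℝ) < (1 / 2) ^ n := by positivity
  obtain ⟨W, hW, hWX⟩ := exists_intertwining_step h₁ h₂ s.1 s.2
    ((Finset.range (n + 1)).image d) _ hε
  have hz : ∀ i, ∃ z, i ≤ n → ‖adAut W (κ z) - d i‖ < (1 / 2) ^ n := fun i => by
    by_cases hi : i ≤ n
    · obtain ⟨z, hz⟩ := hWX (d i) (Finset.mem_image_of_mem _ (Finset.mem_range.2 (by omega)))
      exact ⟨z, fun _ => hz⟩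
    · exact ⟨0, fun h => absurd h hi⟩
  choose z hz using hz
  have ev : ∀ᶠ e in approxUnit A, ∀ i ∈ Finset.range (n + 1), ∀ h ∈ (Finset.univ : Finset G),
      ‖e * z i h - z i h‖ < (1 / 2) ^ n ∧ ‖z i h * e - z i h‖ < (1 / 2) ^ n := by
    simp only [eventually_all_finset]
    intro i _ h _
    have e1 := Metric.tendsto_nhds.1 (tendsto_approxUnit_mul (z i h)) _ hε
    have e2 := Metric.tendsto_nhds.1 (tendsto_mul_approxUnit (z i h)) _ hε
    simp only [dist_eq_norm] at e1 e2
    exact e1.and e2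
  obtain ⟨e, he, he1, hes⟩ := (ev.and eventually_approxUnit).exists
  let Y₀ : Finset (G → A) := s.2.image φ ∪ ((Finset.range (n + 1)).image z ∪
    Finset.univ.image fun h => Pi.single h e)
  let Y : Finset (G → A) := Finset.univ.biUnion fun g => Y₀.image (shiftHom A g)
  have hY₀ : ∀ y ∈ Y₀, y ∈ Y := fun y hy => Finset.mem_biUnion.2 ⟨1, Finset.mem_univ _,
    Finset.mem_image.2 ⟨y, hy, by funext h; rw [shiftHom_apply, inv_one, one_mul]⟩⟩
  refine ⟨(W, Y), hW, fun y hy => hY₀ _ (Finset.mem_union_left _ (Finset.mem_image_of_mem _ hy)),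
    fun y hy g => ?_, z, e, he1, hes, fun h => hY₀ _ (Finset.mem_union_right _
      (Finset.mem_union_right _ (Finset.mem_image_of_mem _ (Finset.mem_univ h)))), fun i hi =>
      ⟨hY₀ _ (Finset.mem_union_right _ (Finset.mem_union_left _ (Finset.mem_image_of_mem _
        (Finset.mem_range.2 (by omega))))), hz i hi, fun h =>
        he i (Finset.mem_range.2 (by omega)) h (Finset.mem_univ _)⟩⟩
  obtain ⟨k, _, hk⟩ := Finset.mem_biUnion.1 hy
  obtain ⟨y, hy', rfl⟩ := Finset.mem_image.1 hk
  refine Finset.mem_biUnion.2 ⟨g * k, Finset.mem_univ _, Finset.mem_image.2 ⟨y, hy', ?_⟩⟩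
  funext h
  simp only [shiftHom_apply, mul_inv_rev, mul_assoc]

/-- The stages j n identify A with a limit of G → A along the shift-equivariant φ, and γ is the
limit of the shift. The central projections of functions on G, cut down by an approximate unit of A,
yield the Rokhlin elements. -/
theorem exists_rokhlin_lift (R : MatrixUnits G A A) (hA : HasApproxPolar A)
    (hR : Nondegenerate R.amp) (hid : ApproxUnitarilyEquiv R.amp (.id ℂ A))
    (ψ : G →* AutModApprox A) : ∃ γ : G →* (A ≃⋆ₐ[ℂ] A), HasRokhlinProperty γ ∧
      ∀ g, (approxUnitaryCon A).mk' (γ g) = ψ g := by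
  classical
  -- The lifts are multiplicative only up to approximate unitary equivalence; an action appears only
  -- in the limit.
  choose α hα using fun g => Con.mk'_surjective (c := approxUnitaryCon A) (ψ g)
  have hκσ := sumHom_comp_shiftHom hα hA hR hid
  set κ := sumHom R α
  have hφσ := modelHom_shiftHom R α
  choose step hstep using exists_intertwiningStep (sumHom_comp_orbitHom (α := α) hid)
    (orbitHom_comp_sumHom hα hA hR hid) (TopologicalSpace.denseSeq A)
  set φ := modelHom R α
  set d := TopologicalSpace.denseSeq A
  let s : ℕ → unitary (Unitization ℂ A) × Finset (G → A) :=
    fun n => Nat.rec (1, ∅) (fun n x => step n x) n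
  have hs : ∀ n, IntertwiningStep κ φ d n (s n) (s (n + 1)) := fun n => hstep n (s n)
  choose hs1 hs2 hs3 z e he1 hes hsing hz using hs
  let j : ℕ → (G → A) →⋆ₙₐ[ℂ] A := fun n => (adAut (s n).1 : A →⋆ₙₐ[ℂ] A).comp κ
  have hjσ : ∀ n g, ApproxUnitarilyEquiv ((α g : A →⋆ₙₐ[ℂ] A).comp (j n))
      ((j n).comp (shiftHom A g)) := fun n g => by
    have e1 := (approxUnitarilyEquiv_adAut_comp (s n).1 κ).comp_left (α g : A →⋆ₙₐ[ℂ] A)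
    exact (e1.symm.trans (hκσ g)).trans
      (approxUnitarilyEquiv_adAut_comp (s n).1 (κ.comp (shiftHom A g)))
  -- Up to ≈ the shift corresponds under j n to the automorphism α g, and both ≈ and automorphisms
  -- preserve norms.
  have hnorm : ∀ n g b, ‖j n (shiftHom A g b)‖ = ‖j n b‖ := fun n g b => by
    rw [← norm_aut (α g) (j n b)]
    exact ((hjσ n g).norm_eq b).symm
  have hσ1 : ∀ b : G → A, shiftHom A 1 b = b := fun b => by
    funext h; rw [shiftHom_apply, inv_one, one_mul]
  have hσm : ∀ (g h : G) (b : G → A), shiftHom A (g * h) b = shiftHom A g (shiftHom A h b) :=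
    fun g h b => by funext k; simp only [shiftHom_apply, mul_inv_rev, mul_assoc]
  -- Since φ commutes with the shift and the finite sets are shift-invariant, all translates of a
  -- thread converge simultaneously.
  have hthread : ∀ n, ∀ y ∈ (s (n + 1)).2, ∃ c : G → A, ∀ g,
      Tendsto (fun k => j k (shiftHom A g (φ^[k - (n + 1)] y))) atTop (𝓝 (c g)) ∧
      ‖c g - j (n + 1) (shiftHom A g y)‖ ≤ (1 / 2) ^ n := by
    intro n y hy
    have h1 : ∀ g, ∃ c, Tendsto (fun k => j k (shiftHom A g (φ^[k - (n + 1)] y))) atTop (𝓝 c) ∧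
        ‖c - j (n + 1) (shiftHom A g y)‖ ≤ (1 / 2) ^ n := fun g => by
      obtain ⟨c, hc, hc'⟩ :=
        exists_tendsto_iterate (j := j) (φ := φ) (Y := fun n => (s n).2) (m := n + 1)
          hs1 hs2 (hs3 n y hy g)
      refine ⟨c, hc.congr fun k => ?_, hc'.trans (le_of_eq ?_)⟩
      · rw [((Function.Commute.iterate_left (hφσ g) (k - (n + 1))).eq y)]
      · rw [pow_succ]; ring
    choose c hc using h1
    exact ⟨c, hc⟩
  have hhalf : Tendsto (fun n : ℕ => (1 / 2 : ℝ) ^ n) atTop (𝓝 0) :=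
    tendsto_pow_atTop_nhds_zero_of_lt_one (by norm_num) (by norm_num)
  have hdense : DenseRange d := TopologicalSpace.denseRange_denseSeq A
  have hdense' : ∀ (a : A) (ε : ℝ), 0 < ε → ∃ (y : ℕ → G → A) (c : G → A),
      (∀ g, Tendsto (fun n => j n (shiftHom A g (y n))) atTop (𝓝 (c g))) ∧ ‖c 1 - a‖ < ε := by
    intro a ε hε
    obtain ⟨i, hi⟩ := Metric.denseRange_iff.1 hdense a (ε / 3) (by positivity)
    obtain ⟨n, hn, hn'⟩ := ((hhalf.eventually (gt_mem_nhds (show (0 : ℝ) < ε / 3 by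
      positivity))).and (eventually_ge_atTop i)).exists
    obtain ⟨hzY, hzd, -⟩ := hz n i hn'
    obtain ⟨c, hc⟩ := hthread n _ hzY
    refine ⟨_, c, fun g => (hc g).1, ?_⟩
    have h1 := (hc 1).2
    rw [hσ1] at h1
    rw [dist_comm, dist_eq_norm] at hi
    have h2 := norm_sub_le_norm_sub_add_norm_sub (c 1) (j (n + 1) (z n i)) (d i)
    have h3 := norm_sub_le_norm_sub_add_norm_sub (c 1) (d i) a
    have h4 : ‖j (n + 1) (z n i) - d i‖ < (1 / 2) ^ n := hzd
    linarith
  obtain ⟨γ, hγ⟩ := exists_limit_action hnorm hσ1 hσm hdense'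
  have hzn : ∀ a : A, ∃ z : ℕ → G → A, Tendsto (fun n => j n (z n)) atTop (𝓝 a) :=
    exists_tendsto_hom fun a ε hε => by
      obtain ⟨y, c, hy, hc⟩ := hdense' a ε hε
      have h1 := hy 1
      simp only [hσ1] at h1
      exact ⟨y, (h1.sub_const a).norm.eventually (gt_mem_nhds hc)⟩
  refine ⟨γ, ?_, fun g => ?_⟩
  swap
  · rw [← hα g]
    exact ((Con.eq _).2 (approxUnitarilyEquiv_limit_action hzn (fun a z hz => hγ a z hz g)
      fun n => hjσ n g)).symm
  let f : G → ℕ → A := fun h n => j (n + 1) (Pi.single h (e n))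
  have hfb : ∀ h n, ‖f h n‖ ≤ 1 := fun h n =>
    (NonUnitalStarAlgHom.norm_apply_le (j (n + 1)) _).trans ((norm_single_le h _).trans (he1 n))
  -- Multiplying by f h n from either side cuts z n i down to its value at h. Together with the
  -- mirror estimate `hr` this gives asymptotic centrality, and summing over h recovers z n i, which
  -- gives the unit condition.
  have hl : ∀ h i n, i ≤ n → ‖f h n * d i - j (n + 1) (Pi.single h (z n i h))‖ ≤
      2 * (1 / 2) ^ n := by
    intro h i n hi
    obtain ⟨-, hzd, hze⟩ := hz n i hi
    have e1 : f h n * j (n + 1) (z n i) - j (n + 1) (Pi.single h (z n i h)) =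
        j (n + 1) (Pi.single h (e n * z n i h - z n i h)) := by
      rw [← map_mul, single_mul', ← map_sub, ← Pi.single_sub]
    have e2 : ‖f h n * d i - f h n * j (n + 1) (z n i)‖ ≤ (1 / 2) ^ n := by
      rw [← mul_sub]
      refine (norm_mul_le _ _).trans ((mul_le_of_le_one_left (norm_nonneg _) (hfb h n)).trans ?_)
      rw [norm_sub_rev]
      exact hzd.le
    have e3 := (NonUnitalStarAlgHom.norm_apply_le (j (n + 1)) _).trans
      ((norm_single_le h (e n * z n i h - z n i h)).trans (hze h).1.le)
    rw [← e1] at e3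
    have e4 := norm_sub_le_norm_sub_add_norm_sub (f h n * d i) (f h n * j (n + 1) (z n i))
      (j (n + 1) (Pi.single h (z n i h)))
    linarith
  have hr : ∀ h i n, i ≤ n → ‖d i * f h n - j (n + 1) (Pi.single h (z n i h))‖ ≤
      2 * (1 / 2) ^ n := by
    intro h i n hi
    obtain ⟨-, hzd, hze⟩ := hz n i hi
    have e1 : j (n + 1) (z n i) * f h n - j (n + 1) (Pi.single h (z n i h)) =
        j (n + 1) (Pi.single h (z n i h * e n - z n i h)) := by
      rw [← map_mul, mul_single', ← map_sub, ← Pi.single_sub]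
    have e2 : ‖d i * f h n - j (n + 1) (z n i) * f h n‖ ≤ (1 / 2) ^ n := by
      rw [← sub_mul]
      refine (norm_mul_le _ _).trans ((mul_le_of_le_one_right (norm_nonneg _) (hfb h n)).trans ?_)
      rw [norm_sub_rev]
      exact hzd.le
    have e3 := (NonUnitalStarAlgHom.norm_apply_le (j (n + 1)) _).trans
      ((norm_single_le h (z n i h * e n - z n i h)).trans (hze h).2.le)
    rw [← e1] at e3
    have e4 := norm_sub_le_norm_sub_add_norm_sub (d i * f h n) (j (n + 1) (z n i) * f h n)
      (j (n + 1) (Pi.single h (z n i h)))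
    linarith
  have hsmall : ∀ {x : ℕ → A} (C : ℝ) (m : ℕ), (∀ n, m ≤ n → ‖x n‖ ≤ C * (1 / 2) ^ n) →
      Tendsto x atTop (𝓝 0) := fun C m h => by
    rw [tendsto_zero_iff_norm_tendsto_zero]
    refine squeeze_zero' (Eventually.of_forall fun _ => norm_nonneg _)
      ((eventually_ge_atTop m).mono h) ?_
    simpa using hhalf.const_mul C
  refine hasRokhlinProperty_of_sequences γ f hfb (fun h n => ?_) (fun h k n hk => ?_)
    (fun h a => ?_) (fun a => ?_) (fun g h => ?_)
  · rw [← map_star, ← Pi.single_star, hes]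
  · rw [← map_mul, single_mul', Pi.single_eq_of_ne hk, mul_zero, Pi.single_zero, map_zero]
  · refine tendsto_zero_of_denseRange (T := fun n a => f h n * a - a * f h n) (C := 2)
      two_pos (fun n a b => ?_) hdense (fun i => hsmall 4 i fun n hn => ?_) a
    · have e1 : f h n * a - a * f h n - (f h n * b - b * f h n) =
          f h n * (a - b) - (a - b) * f h n := by rw [mul_sub, sub_mul]; abel
      rw [e1, two_mul]
      exact (norm_sub_le _ _).trans (add_le_add
        ((norm_mul_le _ _).trans (mul_le_of_le_one_left (norm_nonneg _) (hfb h n)))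
        ((norm_mul_le _ _).trans (mul_le_of_le_one_right (norm_nonneg _) (hfb h n))))
    · have e1 := hl h i n hn
      have e2 := hr h i n hn
      rw [norm_sub_rev] at e2
      have e3 := norm_sub_le_norm_sub_add_norm_sub (f h n * d i)
        (j (n + 1) (Pi.single h (z n i h))) (d i * f h n)
      linarith
  · have key := tendsto_zero_of_denseRange (T := fun n a => (∑ h, f h n) * a - a)
      (C := Fintype.card G + 1) (by positivity) (fun n a b => ?_) hdense
      (fun i => hsmall (2 * Fintype.card G + 1) i fun n hn => ?_) a
    · simpa using key.add_const a
    · have e1 : (∑ h, f h n) * a - a - ((∑ h, f h n) * b - b) =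
          ∑ h, f h n * (a - b) - (a - b) := by rw [← Finset.sum_mul, mul_sub]; abel
      rw [e1, add_mul, one_mul]
      refine (norm_sub_le _ _).trans (add_le_add ?_ le_rfl)
      refine (norm_sum_le _ _).trans ?_
      refine (Finset.sum_le_sum (g := fun _ => ‖a - b‖) fun h _ => (norm_mul_le _ _).trans
        (mul_le_of_le_one_left (norm_nonneg _) (hfb h n))).trans ?_
      simp
    · have e1 : (∑ h, f h n) * d i - d i =
          ∑ h, (f h n * d i - j (n + 1) (Pi.single h (z n i h))) +
            (j (n + 1) (z n i) - d i) := by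
        rw [Finset.sum_mul, Finset.sum_sub_distrib, ← map_sum, Finset.univ_sum_single]; abel
      rw [e1, add_mul, one_mul]
      refine (norm_add_le _ _).trans (add_le_add ?_ (hz n i hn).2.1.le)
      refine (norm_sum_le _ _).trans ?_
      refine (Finset.sum_le_sum fun h _ => hl h i n hn).trans (le_of_eq ?_)
      simp
      ring
  -- The shift moves the function supported at h to g h, and γ g maps the limit of the thread of the
  -- first to that of the second. Each limit is within (1/2)^n of its starting stage.
  · refine hsmall 2 0 fun n _ => ?_
    obtain ⟨c, hc⟩ := hthread n _ (hsing n h)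
    have h1 := (hc 1)
    simp only [hσ1] at h1
    have h2 : γ g (c 1) = c g := tendsto_nhds_unique (hγ _ _ h1.1 g) (hc g).1
    have h3 := (hc g).2
    rw [shiftHom_single, ← h2] at h3
    have h4 := h1.2
    rw [norm_sub_rev, ← norm_aut_sub (γ g)] at h4
    have h5 := norm_sub_le_norm_sub_add_norm_sub (γ g (f h n)) (γ g (c 1)) (f (g * h) n)
    linarith

end Existence

/-! ### Homomorphisms from functions on the group into the sequence algebra -/

section RokhlinMap

variable {G A : Type*} [Group G] [NonUnitalCStarAlgebra A]

/-- An action `β` of `G` admits an equivariant homomorphism from `G → A` into the sequence algebra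
of `A` that extends the inclusion of `A`. -/
def HasRokhlinMap (β : G →* (A ≃⋆ₐ[ℂ] A)) : Prop :=
  ∃ S : (G → A) →⋆ₙₐ[ℂ] SeqInfty A, (∀ a, S (fun _ => a) = constSeq A a) ∧
    ∀ g y, seqInftyMap (β g) (S y) = S fun k => β g (y (g⁻¹ * k))

variable (A) in
theorem exists_seq_approxUnit [TopologicalSpace.SeparableSpace A] : ∃ e : ℕ → A,
    (∀ n, ‖e n‖ ≤ 1) ∧ (∀ a, Tendsto (fun n => e n * a) atTop (𝓝 a)) ∧
      ∀ a, Tendsto (fun n => a * e n) atTop (𝓝 a) := by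
  set d := TopologicalSpace.denseSeq A
  have h : ∀ n : ℕ, ∃ e : A, (‖e‖ ≤ 1 ∧ star e = e) ∧ ∀ i ∈ Finset.range (n + 1),
      ‖e * d i - d i‖ < 1 / ((n : ℝ) + 1) ∧ ‖d i * e - d i‖ < 1 / ((n : ℝ) + 1) := fun n => by
    refine (eventually_approxUnit.and ?_).exists
    rw [eventually_all_finset]
    intro i _
    have hε : (0 : ℝ) < 1 / ((n : ℝ) + 1) := by positivity
    have e1 := Metric.tendsto_nhds.1 (tendsto_approxUnit_mul (d i)) _ hε
    have e2 := Metric.tendsto_nhds.1 (tendsto_mul_approxUnit (d i)) _ hε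
    simp only [dist_eq_norm] at e1 e2
    exact e1.and e2
  choose e he1 he using h
  have hmem : ∀ i, ∀ᶠ n in atTop, i ∈ Finset.range (n + 1) := fun i => by
    filter_upwards [eventually_ge_atTop i] with n hn
    exact Finset.mem_range.2 (by omega)
  refine ⟨e, fun n => (he1 n).1, fun a => ?_, fun a => ?_⟩
  · have key := tendsto_zero_of_denseRange (T := fun n a => e n * a - a) (C := 2) two_pos
      (fun n a b => ?_) (TopologicalSpace.denseRange_denseSeq A) (fun i => ?_) a
    · simpa using key.add_const a
    · have e1 : e n * a - a - (e n * b - b) = e n * (a - b) - (a - b) := by rw [mul_sub]; abel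
      rw [e1, two_mul]
      exact (norm_sub_le _ _).trans (add_le_add_left ((norm_mul_le _ _).trans
        (mul_le_of_le_one_left (norm_nonneg _) (he1 n).1)) _)
    · rw [tendsto_zero_iff_norm_tendsto_zero]
      exact squeeze_zero' (Eventually.of_forall fun _ => norm_nonneg _)
        ((hmem i).mono fun n hn => (he n i hn).1.le) tendsto_one_div_add_atTop_nhds_zero_nat
  · have key := tendsto_zero_of_denseRange (T := fun n a => a * e n - a) (C := 2) two_pos
      (fun n a b => ?_) (TopologicalSpace.denseRange_denseSeq A) (fun i => ?_) a
    · simpa using key.add_const a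
    · have e1 : a * e n - a - (b * e n - b) = (a - b) * e n - (a - b) := by rw [sub_mul]; abel
      rw [e1, two_mul]
      exact (norm_sub_le _ _).trans (add_le_add_left ((norm_mul_le _ _).trans
        (mul_le_of_le_one_right (norm_nonneg _) (he1 n).1)) _)
    · rw [tendsto_zero_iff_norm_tendsto_zero]
      exact squeeze_zero' (Eventually.of_forall fun _ => norm_nonneg _)
        ((hmem i).mono fun n hn => (he n i hn).2.le) tendsto_one_div_add_atTop_nhds_zero_nat

/-- The relative commutant contains an element acting as a unit on `A`. -/
theorem exists_relCommutant_unit [TopologicalSpace.SeparableSpace A] :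
    ∃ x : relCommutant A, ∀ a, (x : SeqInfty A) * constSeq A a = constSeq A a := by
  obtain ⟨e, he, hl, hr⟩ := exists_seq_approxUnit A
  have h1 : ∀ a, seqMk _ (bddSeq e he) * constSeq A a = constSeq A a := fun a => by
    rw [← sub_eq_zero]
    change seqMk _ _ * seqMk _ _ - seqMk _ _ = 0
    rw [← map_mul, ← map_sub, seqMk_eq_zero]
    have := (hl a).sub_const a
    rwa [sub_self] at this
  have h2 : ∀ a, constSeq A a * seqMk _ (bddSeq e he) = constSeq A a := fun a => by
    rw [← sub_eq_zero]
    change seqMk _ _ * seqMk _ _ - seqMk _ _ = 0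
    rw [← map_mul, ← map_sub, seqMk_eq_zero]
    have := (hr a).sub_const a
    rwa [sub_self] at this
  refine ⟨⟨seqMk _ (bddSeq e he), ?_⟩, h1⟩
  rw [NonUnitalStarSubalgebra.mem_centralizer_iff]
  rintro _ ⟨b, rfl⟩
  rw [← map_star, h1, h2, h1, h2]
  exact ⟨rfl, rfl⟩

/-- Lift the images of the indicator functions to elements q_h of A_∞ ∩ A' and set S(y) = ∑ y_h q_h.
The relations among the q_h hold only modulo the annihilator, but become exact once multiplied by
elements of A. -/
theorem HasRokhlinProperty.hasRokhlinMap [Fintype G] [TopologicalSpace.SeparableSpace A]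
    {β : G →* (A ≃⋆ₐ[ℂ] A)} (h : HasRokhlinProperty β) : HasRokhlinMap β := by
  classical
  obtain ⟨Φ, hΦ1, hΦ⟩ := h
  choose q hq using fun h : G => (annIdeal A).cls_surjective (Φ (Pi.single h 1))
  have hann : ∀ {x y : relCommutant A}, (annIdeal A).cls x = (annIdeal A).cls y → ∀ b,
      constSeq A b * (x : SeqInfty A) = constSeq A b * (y : SeqInfty A) := fun {x y} hxy b => by
    have h1 := ((mem_annIdeal A).1 (((annIdeal A).cls_eq_cls).1 hxy) b).2
    have h2 : constSeq A b * ((x : SeqInfty A) - y) = 0 := h1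
    rwa [mul_sub, sub_eq_zero] at h2
  have hcomm : ∀ (x : relCommutant A) b,
      constSeq A b * (x : SeqInfty A) = (x : SeqInfty A) * constSeq A b := fun x b =>
    ((NonUnitalStarSubalgebra.mem_centralizer_iff ℂ).1 x.2 _ ⟨b, rfl⟩).1
  have hqo : ∀ h k, h ≠ k → ∀ b, constSeq A b * ((q h : SeqInfty A) * q k) = 0 :=
    fun h k hk b => by
      have h1 : (annIdeal A).cls (q h * q k) = (annIdeal A).cls 0 := by
        rw [StarIdeal.cls_mul, hq, hq, ← map_mul, StarIdeal.cls_zero, single_mul',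
          Pi.single_eq_of_ne hk, mul_zero, Pi.single_zero, map_zero]
      have h2 := hann h1 b
      change constSeq A b * ((q h : SeqInfty A) * q k) = constSeq A b * 0 at h2
      rwa [mul_zero] at h2
  have hqq : ∀ h b, constSeq A b * ((q h : SeqInfty A) * q h) = constSeq A b * q h :=
    fun h b => hann (x := q h * q h) (by
      rw [StarIdeal.cls_mul, hq, ← map_mul, single_mul', Pi.single_eq_same, mul_one]) b
  have hqs : ∀ h b, constSeq A b * star (q h : SeqInfty A) = constSeq A b * q h :=
    fun h b => hann (x := star (q h)) (by
      rw [StarIdeal.cls_star, hq, ← map_star, ← Pi.single_star, star_one]) b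
  have hqβ : ∀ g h b, constSeq A b * seqInftyMap (β g) (q h : SeqInfty A) =
      constSeq A b * q (g * h) := fun g h b => hann (x := relCommutantMap (β g) (q h)) (by
    change centralSeqMap (β g) ((annIdeal A).cls (q h)) = _
    rw [hq, ← hΦ, hq]
    congr 1
    exact shiftHom_single g h (1 : ℂ)) b
  -- That Φ 1 is a unit of F_∞(A) says something about A only through an element x of A_∞ ∩ A'
  -- acting as a unit on A: b x ∑ q_h = b x, and x can then be absorbed into b.
  have hqu : ∀ b, constSeq A b * ∑ h, (q h : SeqInfty A) = constSeq A b := by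
    obtain ⟨x, hx⟩ := exists_relCommutant_unit (A := A)
    have h1 : (annIdeal A).cls (x * ∑ h, q h) = (annIdeal A).cls x := by
      have h2 : (annIdeal A).cls (∑ h, q h) = Φ 1 := by
        have h3 : (annIdeal A).cls (∑ h, q h) = ∑ h, (annIdeal A).cls (q h) :=
          map_sum (annIdeal A).mkHom q Finset.univ
        rw [h3]
        simp only [hq]
        rw [← map_sum]
        congr 1
        exact Finset.univ_sum_single (1 : G → ℂ)
      rw [StarIdeal.cls_mul, h2, (hΦ1 _).2]
    intro b
    have h4 := hann h1 b
    have h5 : ((∑ h, q h : relCommutant A) : SeqInfty A) = ∑ h, (q h : SeqInfty A) :=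
      map_sum (NonUnitalStarSubalgebraClass.subtype (relCommutant A)) q Finset.univ
    change constSeq A b * ((x : SeqInfty A) * (∑ h, q h : relCommutant A)) = _ at h4
    rw [← mul_assoc, hcomm x b, hx, h5] at h4
    exact h4
  refine ⟨{ toFun := fun y => ∑ h, constSeq A (y h) * q h
            map_smul' := fun c y => by simp [Finset.smul_sum, smul_mul_assoc]
            map_zero' := by simp
            map_add' := fun y z => by simp [add_mul, Finset.sum_add_distrib]
            map_mul' := fun y z => ?_
            map_star' := fun y => ?_ }, fun a => ?_, fun g y => ?_⟩
  · rw [Finset.sum_mul]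
    refine Finset.sum_congr rfl fun h _ => ?_
    have h1 : ∀ k, constSeq A (y h) * (q h : SeqInfty A) * (constSeq A (z k) * q k) =
        constSeq A (y h * z k) * (q h * q k) := fun k => by
      rw [map_mul, mul_assoc, ← mul_assoc (q h : SeqInfty A), ← hcomm]
      simp only [mul_assoc]
    rw [Finset.mul_sum, Finset.sum_eq_single h]
    · rw [h1, hqq]; rfl
    · intro k _ hk
      rw [h1, hqo _ _ hk.symm]
    · simp
  · rw [star_sum]
    refine Finset.sum_congr rfl fun h _ => ?_
    rw [star_mul, ← map_star]
    have h1 := hcomm (star (q h)) (star (y h))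
    change constSeq A (star (y h)) * star (q h : SeqInfty A) = _ at h1
    exact (hqs h _).symm.trans h1
  · change ∑ h, constSeq A a * (q h : SeqInfty A) = _
    rw [← Finset.mul_sum, hqu]
  · change seqInftyMap (β g) (∑ h, constSeq A (y h) * (q h : SeqInfty A)) =
      ∑ h, constSeq A (β g (y (g⁻¹ * h))) * (q h : SeqInfty A)
    rw [map_sum, ← Equiv.sum_comp (Equiv.mulLeft g) fun h =>
      constSeq A (β g (y (g⁻¹ * h))) * (q h : SeqInfty A)]
    refine Finset.sum_congr rfl fun h _ => ?_
    rw [map_mul, seqInftyMap_constSeq, hqβ]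
    simp only [Equiv.coe_mulLeft, inv_mul_cancel_left]

/-- The conjugate of an action by an automorphism. -/
def conjAction (θ : A ≃⋆ₐ[ℂ] A) (β : G →* (A ≃⋆ₐ[ℂ] A)) : G →* (A ≃⋆ₐ[ℂ] A) :=
  (MulAut.conj θ).toMonoidHom.comp β

theorem conjAction_apply (θ : A ≃⋆ₐ[ℂ] A) (β : G →* (A ≃⋆ₐ[ℂ] A)) (g : G) :
    conjAction θ β g = θ * β g * θ⁻¹ := rfl

/-- Transport S to θ_∞ ∘ S ∘ θ⁻¹, with θ⁻¹ applied coordinatewise. -/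
theorem HasRokhlinMap.conj [Fintype G] {β : G →* (A ≃⋆ₐ[ℂ] A)} (h : HasRokhlinMap β)
    (θ : A ≃⋆ₐ[ℂ] A) :
    HasRokhlinMap (conjAction θ β) := by
  obtain ⟨S, hS1, hS⟩ := h
  have hcomp : ∀ (θ η : A ≃⋆ₐ[ℂ] A) x, seqInftyMap (θ * η) x = seqInftyMap θ (seqInftyMap η x) :=
    fun θ η x => by
      obtain ⟨x, rfl⟩ := seqMk_surjective _ x
      rfl
  refine ⟨((seqInftyMap θ).comp S).comp
    (piHom (ι := G) (A := A) (B := G → A) fun h =>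
      ((θ⁻¹ : A ≃⋆ₐ[ℂ] A) : A →⋆ₙₐ[ℂ] A).comp (evalHom A h)), fun a => ?_,
    fun g y => ?_⟩
  · change seqInftyMap θ (S fun _ => θ⁻¹ a) = _
    rw [hS1, seqInftyMap_constSeq, aut_apply_inv_apply]
  · change seqInftyMap (θ * β g * θ⁻¹) (seqInftyMap θ (S fun h => θ⁻¹ (y h))) =
      seqInftyMap θ (S fun h => θ⁻¹ ((θ * β g * θ⁻¹) (y (g⁻¹ * h))))
    rw [← hcomp, inv_mul_cancel_right, hcomp, hS]
    congr 2
    funext k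
    simp only [StarAlgEquiv.mul_apply, aut_inv_apply_apply]

end RokhlinMap

/-! ### Gluing unitaries -/

section Glue

variable {G A : Type*} [Fintype G] [NonUnitalCStarAlgebra A]

theorem eventually_norm_lt_of_seqMk {x : lp (fun _ : ℕ => A) ∞} {c : ℝ}
    (h : ‖seqMk (fun _ : ℕ => A) x‖ < c) : ∀ᶠ n in atTop, ‖x n‖ < c := by
  obtain ⟨y, hy, hlt⟩ := exists_norm_lt (fun _ : ℕ => A) (seqMk _ x)
    (half_pos (sub_pos.2 h))
  have h1 := (seqMk_eq_seqMk _).1 hy.symm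
  filter_upwards [h1.eventually (gt_mem_nhds (half_pos (sub_pos.2 h)))] with n hn
  have h2 : ‖y n‖ ≤ ‖y‖ := lp.norm_apply_le_norm ENNReal.top_ne_zero y n
  have h3 : ‖x n‖ ≤ ‖y n‖ + ‖x n - y n‖ := norm_le_norm_add_norm_sub' _ _
  linarith

/-- A strict estimate valid in every coordinate of G → A holds for all late entries of a lift. This
converts relations among functions into approximate relations in A. -/
theorem eventually_norm_lt_of_hom {S : (G → A) →⋆ₙₐ[ℂ] SeqInfty A} {x : lp (fun _ : ℕ => A) ∞}
    {z : G → A} {c : ℝ} (hc : 0 < c) (hx : seqMk _ x = S z) (hz : ∀ h, ‖z h‖ < c) :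
    ∀ᶠ n in atTop, ‖x n‖ < c :=
  eventually_norm_lt_of_seqMk (by
    rw [hx]
    exact (NonUnitalStarAlgHom.norm_apply_le S z).trans_lt ((pi_norm_lt_iff hc).2 hz))

/-- Unitaries indexed by the group can be glued to one unitary along a homomorphism from `G → A`
into the sequence algebra. -/
theorem eventually_exists_glue (hA : HasApproxPolar A) {S : (G → A) →⋆ₙₐ[ℂ] SeqInfty A}
    (hS : ∀ a, S (fun _ => a) = constSeq A a) {s : (G → A) → lp (fun _ : ℕ => A) ∞}
    (hs : ∀ y, seqMk _ (s y) = S y) (u : G → unitary (Unitization ℂ A)) (Y : Finset (G → A))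
    (ε : ℝ) (hε : 0 < ε) : ∀ᶠ n in atTop, ∃ v : unitary (Unitization ℂ A), ∀ y ∈ Y,
      ‖adAut v (s y n) - s (fun h => adAut (u h) (y h)) n‖ < ε := by
  obtain ⟨e₀, he₀⟩ := hA.exists_adAut
  have hsq : ∀ a : A, Tendsto (fun e => e * e * a) (approxUnit A) (𝓝 a) :=
    (nondegenerate_equiv (1 : A ≃⋆ₐ[ℂ] A)).mul
  have hAd : ∀ h, Tendsto (fun e => adAut (u h) (e * e) * e₀) (approxUnit A) (𝓝 e₀) := fun h => by
    have h1 := ((continuous_hom (adAut (u h) : A →⋆ₙₐ[ℂ] A)).tendsto _).comp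
      (hsq ((adAut (u h))⁻¹ e₀))
    change Tendsto (fun e => adAut (u h) (e * e * (adAut (u h))⁻¹ e₀)) _
      (𝓝 (adAut (u h) ((adAut (u h))⁻¹ e₀))) at h1
    simp only [map_mul, aut_apply_inv_apply] at h1
    simpa only [map_mul] using h1
  have ev1 : ∀ᶠ e in approxUnit A, ∀ h ∈ (Finset.univ : Finset G),
      ‖adAut (u h) (e * e) * e₀ - e₀‖ < 1 / 2 := by
    rw [eventually_all_finset]
    intro h _
    simpa [dist_eq_norm] using Metric.tendsto_nhds.1 (hAd h) (1 / 2) (by norm_num)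
  have ev2 : ∀ᶠ e in approxUnit A, ∀ y ∈ Y, ∀ h ∈ (Finset.univ : Finset G),
      ‖e * e * y h - y h‖ < ε / 10 ∧ ‖e * e * star (y h) - star (y h)‖ < ε / 10 ∧
      ‖e * y h * e - y h‖ < ε / 10 := by
    simp only [eventually_all_finset]
    intro y _ h _
    have h1 := Metric.tendsto_nhds.1 (hsq (y h)) (ε / 10) (by positivity)
    have h2 := Metric.tendsto_nhds.1 (hsq (star (y h))) (ε / 10) (by positivity)
    have h3 := Metric.tendsto_nhds.1 (tendsto_approxUnit_conj (y h)) (ε / 10) (by positivity)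
    simp only [dist_eq_norm] at h1 h2 h3
    exact h1.and (h2.and h3)
  have ev3 := Metric.tendsto_nhds.1 (hsq e₀) 1 one_pos
  obtain ⟨e, ⟨he1, hes⟩, hev1, hev2, hev3⟩ :=
    (eventually_approxUnit.and (ev1.and (ev2.and ev3))).exists
  rw [dist_eq_norm] at hev3
  -- The unitaries u h need not lie in A, so they are cut down by e. The lift of X then plays the
  -- role of ∑ q_h u_h e, with X⋆X = e² and XX⋆ = Ad(u_h)(e²), so its late entries are approximate
  -- unitaries.
  let X : G → A := fun h => leftMul (u h : Unitization ℂ A) e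
  have hX : ∀ h a, X h * a * star (X h) = adAut (u h) (e * a * e) := fun h a =>
    Unitization.inr_injective (R := ℂ) <| by
      rw [Unitization.inr_mul, Unitization.inr_mul, Unitization.inr_star, inr_leftMul, inr_adAut,
        star_mul, ← Unitization.inr_star, hes, Unitization.inr_mul, Unitization.inr_mul]
      simp only [mul_assoc]
  have hX1 : star X * X = fun _ => e * e := funext fun h =>
    Unitization.inr_injective (R := ℂ) <| by
      have h1 : star (u h : Unitization ℂ A) * (u h : Unitization ℂ A) = 1 :=
        Unitary.coe_star_mul_self _
      change ((star (X h) * X h : A) : Unitization ℂ A) = _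
      rw [Unitization.inr_mul, Unitization.inr_star, inr_leftMul, star_mul,
        ← Unitization.inr_star, hes, Unitization.inr_mul, mul_assoc,
        ← mul_assoc (star (u h : Unitization ℂ A)), h1, one_mul]
  have hX2 : X * star X = fun h => adAut (u h) (e * e) := funext fun h =>
    Unitization.inr_injective (R := ℂ) <| by
      change ((X h * star (X h) : A) : Unitization ℂ A) = _
      rw [Unitization.inr_mul, Unitization.inr_star, inr_leftMul, star_mul,
        ← Unitization.inr_star, hes, inr_adAut, Unitization.inr_mul]
      simp only [mul_assoc]
  have lift : ∀ (x : lp (fun _ : ℕ => A) ∞) (z : G → A) (c : ℝ), 0 < c → seqMk _ x = S z →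
      (∀ h, ‖z h‖ < c) → ∀ᶠ n in atTop, ‖x n‖ < c := fun _ _ _ => eventually_norm_lt_of_hom
  let c₀ : lp (fun _ : ℕ => A) ∞ :=
    ⟨fun _ => e₀, memℓp_infty ⟨‖e₀‖, by rintro _ ⟨k, rfl⟩; exact le_rfl⟩⟩
  have hc₀ : seqMk _ c₀ = S fun _ => e₀ := (hS e₀).symm
  have E1 := lift (star (s X) * s X * c₀ - c₀) (star X * X * (fun _ => e₀) - fun _ => e₀) 1 one_pos
    (by simp only [map_sub, map_mul, map_star, hs, hc₀]) (fun h => by rw [hX1]; exact hev3)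
  have E2 := lift (s X * star (s X) * c₀ - c₀) (X * star X * (fun _ => e₀) - fun _ => e₀) 1 one_pos
    (by simp only [map_sub, map_mul, map_star, hs, hc₀]) (fun h => by
      rw [hX2]; exact (hev1 h (Finset.mem_univ h)).trans (by norm_num))
  have E3 : ∀ᶠ n in atTop, ∀ y ∈ Y, ‖(star (s X) * s X * s y - s y) n‖ < ε / 10 ∧
      ‖(star (s X) * s X * star (s y) - star (s y)) n‖ < ε / 10 ∧
      ‖(s X * s y * star (s X) - s fun h => adAut (u h) (y h)) n‖ < ε / 10 := by
    rw [eventually_all_finset]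
    intro y hy
    have hev := fun h => hev2 y hy h (Finset.mem_univ h)
    refine (lift _ (star X * X * y - y) (ε / 10) (by positivity)
        (by simp only [map_sub, map_mul, map_star, hs]) fun h => ?_).and
      ((lift _ (star X * X * star y - star y) (ε / 10) (by positivity)
        (by simp only [map_sub, map_mul, map_star, hs]) fun h => ?_).and
      (lift _ (X * y * star X - fun h => adAut (u h) (y h)) (ε / 10) (by positivity)
        (by simp only [map_sub, map_mul, map_star, hs]) fun h => ?_))
    · rw [hX1]; exact (hev h).1
    · rw [hX1]; exact (hev h).2.1
    · change ‖X h * y h * star (X h) - adAut (u h) (y h)‖ < _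
      rw [hX, norm_aut_sub]
      exact (hev h).2.2
  -- Each coordinate of X has norm at most 1; the bound 2 leaves room for the strict inequality.
  have E4 := lift (s X) X 2 two_pos (hs X) (fun h => by
    rw [norm_leftMul_unitary]; exact he1.trans_lt one_lt_two)
  classical
  filter_upwards [E1, E2, E3, E4] with n h1 h2 h3 h4
  obtain ⟨v, hv⟩ := he₀ (s X n) h1 h2 (Y.image fun y => s y n) (ε / 10) (by positivity)
  refine ⟨v, fun y hy => ?_⟩
  have h5 := hv _ (Finset.mem_image_of_mem _ hy)
  obtain ⟨a1, a2, a3⟩ := h3 y hy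
  have b1 : ‖star (s X n) * s X n * s y n - s y n‖ < ε / 10 := a1
  have b2 : ‖star (s X n) * s X n * star (s y n) - star (s y n)‖ < ε / 10 := a2
  have b3 : ‖s X n * s y n * star (s X n) - s (fun h => adAut (u h) (y h)) n‖ < ε / 10 := a3
  have b4 : ‖s X n‖ * ‖star (s X n) * s X n * star (s y n) - star (s y n)‖ ≤ 2 * (ε / 10) :=
    mul_le_mul h4.le b2.le (norm_nonneg _) two_pos.le
  have b5 := norm_sub_le_norm_sub_add_norm_sub (adAut v (s y n)) (s X n * s y n * star (s X n))
    (s (fun h => adAut (u h) (y h)) n)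
  linarith

end Glue

/-! ### Limits of automorphisms -/

section LimitAut

variable {A : Type*} [NonUnitalCStarAlgebra A]

theorem tendsto_hom_apply {f : ℕ → A →⋆ₙₐ[ℂ] A} {x : ℕ → A} {a b : A}
    (hf : Tendsto (fun n => f n a) atTop (𝓝 b)) (hx : Tendsto x atTop (𝓝 a)) :
    Tendsto (fun n => f n (x n)) atTop (𝓝 b) := by
  have h1 : Tendsto (fun n => f n (x n) - f n a) atTop (𝓝 0) := by
    rw [tendsto_zero_iff_norm_tendsto_zero]
    refine squeeze_zero (fun _ => norm_nonneg _) (fun n => norm_hom_sub_le (f n) (x n) a) ?_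
    simpa using (hx.sub_const a).norm
  simpa using h1.add hf

theorem exists_limit_hom {f : ℕ → A →⋆ₙₐ[ℂ] A} {d : ℕ → A} (hd : DenseRange d) {C : ℝ}
    (h : ∀ n, ∀ i < n, ‖f (n + 1) (d i) - f n (d i)‖ ≤ C * (1 / 2) ^ n) :
    ∃ F : A →⋆ₙₐ[ℂ] A, ∀ a, Tendsto (fun n => f n a) atTop (𝓝 (F a)) := by
  have h1 : ∀ i, CauchySeq fun n => f n (d i) := fun i => by
    rw [← cauchySeq_shift (i + 1)]
    refine cauchySeq_of_le_geometric (1 / 2 : ℝ) (C * (1 / 2) ^ (i + 1)) (by norm_num) fun n => ?_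
    rw [dist_comm, dist_eq_norm, mul_assoc, ← pow_add, add_comm (i + 1) n, add_right_comm n 1]
    exact h _ i (by omega)
  have h2 : ∀ a, ∃ c, Tendsto (fun n => f n a) atTop (𝓝 c) := fun a => by
    refine cauchySeq_tendsto_of_complete (Metric.cauchySeq_iff'.2 fun ε hε => ?_)
    obtain ⟨i, hi⟩ := Metric.denseRange_iff.1 hd a (ε / 3) (by positivity)
    obtain ⟨N, hN⟩ := Metric.cauchySeq_iff'.1 (h1 i) (ε / 3) (by positivity)
    refine ⟨N, fun n hn => ?_⟩
    have h3 := hN n hn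
    rw [dist_eq_norm] at h3 hi ⊢
    have h4 := norm_hom_sub_le (f n) a (d i)
    have h5 := norm_hom_sub_le (f N) (d i) a
    rw [norm_sub_rev (d i)] at h5
    have h6 := norm_sub_le_norm_sub_add_norm_sub (f n a) (f n (d i)) (f N a)
    have h7 := norm_sub_le_norm_sub_add_norm_sub (f n (d i)) (f N (d i)) (f N a)
    linarith
  choose F hF using h2
  exact ⟨{ toFun := F
           map_smul' := fun c a => tendsto_nhds_unique (hF _)
             (by simp only [map_smul]; exact (hF a).const_smul c)
           map_zero' := tendsto_nhds_unique (hF _) (by simp)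
           map_add' := fun a b => tendsto_nhds_unique (hF _)
             (by simpa only [map_add] using (hF a).add (hF b))
           map_mul' := fun a b => tendsto_nhds_unique (hF _)
             (by simpa only [map_mul] using (hF a).mul (hF b))
           map_star' := fun a => tendsto_nhds_unique (hF _)
             (by simpa only [map_star] using (hF a).star) }, hF⟩

/-- A pointwise limit of automorphisms may fail to be surjective, so convergence of the inverses is
imposed as well; the two limits are then mutually inverse. -/
theorem exists_limit_aut {θ : ℕ → A ≃⋆ₐ[ℂ] A} {d : ℕ → A} (hd : DenseRange d) {C : ℝ}
    (h : ∀ n, ∀ i < n, ‖θ (n + 1) (d i) - θ n (d i)‖ ≤ C * (1 / 2) ^ n)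
    (h' : ∀ n, ∀ i < n, ‖(θ (n + 1))⁻¹ (d i) - (θ n)⁻¹ (d i)‖ ≤ C * (1 / 2) ^ n) :
    ∃ Θ : A ≃⋆ₐ[ℂ] A, ∀ a, Tendsto (fun n => θ n a) atTop (𝓝 (Θ a)) ∧
      Tendsto (fun n => (θ n)⁻¹ a) atTop (𝓝 (Θ⁻¹ a)) := by
  obtain ⟨F, hF⟩ := exists_limit_hom (f := fun n => (θ n : A →⋆ₙₐ[ℂ] A)) hd h
  obtain ⟨F', hF'⟩ := exists_limit_hom
    (f := fun n => (((θ n)⁻¹ : A ≃⋆ₐ[ℂ] A) : A →⋆ₙₐ[ℂ] A)) hd h'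
  have e1 : ∀ a, F (F' a) = a := fun a => by
    have h1 := tendsto_hom_apply (hF (F' a)) (hF' a)
    refine tendsto_nhds_unique h1 (tendsto_const_nhds.congr fun n => ?_)
    exact (aut_apply_inv_apply (θ n) a).symm
  have e2 : ∀ a, F' (F a) = a := fun a => by
    have h1 := tendsto_hom_apply (hF' (F a)) (hF a)
    refine tendsto_nhds_unique h1 (tendsto_const_nhds.congr fun n => ?_)
    exact (aut_inv_apply_apply (θ n) a).symm
  exact ⟨StarAlgEquiv.ofNonUnitalStarAlgHom F F' (by ext a; exact e2 a) (by ext a; exact e1 a),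
    fun a => ⟨hF a, hF' a⟩⟩

/-- The change of the inverses at d is governed by how far Ad v moves d itself, and the change of
the automorphisms by how far it moves Ad(w) d. This is why pairs {d, Ad(w) d} are tracked below. -/
theorem norm_adAut_mul_sub_le {v w : unitary (Unitization ℂ A)} {d : A} {r : ℝ}
    (h : ∀ a ∈ ({d, adAut w d} : Set A), ‖adAut v a - a‖ ≤ r) :
    ‖adAut (v * w) d - adAut w d‖ ≤ r ∧ ‖(adAut (v * w))⁻¹ d - (adAut w)⁻¹ d‖ ≤ r := by
  refine ⟨?_, ?_⟩
  · rw [map_mul]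
    exact h _ (Or.inr rfl)
  · rw [map_mul, mul_inv_rev, StarAlgEquiv.mul_apply, norm_aut_sub, ← norm_aut_sub (adAut v),
      aut_apply_inv_apply, norm_sub_rev]
    exact h _ (by simp)

end LimitAut

/-! ### Uniqueness of Rokhlin actions -/

section Uniqueness

variable {G A : Type*} [Group G] [NonUnitalCStarAlgebra A]

theorem conjAction_mul (θ η : A ≃⋆ₐ[ℂ] A) (β : G →* (A ≃⋆ₐ[ℂ] A)) :
    conjAction (θ * η) β = conjAction θ (conjAction η β) := by
  ext g a
  simp only [conjAction_apply, mul_inv_rev, mul_assoc]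

variable [TopologicalSpace.SeparableSpace A]

theorem mk_adAut (u : unitary (Unitization ℂ A)) : (approxUnitaryCon A).mk' (adAut u) = 1 :=
  ((Con.eq _).2 (approxUnitarilyEquiv_adAut_comp u (.id ℂ A))).symm

theorem mk_conjAction_adAut (u : unitary (Unitization ℂ A)) (β : G →* (A ≃⋆ₐ[ℂ] A)) (g : G) :
    (approxUnitaryCon A).mk' (conjAction (adAut u) β g) = (approxUnitaryCon A).mk' (β g) := by
  rw [conjAction_apply, map_mul, map_mul, map_inv, mk_adAut, one_mul, inv_one, mul_one]

variable [Fintype G]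

/-- An action `β` with a Rokhlin map can be moved close to an action that is pointwise
approximately unitarily equivalent to it, by an inner automorphism that is almost trivial where the
two actions are already close. -/
theorem exists_conj_step (hA : HasApproxPolar A) {α β : G →* (A ≃⋆ₐ[ℂ] A)}
    (hαβ : ∀ g, (approxUnitaryCon A).mk' (α g) = (approxUnitaryCon A).mk' (β g))
    (hβ : HasRokhlinMap β) (F : Finset A) {δ : ℝ} (hδ : 0 < δ)
    (hF : ∀ a ∈ F, ∀ h, ‖α h ((β h)⁻¹ a) - a‖ < δ) (L : Finset A) {ε : ℝ} (hε : 0 < ε) :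
    ∃ v : unitary (Unitization ℂ A), (∀ a ∈ L, ∀ g,
      ‖conjAction (adAut v) β g a - α g a‖ < ε) ∧ ∀ a ∈ F, ‖adAut v a - a‖ < δ + ε := by
  classical
  obtain ⟨S, hS1, hSβ⟩ := hβ
  choose s hs using fun y => seqMk_surjective (fun _ : ℕ => A) (S y)
  -- Besides F, the unitaries u h must be controlled at the intermediate points β_l α_l⁻¹ a and at
  -- their images under every β_g.
  let M : Finset A := F ∪ ((Finset.univ ×ˢ L).image (fun p : G × A => β p.1 ((α p.1)⁻¹ p.2)) ∪
    (Finset.univ ×ˢ (Finset.univ ×ˢ L)).image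
      (fun p : G × G × A => β p.1 (β p.2.1 ((α p.2.1)⁻¹ p.2.2))))
  have hu : ∀ h, ∃ u : unitary (Unitization ℂ A), ∀ b ∈ M,
      ‖adAut u b - α h ((β h)⁻¹ b)‖ < ε / 6 := fun h => by
    have h1 : ApproxUnitarilyEquiv ((1 : A ≃⋆ₐ[ℂ] A) : A →⋆ₙₐ[ℂ] A)
        ((α h * (β h)⁻¹ : A ≃⋆ₐ[ℂ] A) : A →⋆ₙₐ[ℂ] A) := approxUnitarilyEquiv_of_con (by
      rw [map_mul, map_inv, hαβ, mul_inv_cancel, map_one])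
    exact approxUnitarilyEquiv_iff_adAut.1 h1 M (ε / 6) (by positivity)
  choose u hu using hu
  -- Gluing carries this function to the constant a, so its lift approximates Ad(v)⁻¹ a.
  let y : A → G → A := fun a h => (adAut (u h))⁻¹ a
  have huy : ∀ a, (fun h => adAut (u h) (y a h)) = fun _ => a := fun a =>
    funext fun h => aut_apply_inv_apply _ _
  let m : G → (G → A) → G → A := fun g z k => β g (z (g⁻¹ * k))
  have hε6 : 0 < ε / 6 := by positivity
  have lift : ∀ (x : lp (fun _ : ℕ => A) ∞) (z : G → A) (c : ℝ), 0 < c → seqMk _ x = S z →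
      (∀ h, ‖z h‖ < c) → ∀ᶠ n in atTop, ‖x n‖ < c := fun _ _ _ => eventually_norm_lt_of_hom
  let c : A → lp (fun _ : ℕ => A) ∞ := fun a =>
    ⟨fun _ => a, memℓp_infty ⟨‖a‖, by rintro _ ⟨k, rfl⟩; exact le_rfl⟩⟩
  have hc : ∀ a, seqMk _ (c a) = S fun _ => a := fun a => (hS1 a).symm
  have E1 : ∀ᶠ n in atTop, ∀ a ∈ F ∪ L, ‖(s (fun _ => a) - c a) n‖ < ε / 6 := by
    rw [eventually_all_finset]
    intro a _
    exact lift _ 0 _ hε6 (by rw [map_sub, hs, hc, sub_self, map_zero]) (by simpa using hε)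
  have E2 : ∀ᶠ n in atTop, ∀ a ∈ L, ∀ g ∈ (Finset.univ : Finset G),
      ‖(lpMap (β g) (s (y a)) - s (m g (y a))) n‖ < ε / 6 := by
    simp only [eventually_all_finset]
    intro a _ g _
    refine lift _ 0 _ hε6 ?_ (by simpa using hε)
    have h1 : seqMk _ (lpMap (β g) (s (y a))) = seqInftyMap (β g) (S (y a)) := by
      rw [← hs]; rfl
    rw [map_sub, h1, hSβ, hs, map_zero]
    exact sub_self _
  have E3 : ∀ᶠ n in atTop, ∀ a ∈ F, ‖(s (fun h => adAut (u h) a) - c a) n‖ < δ + ε / 6 := by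
    rw [eventually_all_finset]
    intro a ha
    refine lift _ ((fun h => adAut (u h) a) - fun _ => a) _ (by positivity)
      (by rw [map_sub, map_sub, hs, hc]) fun h => ?_
    have h1 := hu h a (Finset.mem_union_left _ ha)
    have h2 := hF a ha h
    have h3 := norm_sub_le_norm_sub_add_norm_sub (adAut (u h) a) (α h ((β h)⁻¹ a)) a
    change ‖adAut (u h) a - a‖ < _
    linarith
  -- With Ad u_h ≈ α_h β_h⁻¹ and l = g⁻¹k, coordinate k of the transported function is approximately
  -- α_k β_k⁻¹ β_g β_l α_l⁻¹ a. Since β_k = β_g β_l, this is α_k α_l⁻¹ a = α_g a, independent of k.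
  have E4 : ∀ᶠ n in atTop, ∀ a ∈ L, ∀ g ∈ (Finset.univ : Finset G),
      ‖(s (fun h => adAut (u h) (m g (y a) h)) - c (α g a)) n‖ < ε / 6 + ε / 6 := by
    simp only [eventually_all_finset]
    intro a ha g _
    refine lift _ ((fun h => adAut (u h) (m g (y a) h)) - fun _ => α g a) _ (by positivity)
      (by rw [map_sub, map_sub, hs, hc]) fun k => ?_
    change ‖adAut (u k) (β g ((adAut (u (g⁻¹ * k)))⁻¹ a)) - α g a‖ < _
    set b := β (g⁻¹ * k) ((α (g⁻¹ * k))⁻¹ a) with hb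
    have h1 := hu (g⁻¹ * k) b (Finset.mem_union_right _ (Finset.mem_union_left _
      (Finset.mem_image.2 ⟨(g⁻¹ * k, a), Finset.mem_product.2 ⟨Finset.mem_univ _, ha⟩, rfl⟩)))
    have h2 := hu k (β g b) (Finset.mem_union_right _ (Finset.mem_union_right _
      (Finset.mem_image.2 ⟨(g, g⁻¹ * k, a), Finset.mem_product.2 ⟨Finset.mem_univ _,
        Finset.mem_product.2 ⟨Finset.mem_univ _, ha⟩⟩, rfl⟩)))
    have h3 : α (g⁻¹ * k) ((β (g⁻¹ * k))⁻¹ b) = a := by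
      rw [hb, aut_inv_apply_apply, aut_apply_inv_apply]
    have h4 : α k ((β k)⁻¹ (β g b)) = α g a := by
      have h5 : (β k)⁻¹ (β g b) = (α (g⁻¹ * k))⁻¹ a := by
        rw [← StarAlgEquiv.mul_apply, hb, ← StarAlgEquiv.mul_apply, ← map_inv, ← map_mul,
          ← map_mul]
        simp
      rw [h5, ← StarAlgEquiv.mul_apply, ← map_inv, ← map_mul]
      simp
    rw [h3] at h1
    rw [h4] at h2
    rw [← norm_aut_sub (adAut (u (g⁻¹ * k)))⁻¹, aut_inv_apply_apply, norm_sub_rev,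
      ← norm_aut_sub (β g), ← norm_aut_sub (adAut (u k))] at h1
    have h6 := norm_sub_le_norm_sub_add_norm_sub
      (adAut (u k) (β g ((adAut (u (g⁻¹ * k)))⁻¹ a))) (adAut (u k) (β g b)) (α g a)
    linarith
  let Y : Finset (G → A) := (F.image fun a _ => a) ∪ (L.image y ∪
    (Finset.univ ×ˢ L).image fun p : G × A => m p.1 (y p.2))
  obtain ⟨n, h1, h2, h3, h4, v, hv⟩ := (E1.and (E2.and (E3.and (E4.and
    (eventually_exists_glue hA hS1 hs u Y (ε / 6) hε6))))).exists
  refine ⟨v, fun a ha g => ?_, fun a ha => ?_⟩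
  · have a1 : ‖s (fun _ => a) n - a‖ < ε / 6 := h1 a (Finset.mem_union_right _ ha)
    have a2 : ‖β g (s (y a) n) - s (m g (y a)) n‖ < ε / 6 := h2 a ha g (Finset.mem_univ g)
    have a4 : ‖s (fun h => adAut (u h) (m g (y a) h)) n - α g a‖ < ε / 6 + ε / 6 :=
      h4 a ha g (Finset.mem_univ g)
    have b1 := hv (y a) (Finset.mem_union_right _ (Finset.mem_union_left _
      (Finset.mem_image_of_mem _ ha)))
    have b2 := hv (m g (y a)) (Finset.mem_union_right _ (Finset.mem_union_right _
      (Finset.mem_image.2 ⟨(g, a), Finset.mem_product.2 ⟨Finset.mem_univ _, ha⟩, rfl⟩)))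
    rw [huy] at b1
    have c1 := norm_sub_le_norm_sub_add_norm_sub (adAut v (s (y a) n)) (s (fun _ => a) n) a
    have c2 : ‖adAut v (β g ((adAut v)⁻¹ a)) - adAut v (β g (s (y a) n))‖ < ε / 6 + ε / 6 := by
      rw [norm_aut_sub, norm_aut_sub, ← norm_aut_sub (adAut v), aut_apply_inv_apply, norm_sub_rev]
      linarith
    have c3 : ‖adAut v (β g (s (y a) n)) - adAut v (s (m g (y a)) n)‖ < ε / 6 := by
      rwa [norm_aut_sub]
    -- The errors are two units of ε / 6 for Ad(v)⁻¹ a, one for equivariance, one for gluing and two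
    -- for `E4`; they sum to ε, and strictness comes from the individual estimates.
    change ‖adAut v (β g ((adAut v)⁻¹ a)) - α g a‖ < ε
    have d1 := norm_sub_le_norm_sub_add_norm_sub (adAut v (β g ((adAut v)⁻¹ a)))
      (adAut v (β g (s (y a) n))) (α g a)
    have d2 := norm_sub_le_norm_sub_add_norm_sub (adAut v (β g (s (y a) n)))
      (adAut v (s (m g (y a)) n)) (α g a)
    have d3 := norm_sub_le_norm_sub_add_norm_sub (adAut v (s (m g (y a)) n))
      (s (fun h => adAut (u h) (m g (y a) h)) n) (α g a)
    linarith
  · have a1 : ‖s (fun _ => a) n - a‖ < ε / 6 := h1 a (Finset.mem_union_left _ ha)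
    have a3 : ‖s (fun h => adAut (u h) a) n - a‖ < δ + ε / 6 := h3 a ha
    have b1 := hv (fun _ => a) (Finset.mem_union_left _
      (Finset.mem_image.2 ⟨a, ha, rfl⟩))
    rw [← norm_aut_sub (adAut v), norm_sub_rev] at a1
    have d1 := norm_sub_le_norm_sub_add_norm_sub (adAut v a) (adAut v (s (fun _ => a) n)) a
    have d2 := norm_sub_le_norm_sub_add_norm_sub (adAut v (s (fun _ => a) n))
      (s (fun h => adAut (u h) a) n) a
    linarith

/-- The closeness condition maintained by the intertwining of two actions. -/
def AreClose (α β : G →* (A ≃⋆ₐ[ℂ] A)) (d : ℕ → A) (n : ℕ)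
    (s : unitary (Unitization ℂ A) × unitary (Unitization ℂ A)) : Prop :=
  ∀ i < n, ∀ a ∈ ({d i, adAut s.2 (d i)} : Set A), ∀ h,
    ‖conjAction (adAut s.1) α h ((conjAction (adAut s.2) β h)⁻¹ a) - a‖ < (1 / 2) ^ n

/-- Two applications of `exists_conj_step`: first β is moved towards α, then α towards the new β
with the tolerance of the next stage. Each correction acts on points where the actions were already
(1/2)^n-close, so it displaces them by at most 2(1/2)^n. -/
theorem exists_intertwine_actions (hA : HasApproxPolar A) {α β : G →* (A ≃⋆ₐ[ℂ] A)}
    (hαβ : ∀ g, (approxUnitaryCon A).mk' (α g) = (approxUnitaryCon A).mk' (β g))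
    (hα : HasRokhlinMap α) (hβ : HasRokhlinMap β) (d : ℕ → A) (n : ℕ)
    (s : unitary (Unitization ℂ A) × unitary (Unitization ℂ A)) (hs : AreClose α β d n s) :
    ∃ t : unitary (Unitization ℂ A) × unitary (Unitization ℂ A), AreClose α β d (n + 1) t ∧
      (∀ i < n, (‖adAut t.1 (d i) - adAut s.1 (d i)‖ ≤ 2 * (1 / 2) ^ n ∧
          ‖(adAut t.1)⁻¹ (d i) - (adAut s.1)⁻¹ (d i)‖ ≤ 2 * (1 / 2) ^ n) ∧
        ‖adAut t.2 (d i) - adAut s.2 (d i)‖ ≤ 2 * (1 / 2) ^ n ∧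
          ‖(adAut t.2)⁻¹ (d i) - (adAut s.2)⁻¹ (d i)‖ ≤ 2 * (1 / 2) ^ n) ∧
      ∀ i ≤ n, ∀ g, ‖conjAction (adAut t.1) α g (d i) - conjAction (adAut t.2) β g (d i)‖ <
        (1 / 2) ^ (n + 1) := by
  classical
  obtain ⟨u, v⟩ := s
  have hε : (0 : ℝ) < (1 / 2) ^ n := by positivity
  have hε' : (0 : ℝ) < (1 / 2) ^ (n + 1) := by positivity
  have hεε : (1 / 2 : ℝ) ^ (n + 1) ≤ (1 / 2) ^ n := by
    rw [pow_succ]; linarith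
  let X : ℕ → Finset A := fun n => (Finset.range n).image d
  have hX : ∀ {i n}, i < n → d i ∈ X n := fun hi =>
    Finset.mem_image_of_mem _ (Finset.mem_range.2 hi)
  let P : ℕ → unitary (Unitization ℂ A) → Finset A := fun n w => X n ∪ (X n).image (adAut w)
  have hP : ∀ {i n w}, i < n → ∀ a ∈ ({d i, adAut w (d i)} : Set A), a ∈ P n w := by
    rintro i n w hi a (rfl | rfl)
    · exact Finset.mem_union_left _ (hX hi)
    · exact Finset.mem_union_right _ (Finset.mem_image_of_mem _ (hX hi))
  have hP' : ∀ {n w a}, a ∈ P n w → ∃ i < n, a ∈ ({d i, adAut w (d i)} : Set A) := by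
    intro n w a ha
    rcases Finset.mem_union.1 ha with ha | ha
    · obtain ⟨i, hi, rfl⟩ := Finset.mem_image.1 ha
      exact ⟨i, Finset.mem_range.1 hi, by simp⟩
    · obtain ⟨b, hb, rfl⟩ := Finset.mem_image.1 ha
      obtain ⟨i, hi, rfl⟩ := Finset.mem_image.1 hb
      exact ⟨i, Finset.mem_range.1 hi, by simp⟩
  -- Closeness of two actions at γ_h⁻¹ a is closeness of a quotient of the two to the identity at a,
  -- which is the form required by the next correction.
  let I : (G →* (A ≃⋆ₐ[ℂ] A)) → Finset A → Finset A := fun γ P =>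
    (Finset.univ ×ˢ P).image fun p : G × A => (γ p.1)⁻¹ p.2
  have hI : ∀ {γ P a}, a ∈ P → ∀ h, (γ h)⁻¹ a ∈ I γ P := fun ha h =>
    Finset.mem_image.2 ⟨(h, _), Finset.mem_product.2 ⟨Finset.mem_univ _, ha⟩, rfl⟩
  obtain ⟨v', hv1, hv2⟩ := exists_conj_step (α := conjAction (adAut u) α)
    (β := conjAction (adAut v) β) hA
    (fun g => by rw [mk_conjAction_adAut, mk_conjAction_adAut, hαβ]) (hβ.conj _) (P n v) hε
    (fun a ha h => by
      obtain ⟨i, hi, ha⟩ := hP' ha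
      exact hs i hi a ha h) (I (conjAction (adAut u) α) (P n u)) hε
  rw [← conjAction_mul, ← map_mul] at hv1
  obtain ⟨u', hu1, hu2⟩ := exists_conj_step (α := conjAction (adAut (v' * v)) β)
    (β := conjAction (adAut u) α) hA
    (fun g => by rw [mk_conjAction_adAut, mk_conjAction_adAut, hαβ]) (hα.conj _) (P n u) hε
    (fun a ha h => by
      have h1 := hv1 _ (hI (γ := conjAction (adAut u) α) ha h) h
      rwa [aut_apply_inv_apply] at h1)
    (X (n + 1) ∪ I (conjAction (adAut (v' * v)) β) (P (n + 1) (v' * v))) hε'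
  rw [← conjAction_mul, ← map_mul] at hu1
  refine ⟨(u' * u, v' * v), fun i hi a ha h => ?_, fun i hi => ⟨?_, ?_⟩, fun i hi g => ?_⟩
  · have h1 := hu1 _ (Finset.mem_union_right _ (hI (γ := conjAction (adAut (v' * v)) β)
      (hP hi a ha) h)) h
    rwa [aut_apply_inv_apply] at h1
  · refine norm_adAut_mul_sub_le fun a ha => ?_
    have h1 := hu2 a (hP hi a ha)
    linarith
  · refine norm_adAut_mul_sub_le fun a ha => ?_
    have h1 := hv2 a (hP hi a ha)
    linarith
  · exact hu1 _ (Finset.mem_union_left _ (hX (by omega))) g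

/-- Rokhlin actions that are pointwise approximately unitarily equivalent are conjugate. -/
theorem exists_conj_of_hasRokhlinMap (hA : HasApproxPolar A) {α β : G →* (A ≃⋆ₐ[ℂ] A)}
    (hαβ : ∀ g, (approxUnitaryCon A).mk' (α g) = (approxUnitaryCon A).mk' (β g))
    (hα : HasRokhlinMap α) (hβ : HasRokhlinMap β) :
    ∃ σ : A ≃⋆ₐ[ℂ] A, ∀ g, β g = σ * α g * σ⁻¹ := by
  have hd : DenseRange (TopologicalSpace.denseSeq A) := TopologicalSpace.denseRange_denseSeq A
  set d := TopologicalSpace.denseSeq A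
  choose! step hstep using exists_intertwine_actions hA hαβ hα hβ d
  let s : ℕ → unitary (Unitization ℂ A) × unitary (Unitization ℂ A) :=
    fun n => Nat.rec (1, 1) (fun n x => step n x) n
  have hs : ∀ n, AreClose α β d n (s n) := by
    intro n
    induction n with
    -- The start is free: at stage 0 no elements are tested.
    | zero => exact fun i hi => absurd hi (Nat.not_lt_zero i)
    | succ n ih => exact (hstep n (s n) ih).1
  have hm := fun n => (hstep n (s n) (hs n)).2.1
  have hc := fun n => (hstep n (s n) (hs n)).2.2
  obtain ⟨Θ, hΘ⟩ := exists_limit_aut (θ := fun n => adAut (s n).1) hd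
    (fun n i hi => (hm n i hi).1.1) (fun n i hi => (hm n i hi).1.2)
  obtain ⟨H, hH⟩ := exists_limit_aut (θ := fun n => adAut (s n).2) hd
    (fun n i hi => (hm n i hi).2.1) (fun n i hi => (hm n i hi).2.2)
  have hlim : ∀ (w : ℕ → unitary (Unitization ℂ A)) (Ω : A ≃⋆ₐ[ℂ] A) (γ : G →* (A ≃⋆ₐ[ℂ] A)),
      (∀ a, Tendsto (fun n => adAut (w n) a) atTop (𝓝 (Ω a)) ∧
        Tendsto (fun n => (adAut (w n))⁻¹ a) atTop (𝓝 (Ω⁻¹ a))) → ∀ g a,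
      Tendsto (fun n => conjAction (adAut (w n)) γ g a) atTop (𝓝 (conjAction Ω γ g a)) := by
    intro w Ω γ h g a
    exact tendsto_hom_apply (f := fun n => (adAut (w n) : A →⋆ₙₐ[ℂ] A)) (h _).1
      (((continuous_hom (γ g : A →⋆ₙₐ[ℂ] A)).tendsto _).comp (h a).2)
  have heq : ∀ g, conjAction Θ α g = conjAction H β g := by
    intro g
    have h1 : ∀ i, conjAction Θ α g (d i) = conjAction H β g (d i) := fun i => by
      have h2 := ((hlim _ _ α hΘ g (d i)).sub (hlim _ _ β hH g (d i)))
      have h3 : Tendsto (fun n => conjAction (adAut (s n).1) α g (d i) -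
          conjAction (adAut (s n).2) β g (d i)) atTop (𝓝 0) := by
        rw [← tendsto_add_atTop_iff_nat 1, tendsto_zero_iff_norm_tendsto_zero]
        refine squeeze_zero' (Eventually.of_forall fun _ => norm_nonneg _)
          ((eventually_ge_atTop i).mono fun n hn => (hc n i hn g).le) ?_
        exact (tendsto_pow_atTop_nhds_zero_of_lt_one (by norm_num) (by norm_num)).comp
          (tendsto_add_atTop_nat 1)
      exact sub_eq_zero.1 (tendsto_nhds_unique h2 h3)
    have h2 := hd.equalizer
      (continuous_hom ((conjAction Θ α g : A ≃⋆ₐ[ℂ] A) : A →⋆ₙₐ[ℂ] A))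
      (continuous_hom ((conjAction H β g : A ≃⋆ₐ[ℂ] A) : A →⋆ₙₐ[ℂ] A)) (funext h1)
    ext a
    exact congrFun h2 a
  -- In the limit Θ α Θ⁻¹ = H β H⁻¹, so H⁻¹Θ conjugates α to β.
  refine ⟨H⁻¹ * Θ, fun g => ?_⟩
  have h1 := heq g
  rw [conjAction_apply, conjAction_apply] at h1
  calc β g = H⁻¹ * (H * β g * H⁻¹) * H := by group
    _ = H⁻¹ * Θ * α g * (H⁻¹ * Θ)⁻¹ := by rw [← h1]; group

end Uniqueness

/-! ### The classification -/

section Classification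

variable {G A : Type*} [Group G] [NonUnitalCStarAlgebra A]

theorem MatrixUnits.amp_reindex {ι κ C : Type*} [Fintype ι] [Fintype κ] [NonUnitalCStarAlgebra C]
    (R : MatrixUnits ι A C) (e : κ ≃ ι) : (R.reindex e).amp = R.amp := by
  ext a
  exact Equiv.sum_comp e fun i => R.unit i i a

theorem hasApproxPolar_of_cases (h : IsUnitalAlg A ∨ IsStableAlg A ∨ HasStableRankOne A) :
    HasApproxPolar A :=
  h.elim hasApproxPolar_of_unital fun h =>
    h.elim hasApproxPolar_of_stable hasApproxPolar_of_stableRankOne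

variable [TopologicalSpace.SeparableSpace A] [Finite G]

theorem rokhlinToHom_surjective (hUHF : AbsorbsUHF A (Nat.card G)) (hA : HasApproxPolar A) :
    Function.Surjective (rokhlinToHom G A) := by
  classical
  intro ψ
  have := Fintype.ofFinite G
  obtain ⟨R, hR, hid⟩ := hUHF.exists_matrixUnits hA
  -- Absorption gives matrix units indexed by Fin |G|; they are relabelled by G without changing the
  -- amplification.
  rw [← R.amp_reindex (Finite.equivFin G)] at hR hid
  obtain ⟨γ, hγ, hψ⟩ := exists_rokhlin_lift _ hA hR hid ψ
  exact ⟨⟨γ, hγ⟩, MonoidHom.ext hψ⟩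

/-- A conjugating class lifts to an automorphism σ; replacing α by its conjugate under σ makes the
induced homomorphisms equal, and σ is composed back in at the end. -/
theorem rokhlinToHomClasses_injective (hA : HasApproxPolar A) :
    Function.Injective (rokhlinToHomClasses G A) := by
  have := Fintype.ofFinite G
  intro α β
  refine Quotient.inductionOn₂ α β fun α β h => Quotient.sound ?_
  obtain ⟨x, hx⟩ := Quotient.exact h
  obtain ⟨σ, rfl⟩ := Con.mk'_surjective (c := approxUnitaryCon A) x
  obtain ⟨τ, hτ⟩ := exists_conj_of_hasRokhlinMap hA (α := conjAction σ α.1) (β := β.1)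
    (fun g => by
      rw [conjAction_apply, map_mul, map_mul, map_inv]
      exact (hx g).symm) (α.2.hasRokhlinMap.conj σ) β.2.hasRokhlinMap
  refine ⟨τ * σ, fun g => ?_⟩
  rw [hτ g, conjAction_apply]
  group

end Classification

end CStarRokhlin

end

theorem corollary2p7 {G : Type*} [Group G] [Finite G]
    {A : Type*} [NonUnitalCStarAlgebra A] [TopologicalSpace.SeparableSpace A]
    (hUHF : CStarRokhlin.AbsorbsUHF A (Nat.card G))
    (hA : CStarRokhlin.IsUnitalAlg A ∨ CStarRokhlin.IsStableAlg A ∨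
      CStarRokhlin.HasStableRankOne A) :
    Function.Surjective (CStarRokhlin.rokhlinToHom G A) ∧
      Function.Bijective (CStarRokhlin.rokhlinToHomClasses G A) := by
  have hP := CStarRokhlin.hasApproxPolar_of_cases hA
  have hsurj := CStarRokhlin.rokhlinToHom_surjective hUHF hP
  refine ⟨hsurj, CStarRokhlin.rokhlinToHomClasses_injective hP, fun ψ => ?_⟩
  refine Quotient.inductionOn ψ fun ψ => ?_
  obtain ⟨α, rfl⟩ := hsurj ψ
  exact ⟨Quotient.mk _ α, rfl⟩
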